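/- Let $\Omega\subset\mathbb R^2$ be a bounded polygonal domain, and let $\Omega_1,\Omega_2$ be disjoint connected open sets with $\Omega_1\cup\Omega_2=\Omega\setminus\Gamma$, where $\Gamma=\partial\Omega_1\cap\partial\Omega_2$. Assume that $\Gamma$ lies on a line $L$ and that $\Omega_2$ is the mirror image of $\Omega_1$ in $L$. Let $\mathcal T_h$ be a conforming triangulation of $\Omega$, with mesh size $h$, no element of which is cut by $\Gamma$, and assume that $\mathcal T_h$ is mapped to itself by the reflection in $L$, is shape regular (each element $K$ contains a disc of radius $\sigma\,\mathrm{diam}\,K$) and quasi-uniform ($\tau h\le \mathrm{diam}\,K$ for each $K$), where $\sigma,\tau>0$. Let $W\subset H^1_0(\Omega)$ be the P1 conforming finite element space over $\mathcal T_h$, $W_i=W|_{\Omega_i}$, $V_\Gamma=W|_\Gamma$. For constants $\nu_1,\nu_2>0$ and $f\in L^2(\Omega)$ put $$a_i(u,v)=\int_{\Omega_i}\nu_i\nabla u\cdot\nabla v,\qquad (f,v)_i=\int_{\Omega_i}fv,\qquad \langle u,v\rangle=\int_\Gamma uv .$$ For $\gamma_1,\gamma_2>0$ and $\theta\in\mathbb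 R$, one step of the Robin--Robin algorithm maps $g_1^n\in V_\Gamma$ to $g_1^{n+1}\in V_\Gamma$ as follows: 1. find $u_1^n\in W_1$ with $a_1(u_1^n,v)+\gamma_1\langle u_1^n,v\rangle=(f,v)_1+\langle g_1^n,v\rangle$ for all $v\in W_1$; 2. $g_2^n=(\gamma_1+\gamma_2)u_1^n|_\Gamma-g_1^n$; 3. find $u_2^n\in W_2$ with $a_2(u_2^n,v)+\gamma_2\langle u_2^n,v\rangle=(f,v)_2+\langle g_2^n,v\rangle$ for all $v\in W_2$; 4. $\tilde g_1^n=(\gamma_1+\gamma_2)u_2^n|_\Gamma-g_2^n$; 5. $g_1^{n+1}=\theta\tilde g_1^n+(1-\theta)g_1^n$. Let $u\in W$ be the finite element solution, i.e. $a_1(u,v)+a_2(u,v)=(f,v)_1+(f,v)_2$ for all $v\in W$, and let $g^*\in V_\Gamma$ be the exact Robin datum, i.e. the datum for which $u|_{\Omega_1}$ solves the problem in 1. The error operator of the algorithm is the linear operator $R$ on $V_\Gamma$, independent of $f$, with $g_1^{n+1}-g^*=R(g_1^n-g^*)$. The convergence rate is the spectral radius of $R$. **Theorem.** There are constants $c_0,C_1>0$,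 depending only on $\Omega,\Omega_1,\Omega_2,\sigma,\tau$ (not on the mesh, $h$, $\nu_1,\nu_2,\gamma_1,\gamma_2$), such that for every such mesh $\mathcal T_h$ and all $\nu_1,\nu_2>0$, if $$\gamma_1\ge C_1\nu_2h^{-1},\qquad 0<\gamma_2\le c_0\nu_1,\qquad \theta=\frac{2}{2+\nu_1/\nu_2},$$ then for every $f\in L^2(\Omega)$ the exact datum $g^*$ exists and the algorithm is well defined (each step has exactly one result), it has an error operator $R$ as above, and its convergence rate is strictly less than $\dfrac{\nu_1}{2\nu_2}$. In particular it is bounded by $C\nu_1/\nu_2$ with $C=1/2$. -/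

import Mathlib

open MeasureTheory

noncomputable section

namespace RobinRobin

/-- The Euclidean plane. -/
abbrev Plane : Type := EuclideanSpace ℝ (Fin 2)

/-! ### Geometry -/

/-- A bounded polygonal domain: a nonempty, connected, bounded open set whose boundary is a finite
union of nondegenerate line segments. -/
structure IsPolygonalDomain (Ω : Set Plane) : Prop where
  isOpen : IsOpen Ω
  isConnected : IsConnected Ω
  isBounded : Bornology.IsBounded Ω
  polygonal : ∃ S : Finset (Plane × Plane), (∀ e ∈ S, e.1 ≠ e.2) ∧
    frontier Ω = ⋃ e ∈ S, segment ℝ e.1 e.2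

/-- The common interface `Γ = ∂Ω₁ ∩ ∂Ω₂`. -/
def interface (Ω₁ Ω₂ : Set Plane) : Set Plane := frontier Ω₁ ∩ frontier Ω₂

/-- `Ω₁`, `Ω₂` are nonoverlapping subdomains decomposing the polygonal domain `Ω`: disjoint
connected open sets with `Ω \ Γ = Ω₁ ∪ Ω₂`. -/
structure IsDecomposition (Ω Ω₁ Ω₂ : Set Plane) : Prop where
  polygonal : IsPolygonalDomain Ω
  isOpen₁ : IsOpen Ω₁
  isOpen₂ : IsOpen Ω₂
  isConnected₁ : IsConnected Ω₁
  isConnected₂ : IsConnected Ω₂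
  disjoint : Disjoint Ω₁ Ω₂
  union_eq : Ω₁ ∪ Ω₂ = Ω \ interface Ω₁ Ω₂

/-- `Ω₁` and `Ω₂` are mirror images of each other in the line `L`, and `L` carries the interface. -/
structure IsMirrorSymmetric (Ω₁ Ω₂ : Set Plane) (L : AffineSubspace ℝ Plane) [Nonempty L] :
    Prop where
  isLine : Module.finrank ℝ L.direction = 1
  interface_subset : interface Ω₁ Ω₂ ⊆ (L : Set Plane)
  image_eq : EuclideanGeometry.reflection L '' Ω₁ = Ω₂

/-! ### Meshes

A mesh is a finite set of triangles, a triangle being given by the finite set `K` of its vertices;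
the closed triangle is `convexHull ℝ (K : Set Plane)`. -/

/-- `T` is a (conforming) triangulation of `Ω`, no element of which is cut by the interface of
`Ω₁` and `Ω₂`. -/
structure IsTriangulation (T : Finset (Finset Plane)) (Ω Ω₁ Ω₂ : Set Plane) : Prop where
  card_eq : ∀ K ∈ T, K.card = 3
  indep : ∀ K ∈ T, AffineIndependent ℝ (fun p : K => (p : Plane))
  /-- two elements meet in a common face, or not at all -/
  inter_subset : ∀ K ∈ T, ∀ K' ∈ T,
    convexHull ℝ (K : Set Plane) ∩ convexHull ℝ (K' : Set Plane) ⊆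
      convexHull ℝ ((K : Set Plane) ∩ (K' : Set Plane))
  cover : ⋃ K ∈ T, convexHull ℝ (K : Set Plane) = closure Ω
  /-- the boundary of `Ω` is a union of element edges -/
  boundary : ∀ x ∈ frontier Ω, ∃ K ∈ T, ∃ p ∈ K, ∃ q ∈ K, p ≠ q ∧
    x ∈ segment ℝ p q ∧ segment ℝ p q ⊆ frontier Ω
  /-- the interface cuts through no element -/
  uncut : ∀ K ∈ T, convexHull ℝ (K : Set Plane) ⊆ closure Ω₁ ∨
    convexHull ℝ (K : Set Plane) ⊆ closure Ω₂

/-- The mesh size: the largest diameter of an element. -/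
def meshSize (T : Finset (Finset Plane)) : ℝ :=
  ⨆ K : T, Metric.diam (convexHull ℝ ((K : Finset Plane) : Set Plane))

/-- Shape regularity with constant `σ`: each element `K` contains a disc of radius
`σ * diam K`. -/
def IsShapeRegular (σ : ℝ) (T : Finset (Finset Plane)) : Prop :=
  ∀ K ∈ T, ∃ x : Plane,
    Metric.closedBall x (σ * Metric.diam (convexHull ℝ (K : Set Plane))) ⊆
      convexHull ℝ (K : Set Plane)

/-- Quasi-uniformity with constant `τ`: `τ * h ≤ diam K` for each element `K`. -/
def IsQuasiUniform (τ : ℝ) (T : Finset (Finset Plane)) : Prop :=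
  ∀ K ∈ T, τ * meshSize T ≤ Metric.diam (convexHull ℝ (K : Set Plane))

/-- The mesh is mapped to itself by the reflection in `L`. -/
def IsMirrorSymmetricMesh (T : Finset (Finset Plane)) (L : AffineSubspace ℝ Plane) [Nonempty L] :
    Prop :=
  ∀ K ∈ T, K.map (EuclideanGeometry.reflection L).toEquiv.toEmbedding ∈ T

/-! ### Finite element spaces

A function on a subset of the plane is represented by its extension by zero to the plane. -/

/-- The P1 conforming finite element space `W ⊂ H₀¹(Ω)`: continuous functions that are affine on
every element and vanish on `∂Ω` (extended by zero outside `Ω`). -/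
def feSpace (T : Finset (Finset Plane)) (Ω : Set Plane) : Submodule ℝ (Plane → ℝ) where
  carrier := {u | Continuous u ∧ (∀ x, x ∉ Ω → u x = 0) ∧
    ∀ K ∈ T, ∃ A : Plane →ᵃ[ℝ] ℝ, ∀ x ∈ convexHull ℝ (K : Set Plane), u x = A x}
  zero_mem' := ⟨continuous_const, fun _ _ => rfl, fun _ _ => ⟨0, fun _ _ => rfl⟩⟩
  add_mem' := by
    rintro u v ⟨hu, hu0, huA⟩ ⟨hv, hv0, hvA⟩
    refine ⟨hu.add hv, fun x hx => by simp [hu0 x hx, hv0 x hx], fun K hK => ?_⟩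
    obtain ⟨A, hA⟩ := huA K hK
    obtain ⟨B, hB⟩ := hvA K hK
    exact ⟨A + B, fun x hx => by simp [hA x hx, hB x hx]⟩
  smul_mem' := by
    rintro c u ⟨hu, hu0, huA⟩
    refine ⟨hu.const_smul c, fun x hx => by simp [hu0 x hx], fun K hK => ?_⟩
    obtain ⟨A, hA⟩ := huA K hK
    exact ⟨c • A, fun x hx => by simp [hA x hx]⟩

/-- Restriction of functions to the set `s`. -/
def restrictTo (s : Set Plane) : (Plane → ℝ) →ₗ[ℝ] (Plane → ℝ) where
  toFun u := s.indicator u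
  map_add' u v := Set.indicator_add s u v
  map_smul' c u := Set.indicator_const_smul s c u

/-- The space `W_i` of the restrictions to the closed subdomain `closure D` of the functions
in `W`. -/
def localSpace (T : Finset (Finset Plane)) (Ω D : Set Plane) : Submodule ℝ (Plane → ℝ) :=
  (feSpace T Ω).map (restrictTo (closure D))

/-- The space `V_Γ = W|_Γ`. -/
def interfaceSpace (T : Finset (Finset Plane)) (Ω Γ : Set Plane) : Submodule ℝ (Plane → ℝ) :=
  (feSpace T Ω).map (restrictTo Γ)

/-! ### Forms -/

/-- `∫_D ν ∇u · ∇v`. -/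
def energy (D : Set Plane) (ν : ℝ) (u v : Plane → ℝ) : ℝ :=
  ∫ x in D, ν * inner ℝ (gradient u x) (gradient v x)

/-- `∫_D f v`. -/
def load (D : Set Plane) (f v : Plane → ℝ) : ℝ := ∫ x in D, f x * v x

/-- `⟨u, v⟩ = ∫_Γ u v`, with respect to arc length. -/
def pairing (Γ : Set Plane) (u v : Plane → ℝ) : ℝ :=
  ∫ x in Γ, u x * v x ∂(Measure.hausdorffMeasure (1 : ℝ))

/-! ### The Robin–Robin algorithm -/

/-- `u ∈ W_i` solves the discrete problem in the subdomain `D` with coefficient `ν`, source `f` and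
Robin condition with parameter `γ` and datum `g` on the interface `Γ`. -/
def IsRobinSolution (T : Finset (Finset Plane)) (Ω D Γ : Set Plane) (ν γ : ℝ)
    (f g u : Plane → ℝ) : Prop :=
  u ∈ localSpace T Ω D ∧
    ∀ v ∈ localSpace T Ω D, energy D ν u v + γ * pairing Γ u v = load D f v + pairing Γ g v

/-- One step `g₁ⁿ = g ↦ g' = g₁ⁿ⁺¹` of the Robin–Robin algorithm with source `f`, Robin parameters
`γ₁`, `γ₂` and relaxation parameter `θ`. -/
def IsRRStep (T : Finset (Finset Plane)) (Ω Ω₁ Ω₂ : Set Plane) (ν₁ ν₂ γ₁ γ₂ θ : ℝ)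
    (f g g' : Plane → ℝ) : Prop :=
  ∃ u₁ g₂ u₂ gt : Plane → ℝ,
    IsRobinSolution T Ω Ω₁ (interface Ω₁ Ω₂) ν₁ γ₁ f g u₁ ∧
    g₂ = (γ₁ + γ₂) • restrictTo (interface Ω₁ Ω₂) u₁ - g ∧
    IsRobinSolution T Ω Ω₂ (interface Ω₁ Ω₂) ν₂ γ₂ f g₂ u₂ ∧
    gt = (γ₁ + γ₂) • restrictTo (interface Ω₁ Ω₂) u₂ - g₂ ∧
    g' = θ • gt + (1 - θ) • g

/-- `u` is the finite element solution of the model problem `-∇·(ν∇u) = f` in `Ω`, `u = 0` on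
`∂Ω`, where `ν = ν_i` in `Ω_i`. -/
def IsDiscreteSolution (T : Finset (Finset Plane)) (Ω Ω₁ Ω₂ : Set Plane) (ν₁ ν₂ : ℝ)
    (f u : Plane → ℝ) : Prop :=
  u ∈ feSpace T Ω ∧ ∀ v ∈ feSpace T Ω,
    energy Ω₁ ν₁ u v + energy Ω₂ ν₂ u v = load Ω₁ f v + load Ω₂ f v

/-- `g` is the exact Robin datum, that is, the datum for which the Robin problem in `Ω₁` is solved
by the restriction to `Ω₁` of the finite element solution of the model problem. -/
def IsExactDatum (T : Finset (Finset Plane)) (Ω Ω₁ Ω₂ : Set Plane) (ν₁ ν₂ γ₁ : ℝ)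
    (f g : Plane → ℝ) : Prop :=
  ∃ u : Plane → ℝ, IsDiscreteSolution T Ω Ω₁ Ω₂ ν₁ ν₂ f u ∧
    IsRobinSolution T Ω Ω₁ (interface Ω₁ Ω₂) ν₁ γ₁ f g (restrictTo (closure Ω₁) u)

/-- The linear operator `R` on `V_Γ` is the error operator of the Robin–Robin algorithm: for every
source `f ∈ L²(Ω)` the exact datum `g*` exists, every `g` in `V_Γ` has exactly one successor `g'`,
and `g' - g* = R (g - g*)`. -/
def IsRRErrorOperator (T : Finset (Finset Plane)) (Ω Ω₁ Ω₂ : Set Plane) (ν₁ ν₂ γ₁ γ₂ θ : ℝ)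
    (R : Module.End ℝ (interfaceSpace T Ω (interface Ω₁ Ω₂))) : Prop :=
  ∀ f : Plane → ℝ, MemLp f 2 (volume.restrict Ω) →
    ∃ gstar : interfaceSpace T Ω (interface Ω₁ Ω₂),
      IsExactDatum T Ω Ω₁ Ω₂ ν₁ ν₂ γ₁ f gstar ∧
      ∀ g g' : interfaceSpace T Ω (interface Ω₁ Ω₂),
        IsRRStep T Ω Ω₁ Ω₂ ν₁ ν₂ γ₁ γ₂ θ f g g' ↔ g' - gstar = R (g - gstar)

/-- The convergence rate of the iteration with error operator `R`: the spectral radius of `R`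
(taken over `ℂ`, so that non-real eigenvalues count). -/
def convergenceRate {V : Type*} [AddCommGroup V] [Module ℝ V] (R : Module.End ℝ V) : ENNReal :=
  spectralRadius ℂ (LinearMap.baseChange ℂ R : Module.End ℂ (TensorProduct ℝ ℂ V))

end RobinRobin

end

noncomputable section

namespace RobinRobin

/-! ### Linear algebra -/

section LinearAlgebra

/-! Let `N` be the discrete Neumann-to-Dirichlet operator of the first subdomain with coefficient
one. It is self-adjoint and positive for the interface pairing, so the trace space has a basis of
eigenvectors with eigenvalues `μ > 0`. Mirror symmetry gives the second subdomain the same operator,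
and coefficients and Robin parameters only rescale it: on an eigenvector, both Robin-to-Dirichlet
maps are multiplication by `μ / (ν + γ * μ)` (`MirrorSplitting.exists_basis`). The error operator is
therefore diagonal in this basis, and its spectral radius is a question about a scalar function of
`μ`.

Two estimates locate `μ`. The trace inequality (`integral_sq_le_energy`) bounds it above by a
constant `M` of the geometry: on each normal to the mirror line, a function vanishing off `Ω` is
controlled by its derivative up to the first exit from `Ω`. The inverse estimate (`exists_lift`)
bounds `1 / μ` above by a multiple of `1 / h`: interpolating a trace by zero at all vertices off the
mirror line gives a lift of small enough energy. The conditions on the Robin parameters then say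
exactly what is needed, `ν₂ ≤ γ₁ * μ` and `γ₂ * μ ≤ ν₁`.

Under these inequalities the unrelaxed step has eigenvalue `-Z` with `0 ≤ Z ≤ κ`, where `κ = ν₁ /
ν₂`. The relaxed eigenvalue `1 - θ * (1 + Z)` equals `(κ - 2 * Z) / (2 + κ)` for the given `θ`. This
choice equalizes the moduli at the two ends of the interval, so the rate is at most `κ / (2 + κ)`,
strictly below `κ / 2` (`MirrorSplitting.abs_eigenvalue_le`).

The algebra takes place in `MirrorSplitting`; the rest shows that the finite element spaces form
such a splitting. There, Lipschitz continuity of finite element functions provides almost everywhere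
differentiability, and orthonormal coordinates along the mirror line turn interface integrals into
integrals over `ℝ`. -/

/-- The spectral radius of a diagonalizable real operator is bounded by its eigenvalues. -/
theorem convergenceRate_le_of_eigenbasis {V ι : Type*} [AddCommGroup V] [Module ℝ V] [Fintype ι]
    [DecidableEq ι] (v : Module.Basis ι ℝ V) (R : Module.End ℝ V) (ρ : ι → ℝ) (r : ℝ)
    (hR : ∀ i, R (v i) = ρ i • v i) (hρ : ∀ i, |ρ i| ≤ r) :
    convergenceRate R ≤ ENNReal.ofReal r := by
  have hM : LinearMap.toMatrix v v R = Matrix.diagonal ρ := by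
    ext i j
    simp [LinearMap.toMatrix_apply, hR, Matrix.diagonal_apply, Finsupp.single_apply, eq_comm]
    split_ifs with h
    · rw [h]
    · rfl
  have hM' : LinearMap.toMatrix (Algebra.TensorProduct.basis ℂ v) (Algebra.TensorProduct.basis ℂ v) (R.baseChange ℂ) =
      Matrix.diagonal (fun i => (ρ i : ℂ)) := by
    rw [LinearMap.toMatrix_baseChange, hM]
    ext i j
    by_cases h : i = j <;> simp [h]
  -- The real eigenbasis stays an eigenbasis after complexification, so no non-real eigenvalues
  -- appear.
  have hs : spectrum ℂ (LinearMap.baseChange ℂ R : Module.End ℂ (TensorProduct ℝ ℂ V)) =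
      Set.range (fun i => (ρ i : ℂ)) := by
    rw [← spectrum_diagonal, ← hM']
    exact (AlgEquiv.spectrum_eq (LinearMap.toMatrixAlgEquiv (Algebra.TensorProduct.basis ℂ v)) _).symm
  unfold convergenceRate spectralRadius
  rw [hs]
  refine iSup₂_le ?_
  rintro _ ⟨i, rfl⟩
  change ‖(ρ i : ℂ)‖ₑ ≤ _
  rw [← ofReal_norm]
  exact ENNReal.ofReal_le_ofReal (by simpa using hρ i)

/-- The isomorphism between the dual space and the space given by an anisotropic form. -/
def solve {X : Type*} [AddCommGroup X] [Module ℝ X] [FiniteDimensional ℝ X]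
    (B : X →ₗ[ℝ] X →ₗ[ℝ] ℝ) (hB : ∀ x, B x x = 0 → x = 0) : (X →ₗ[ℝ] ℝ) ≃ₗ[ℝ] X :=
  (LinearEquiv.ofInjectiveOfFinrankEq B
    ((injective_iff_map_eq_zero B).2 fun x hx => hB x (by simp [hx]))
    (Subspace.dual_finrank_eq (K := ℝ) (V := X)).symm).symm

theorem solve_eq_iff {X : Type*} [AddCommGroup X] [Module ℝ X] [FiniteDimensional ℝ X]
    (B : X →ₗ[ℝ] X →ₗ[ℝ] ℝ) (hB : ∀ x, B x x = 0 → x = 0) (φ : X →ₗ[ℝ] ℝ) (x : X) :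
    solve B hB φ = x ↔ ∀ y, B x y = φ y := by
  rw [solve, LinearEquiv.symm_apply_eq]
  constructor
  · rintro rfl y; rfl
  · intro h; ext y; exact (h y).symm

theorem solve_spec {X : Type*} [AddCommGroup X] [Module ℝ X] [FiniteDimensional ℝ X]
    (B : X →ₗ[ℝ] X →ₗ[ℝ] ℝ) (hB : ∀ x, B x x = 0 → x = 0) (φ : X →ₗ[ℝ] ℝ) (y : X) :
    B (solve B hB φ) y = φ y := (solve_eq_iff B hB φ _).1 rfl y

/-- Simultaneous diagonalization: an operator that is self-adjoint for a positive definite form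
has an eigenbasis. -/
theorem exists_eigenbasis {V : Type*} [AddCommGroup V] [Module ℝ V] [FiniteDimensional ℝ V]
    (b : V →ₗ[ℝ] V →ₗ[ℝ] ℝ) (hsymm : ∀ x y, b x y = b y x) (hnn : ∀ x, 0 ≤ b x x)
    (hdef : ∀ x, b x x = 0 → x = 0) (N : Module.End ℝ V) (hN : ∀ x y, b (N x) y = b x (N y)) :
    ∃ (v : Module.Basis (Fin (Module.finrank ℝ V)) ℝ V) (μ : Fin (Module.finrank ℝ V) → ℝ),
      ∀ i, N (v i) = μ i • v i := by
  let core : InnerProductSpace.Core ℝ V :=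
    { inner := fun x y => b x y
      conj_inner_symm := fun x y => by simp [hsymm y x]
      re_inner_nonneg := fun x => by simpa using hnn x
      add_left := fun x y z => by simp
      smul_left := fun x y r => by simp
      definite := fun x hx => hdef x hx }
  let : NormedAddCommGroup V := core.toNormedAddCommGroup
  let : InnerProductSpace ℝ V := InnerProductSpace.ofCore core.toCore
  have hs : N.IsSymmetric := fun x y => hN x y
  exact ⟨(hs.eigenvectorBasis rfl).toBasis, hs.eigenvalues rfl, fun i => by
    simp [hs.apply_eigenvectorBasis rfl i]⟩

/-- The Robin form `ν a(x, y) + γ b(tr x, tr y)`. -/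
def robinForm {X V : Type*} [AddCommGroup X] [Module ℝ X] [AddCommGroup V] [Module ℝ V]
    (a : X →ₗ[ℝ] X →ₗ[ℝ] ℝ) (b : V →ₗ[ℝ] V →ₗ[ℝ] ℝ) (tr : X →ₗ[ℝ] V) (ν γ : ℝ) :
    X →ₗ[ℝ] X →ₗ[ℝ] ℝ := ν • a + γ • b.compl₁₂ tr tr

theorem robinForm_apply {X V : Type*} [AddCommGroup X] [Module ℝ X] [AddCommGroup V] [Module ℝ V]
    (a : X →ₗ[ℝ] X →ₗ[ℝ] ℝ) (b : V →ₗ[ℝ] V →ₗ[ℝ] ℝ) (tr : X →ₗ[ℝ] V) (ν γ : ℝ) (x y : X) :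
    robinForm a b tr ν γ x y = ν * a x y + γ * b (tr x) (tr y) := rfl

/-- An abstract splitting of a discrete problem on `W` into problems on `X₁` and `X₂` that are
coupled through the traces in `V` and are mirror images of each other under `J`. -/
structure MirrorSplitting (W X₁ X₂ V : Type*) [AddCommGroup W] [Module ℝ W]
    [AddCommGroup X₁] [Module ℝ X₁] [AddCommGroup X₂] [Module ℝ X₂]
    [AddCommGroup V] [Module ℝ V] where
  r₁ : W →ₗ[ℝ] X₁
  r₂ : W →ₗ[ℝ] X₂
  tr₁ : X₁ →ₗ[ℝ] V
  tr₂ : X₂ →ₗ[ℝ] V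
  a₁ : X₁ →ₗ[ℝ] X₁ →ₗ[ℝ] ℝ
  a₂ : X₂ →ₗ[ℝ] X₂ →ₗ[ℝ] ℝ
  b : V →ₗ[ℝ] V →ₗ[ℝ] ℝ
  J : X₁ → X₂
  tr_J : ∀ x, tr₂ (J x) = tr₁ x
  a_J : ∀ x y, a₂ (J x) (J y) = a₁ x y
  J_surj : Function.Surjective J
  r₂_surj : Function.Surjective r₂
  tr₁_surj : Function.Surjective tr₁
  tr_r : ∀ w, tr₁ (r₁ w) = tr₂ (r₂ w)
  glue : ∀ x, tr₁ x = 0 → ∃ w, r₁ w = x ∧ r₂ w = 0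
  r_inj : ∀ w, r₁ w = 0 → r₂ w = 0 → w = 0
  a_symm : ∀ x y, a₁ x y = a₁ y x
  a_nonneg : ∀ x, 0 ≤ a₁ x x
  a_def : ∀ x, a₁ x x = 0 → x = 0
  b_symm : ∀ x y, b x y = b y x
  b_nonneg : ∀ x, 0 ≤ b x x
  b_def : ∀ x, b x x = 0 → x = 0

/-! ### The Robin–Robin iteration for an abstract mirror splitting. -/

namespace MirrorSplitting

variable {W X₁ X₂ V : Type*} [AddCommGroup W] [Module ℝ W]
    [AddCommGroup X₁] [Module ℝ X₁] [AddCommGroup X₂] [Module ℝ X₂]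
    [AddCommGroup V] [Module ℝ V] (D : MirrorSplitting W X₁ X₂ V)

/-- Linearity of `J` is not part of the structure. A preimage of zero has zero energy because `J`
preserves the form, hence it is zero itself. -/
theorem J_eq_zero {x : X₁} (hx : x = 0) : D.J x = 0 := by
  obtain ⟨y, hy⟩ := D.J_surj 0
  have : y = 0 := D.a_def y (by rw [← D.a_J, hy]; simp)
  rw [hx, ← this, hy]

theorem a₂_nonneg (x : X₂) : 0 ≤ D.a₂ x x := by
  obtain ⟨y, rfl⟩ := D.J_surj x
  rw [D.a_J]; exact D.a_nonneg y

theorem a₂_def (x : X₂) (hx : D.a₂ x x = 0) : x = 0 := by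
  obtain ⟨y, rfl⟩ := D.J_surj x
  rw [D.a_J] at hx
  exact D.J_eq_zero (D.a_def y hx)

theorem robin_def₁ {ν γ : ℝ} (hν : 0 < ν) (hγ : 0 ≤ γ) (x : X₁)
    (hx : robinForm D.a₁ D.b D.tr₁ ν γ x x = 0) : x = 0 := by
  rw [robinForm_apply] at hx
  have h1 := mul_nonneg hν.le (D.a_nonneg x)
  have h2 := mul_nonneg hγ (D.b_nonneg (D.tr₁ x))
  exact D.a_def x ((mul_eq_zero.1 (by linarith : ν * D.a₁ x x = 0)).resolve_left hν.ne')

theorem robin_def₂ {ν γ : ℝ} (hν : 0 < ν) (hγ : 0 ≤ γ) (x : X₂)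
    (hx : robinForm D.a₂ D.b D.tr₂ ν γ x x = 0) : x = 0 := by
  rw [robinForm_apply] at hx
  have h1 := mul_nonneg hν.le (D.a₂_nonneg x)
  have h2 := mul_nonneg hγ (D.b_nonneg (D.tr₂ x))
  exact D.a₂_def x ((mul_eq_zero.1 (by linarith : ν * D.a₂ x x = 0)).resolve_left hν.ne')

/-- The solution operator of the homogeneous Robin problem in the first subdomain. -/
def robin₁ [FiniteDimensional ℝ X₁] {ν γ : ℝ} (hν : 0 < ν) (hγ : 0 ≤ γ) : V →ₗ[ℝ] X₁ :=
  (solve _ (D.robin_def₁ hν hγ)).toLinearMap ∘ₗ D.b.compl₂ D.tr₁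

/-- The solution operator of the homogeneous Robin problem in the second subdomain. -/
def robin₂ [FiniteDimensional ℝ X₂] {ν γ : ℝ} (hν : 0 < ν) (hγ : 0 ≤ γ) : V →ₗ[ℝ] X₂ :=
  (solve _ (D.robin_def₂ hν hγ)).toLinearMap ∘ₗ D.b.compl₂ D.tr₂

theorem robin₁_eq_iff [FiniteDimensional ℝ X₁] {ν γ : ℝ} (hν : 0 < ν) (hγ : 0 ≤ γ) (g : V) (x : X₁) :
    D.robin₁ hν hγ g = x ↔
      ∀ y, ν * D.a₁ x y + γ * D.b (D.tr₁ x) (D.tr₁ y) = D.b g (D.tr₁ y) :=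
  solve_eq_iff _ (D.robin_def₁ hν hγ) _ _

theorem robin₂_eq_iff [FiniteDimensional ℝ X₂] {ν γ : ℝ} (hν : 0 < ν) (hγ : 0 ≤ γ) (g : V) (x : X₂) :
    D.robin₂ hν hγ g = x ↔
      ∀ y, ν * D.a₂ x y + γ * D.b (D.tr₂ x) (D.tr₂ y) = D.b g (D.tr₂ y) :=
  solve_eq_iff _ (D.robin_def₂ hν hγ) _ _

/-- There is a basis of the trace space that diagonalizes the Robin-to-Dirichlet operators of both
subdomains for all parameters; its eigenvalues `μ` of the Neumann-to-Dirichlet operator are bounded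
by the constants of the trace inequality and of the inverse inequality. -/
theorem exists_basis [FiniteDimensional ℝ X₁] [FiniteDimensional ℝ X₂] [FiniteDimensional ℝ V]
    {c Λ : ℝ} (hc : ∀ x, c * D.b (D.tr₁ x) (D.tr₁ x) ≤ D.a₁ x x)
    (hΛ : ∀ v, ∃ x, D.tr₁ x = v ∧ D.a₁ x x ≤ Λ * D.b v v) :
    ∃ (v : Module.Basis (Fin (Module.finrank ℝ V)) ℝ V) (μ : Fin (Module.finrank ℝ V) → ℝ),
      ∀ i, 0 < μ i ∧ c * μ i ≤ 1 ∧ 1 ≤ Λ * μ i ∧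
        ∀ (ν γ : ℝ) (hν : 0 < ν) (hγ : 0 ≤ γ),
          D.tr₁ (D.robin₁ hν hγ (v i)) = (μ i / (ν + γ * μ i)) • v i ∧
          D.tr₂ (D.robin₂ hν hγ (v i)) = (μ i / (ν + γ * μ i)) • v i := by
  -- With `ν = 1` and `γ = 0` the Robin problem is the Neumann problem, so `D.tr₁ ∘ₗ E` is the
  -- Neumann-to-Dirichlet operator.
  have h01 : (0 : ℝ) < 1 := one_pos
  set E := D.robin₁ h01 le_rfl with hE
  have hEs : ∀ g y, D.a₁ (E g) y = D.b g (D.tr₁ y) := fun g y => by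
    simpa using (D.robin₁_eq_iff h01 le_rfl g _).1 rfl y
  obtain ⟨v, μ, hv⟩ := exists_eigenbasis D.b D.b_symm D.b_nonneg D.b_def (D.tr₁ ∘ₗ E)
    (fun x y => by
      simp only [LinearMap.comp_apply]
      rw [D.b_symm, ← hEs, ← hEs, D.a_symm])
  refine ⟨v, μ, fun i => ?_⟩
  have htr : D.tr₁ (E (v i)) = μ i • v i := hv i
  have hb : 0 < D.b (v i) (v i) :=
    lt_of_le_of_ne (D.b_nonneg _) fun h => v.ne_zero i (D.b_def _ h.symm)
  have haE : D.a₁ (E (v i)) (E (v i)) = μ i * D.b (v i) (v i) := by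
    rw [hEs, htr]; simp
  have hμ : 0 < μ i := by
    have h0 : E (v i) ≠ 0 := by
      intro h0
      obtain ⟨x, hx⟩ := D.tr₁_surj (v i)
      have := hEs (v i) x
      rw [h0, hx] at this
      simp at this
      exact hb.ne this
    have h1 : 0 < D.a₁ (E (v i)) (E (v i)) :=
      lt_of_le_of_ne (D.a_nonneg _) fun h => h0 (D.a_def _ h.symm)
    rw [haE] at h1
    exact pos_of_mul_pos_left h1 hb.le
  refine ⟨hμ, ?_, ?_, fun ν γ hν hγ => ?_⟩
  · have := hc (E (v i))
    rw [haE, htr] at this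
    simp only [map_smul, LinearMap.smul_apply, smul_eq_mul] at this
    have h2 : (c * μ i) * (μ i * D.b (v i) (v i)) ≤ 1 * (μ i * D.b (v i) (v i)) := by linarith
    exact le_of_mul_le_mul_right h2 (mul_pos hμ hb)
  · obtain ⟨x, hx, hxΛ⟩ := hΛ (v i)
    -- Expanding this square is Cauchy–Schwarz for the energy. It compares the Neumann solution with
    -- an arbitrary lift `x` of `v i` and gives `b v v ≤ μ * a x x`.
    have h1 := D.a_nonneg (E (v i) - μ i • x)
    have h2 : D.a₁ (E (v i)) x = D.b (v i) (v i) := by rw [hEs, hx]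
    have h3 : D.a₁ x (E (v i)) = D.b (v i) (v i) := by rw [D.a_symm, h2]
    simp only [map_sub, map_smul, LinearMap.sub_apply, LinearMap.smul_apply, smul_eq_mul, haE, h2,
      h3] at h1
    have h4 : μ i * D.b (v i) (v i) ≤ μ i * (μ i * D.a₁ x x) := by linarith
    have h5 := le_of_mul_le_mul_left h4 hμ
    have h6 : 1 * D.b (v i) (v i) ≤ (Λ * μ i) * D.b (v i) (v i) := by
      have := mul_le_mul_of_nonneg_left hxΛ hμ.le
      linarith
    exact le_of_mul_le_mul_right h6 hb
  · have hpos : 0 < ν + γ * μ i := by positivity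
    -- The trace of the Neumann solution is a multiple of the datum, so the Robin term only changes
    -- the scalar factor.
    have e1 : D.robin₁ hν hγ (v i) = (ν + γ * μ i)⁻¹ • E (v i) := by
      rw [robin₁_eq_iff]
      intro y
      simp only [map_smul, LinearMap.smul_apply, smul_eq_mul, hEs, htr]
      field_simp
    have e2 : D.robin₂ hν hγ (v i) = (ν + γ * μ i)⁻¹ • D.J (E (v i)) := by
      rw [robin₂_eq_iff]
      intro y
      obtain ⟨y, rfl⟩ := D.J_surj y
      simp only [map_smul, LinearMap.smul_apply, smul_eq_mul, D.a_J, D.tr_J, hEs, htr]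
      field_simp
    rw [e1, e2, map_smul, map_smul, D.tr_J, htr, smul_smul, div_eq_inv_mul]
    exact ⟨rfl, rfl⟩

/-- The existence of the exact datum. -/
theorem exists_exactDatum [FiniteDimensional ℝ W] [FiniteDimensional ℝ V]
    {ν₁ ν₂ : ℝ} (hν₁ : 0 < ν₁) (hν₂ : 0 < ν₂) (γ₁ γ₂ : ℝ)
    (l₁ : X₁ →ₗ[ℝ] ℝ) (l₂ : X₂ →ₗ[ℝ] ℝ) :
    ∃ (g : V) (w : W),
      (∀ z, ν₁ * D.a₁ (D.r₁ w) (D.r₁ z) + ν₂ * D.a₂ (D.r₂ w) (D.r₂ z) =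
        l₁ (D.r₁ z) + l₂ (D.r₂ z)) ∧
      (∀ x, ν₁ * D.a₁ (D.r₁ w) x + γ₁ * D.b (D.tr₁ (D.r₁ w)) (D.tr₁ x) =
        l₁ x + D.b g (D.tr₁ x)) ∧
      (∀ x, ν₂ * D.a₂ (D.r₂ w) x + γ₂ * D.b (D.tr₂ (D.r₂ w)) (D.tr₂ x) =
        l₂ x + D.b ((γ₁ + γ₂) • D.tr₁ (D.r₁ w) - g) (D.tr₂ x)) := by
  let B : W →ₗ[ℝ] W →ₗ[ℝ] ℝ := ν₁ • D.a₁.compl₁₂ D.r₁ D.r₁ + ν₂ • D.a₂.compl₁₂ D.r₂ D.r₂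
  have hBapp : ∀ x y, B x y = ν₁ * D.a₁ (D.r₁ x) (D.r₁ y) + ν₂ * D.a₂ (D.r₂ x) (D.r₂ y) :=
    fun _ _ => rfl
  have hB : ∀ x, B x x = 0 → x = 0 := by
    intro x hx
    rw [hBapp] at hx
    have h1 := mul_nonneg hν₁.le (D.a_nonneg (D.r₁ x))
    have h2 := mul_nonneg hν₂.le (D.a₂_nonneg (D.r₂ x))
    exact D.r_inj x
      (D.a_def _ ((mul_eq_zero.1 (by linarith : ν₁ * D.a₁ _ _ = 0)).resolve_left hν₁.ne'))
      (D.a₂_def _ ((mul_eq_zero.1 (by linarith : ν₂ * D.a₂ _ _ = 0)).resolve_left hν₂.ne'))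
  set w := solve B hB (l₁ ∘ₗ D.r₁ + l₂ ∘ₗ D.r₂) with hw
  have hwz : ∀ z, ν₁ * D.a₁ (D.r₁ w) (D.r₁ z) + ν₂ * D.a₂ (D.r₂ w) (D.r₂ z) =
        l₁ (D.r₁ z) + l₂ (D.r₂ z) := fun z => by
    rw [← hBapp, hw, solve_spec]; rfl
  -- `F` is the residual of the discrete solution in the first Robin problem. By `glue`, test
  -- functions without trace extend by zero to the whole problem, so `F` depends on the trace only,
  -- and `b` represents it by a datum.
  let F : X₁ →ₗ[ℝ] ℝ := robinForm D.a₁ D.b D.tr₁ ν₁ γ₁ (D.r₁ w) - l₁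
  have hFapp : ∀ x, F x = ν₁ * D.a₁ (D.r₁ w) x + γ₁ * D.b (D.tr₁ (D.r₁ w)) (D.tr₁ x) - l₁ x :=
    fun _ => rfl
  have hF : ∀ x, D.tr₁ x = 0 → F x = 0 := by
    intro x hx
    obtain ⟨z, rfl, hz⟩ := D.glue x hx
    have := hwz z
    rw [hz] at this
    rw [hFapp, hx]
    simp at this ⊢
    linarith
  obtain ⟨s, hs⟩ := D.tr₁.exists_rightInverse_of_surjective (LinearMap.range_eq_top.2 D.tr₁_surj)
  have hs' : ∀ v, D.tr₁ (s v) = v := fun v => LinearMap.congr_fun hs v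
  have hFs : ∀ x, F (s (D.tr₁ x)) = F x := fun x => by
    have := hF (s (D.tr₁ x) - x) (by rw [map_sub, hs', sub_self])
    rwa [map_sub, sub_eq_zero] at this
  set g := solve D.b D.b_def (F ∘ₗ s) with hg
  have hgx : ∀ x, D.b g (D.tr₁ x) = F x := fun x => by
    rw [hg, solve_spec, LinearMap.comp_apply, hFs]
  refine ⟨g, w, hwz, fun x => by rw [hgx, hFapp]; ring, fun x => ?_⟩
  -- Testing the global equation with an extension `z` of `x` and eliminating the first subdomain by
  -- the definition of `g` leaves the second Robin problem: the exact solution is a fixed point of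
  -- the iteration.
  obtain ⟨z, rfl⟩ := D.r₂_surj x
  have h1 := hwz z
  have h2 := hgx (D.r₁ z)
  rw [hFapp, D.tr_r, D.tr_r] at h2
  rw [map_sub, map_smul, LinearMap.sub_apply, LinearMap.smul_apply, smul_eq_mul, h2, D.tr_r]
  linarith

/-- The error operator of the Robin–Robin algorithm for the splitting. -/
def errorOperator [FiniteDimensional ℝ X₁] [FiniteDimensional ℝ X₂]
    {ν₁ ν₂ γ₁ γ₂ : ℝ} (hν₁ : 0 < ν₁) (hν₂ : 0 < ν₂) (hγ₁ : 0 ≤ γ₁) (hγ₂ : 0 ≤ γ₂)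
    (θ : ℝ) : Module.End ℝ V :=
  θ • (((γ₁ + γ₂) • (D.tr₂ ∘ₗ D.robin₂ hν₂ hγ₂) - LinearMap.id) ∘ₗ
    ((γ₁ + γ₂) • (D.tr₁ ∘ₗ D.robin₁ hν₁ hγ₁) - LinearMap.id)) + (1 - θ) • LinearMap.id

/-- The error operator describes the propagation of the error in one step. -/
theorem step_iff [FiniteDimensional ℝ X₁] [FiniteDimensional ℝ X₂]
    {ν₁ ν₂ γ₁ γ₂ : ℝ} (hν₁ : 0 < ν₁) (hν₂ : 0 < ν₂) (hγ₁ : 0 ≤ γ₁) (hγ₂ : 0 ≤ γ₂)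
    (θ : ℝ) (l₁ : X₁ →ₗ[ℝ] ℝ) (l₂ : X₂ →ₗ[ℝ] ℝ) (gs : V) (w : W)
    (h₁ : ∀ x, ν₁ * D.a₁ (D.r₁ w) x + γ₁ * D.b (D.tr₁ (D.r₁ w)) (D.tr₁ x) =
        l₁ x + D.b gs (D.tr₁ x))
    (h₂ : ∀ x, ν₂ * D.a₂ (D.r₂ w) x + γ₂ * D.b (D.tr₂ (D.r₂ w)) (D.tr₂ x) =
        l₂ x + D.b ((γ₁ + γ₂) • D.tr₁ (D.r₁ w) - gs) (D.tr₂ x)) (g g' : V) :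
    (∃ (u₁ : X₁) (u₂ : X₂),
      (∀ x, ν₁ * D.a₁ u₁ x + γ₁ * D.b (D.tr₁ u₁) (D.tr₁ x) = l₁ x + D.b g (D.tr₁ x)) ∧
      (∀ x, ν₂ * D.a₂ u₂ x + γ₂ * D.b (D.tr₂ u₂) (D.tr₂ x) =
        l₂ x + D.b ((γ₁ + γ₂) • D.tr₁ u₁ - g) (D.tr₂ x)) ∧
      g' = θ • ((γ₁ + γ₂) • D.tr₂ u₂ - ((γ₁ + γ₂) • D.tr₁ u₁ - g)) + (1 - θ) • g) ↔
    g' - gs = D.errorOperator hν₁ hν₂ hγ₁ hγ₂ θ (g - gs) := by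
  -- Subtracting the fixed point removes the loads. Each half step becomes an equation for the value
  -- of a homogeneous solution operator, which yields existence and uniqueness together.
  have k₁ : ∀ u₁ : X₁,
      (∀ x, ν₁ * D.a₁ u₁ x + γ₁ * D.b (D.tr₁ u₁) (D.tr₁ x) = l₁ x + D.b g (D.tr₁ x)) ↔
      D.robin₁ hν₁ hγ₁ (g - gs) = u₁ - D.r₁ w := by
    intro u₁
    rw [robin₁_eq_iff]
    refine forall_congr' fun x => ?_
    simp only [map_sub, LinearMap.sub_apply]
    have := h₁ x
    constructor <;> intro h <;> linarith
  have k₂ : ∀ (u₁ : X₁) (u₂ : X₂),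
      (∀ x, ν₂ * D.a₂ u₂ x + γ₂ * D.b (D.tr₂ u₂) (D.tr₂ x) =
        l₂ x + D.b ((γ₁ + γ₂) • D.tr₁ u₁ - g) (D.tr₂ x)) ↔
      D.robin₂ hν₂ hγ₂ ((γ₁ + γ₂) • D.tr₁ (u₁ - D.r₁ w) - (g - gs)) = u₂ - D.r₂ w := by
    intro u₁ u₂
    rw [robin₂_eq_iff]
    refine forall_congr' fun x => ?_
    have := h₂ x
    simp only [map_sub, map_smul, LinearMap.sub_apply, LinearMap.smul_apply, smul_eq_mul] at this ⊢
    constructor <;> intro h <;> linarith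
  have hR : ∀ d, D.errorOperator hν₁ hν₂ hγ₁ hγ₂ θ d = θ • ((γ₁ + γ₂) •
      D.tr₂ (D.robin₂ hν₂ hγ₂ ((γ₁ + γ₂) • D.tr₁ (D.robin₁ hν₁ hγ₁ d) - d)) -
      ((γ₁ + γ₂) • D.tr₁ (D.robin₁ hν₁ hγ₁ d) - d)) + (1 - θ) • d := fun _ => rfl
  have hfix : ∀ (u₁ : X₁) (u₂ : X₂),
      g' = θ • ((γ₁ + γ₂) • D.tr₂ u₂ - ((γ₁ + γ₂) • D.tr₁ u₁ - g)) + (1 - θ) • g ↔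
      g' - gs = θ • ((γ₁ + γ₂) • D.tr₂ (u₂ - D.r₂ w) -
        ((γ₁ + γ₂) • D.tr₁ (u₁ - D.r₁ w) - (g - gs))) + (1 - θ) • (g - gs) := by
    intro u₁ u₂
    rw [sub_eq_iff_eq_add, map_sub, map_sub, D.tr_r w]
    have : θ • ((γ₁ + γ₂) • D.tr₂ u₂ - ((γ₁ + γ₂) • D.tr₁ u₁ - g)) + (1 - θ) • g =
      θ • ((γ₁ + γ₂) • (D.tr₂ u₂ - D.tr₂ (D.r₂ w)) -
        ((γ₁ + γ₂) • (D.tr₁ u₁ - D.tr₂ (D.r₂ w)) - (g - gs))) + (1 - θ) • (g - gs) + gs := by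
      module
    rw [this]
  rw [hR]
  constructor
  · rintro ⟨u₁, u₂, e₁, e₂, e₃⟩
    rw [k₁] at e₁
    rw [k₂] at e₂
    rw [hfix] at e₃
    rw [e₁, e₂, e₃]
  · intro h
    set d₁ := D.robin₁ hν₁ hγ₁ (g - gs) with hd₁
    set d₂ := D.robin₂ hν₂ hγ₂ ((γ₁ + γ₂) • D.tr₁ d₁ - (g - gs)) with hd₂
    refine ⟨d₁ + D.r₁ w, d₂ + D.r₂ w, ?_, ?_, ?_⟩
    · rw [k₁, add_sub_cancel_right]
    · rw [k₂, add_sub_cancel_right, add_sub_cancel_right]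
    · rw [hfix, add_sub_cancel_right, add_sub_cancel_right, h]

/-- The bound for the eigenvalues of the error operator. -/
theorem abs_eigenvalue_le {ν₁ ν₂ γ₁ γ₂ θ μ : ℝ} (hν₁ : 0 < ν₁) (hν₂ : 0 < ν₂) (hγ₁ : 0 ≤ γ₁)
    (hγ₂ : 0 ≤ γ₂) (hμ : 0 < μ) (h₁ : ν₂ ≤ γ₁ * μ) (h₂ : γ₂ * μ ≤ ν₁)
    (hθ : θ = 2 / (2 + ν₁ / ν₂)) :
    |θ * (((γ₁ + γ₂) * (μ / (ν₂ + γ₂ * μ)) - 1) * ((γ₁ + γ₂) * (μ / (ν₁ + γ₁ * μ)) - 1)) +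
      (1 - θ)| ≤ (ν₁ / ν₂) / (2 + ν₁ / ν₂) := by
  have hκ : 0 < ν₁ / ν₂ := div_pos hν₁ hν₂
  have p₁ : 0 < ν₁ + γ₁ * μ := by positivity
  have p₂ : 0 < ν₂ + γ₂ * μ := by positivity
  have eX : (γ₁ + γ₂) * (μ / (ν₂ + γ₂ * μ)) - 1 = (γ₁ * μ - ν₂) / (ν₂ + γ₂ * μ) := by
    field_simp; ring
  have eY : (γ₁ + γ₂) * (μ / (ν₁ + γ₁ * μ)) - 1 = (γ₂ * μ - ν₁) / (ν₁ + γ₁ * μ) := by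
    field_simp; ring
  -- The denominators are exchanged because the regrouped factors have separate bounds in terms of
  -- `ν₁ / ν₂` alone: the first lies in `[0, 1]`, the second in `[0, ν₁ / ν₂]`.
  have eXY : ((γ₁ * μ - ν₂) / (ν₂ + γ₂ * μ)) * ((γ₂ * μ - ν₁) / (ν₁ + γ₁ * μ)) =
      -(((γ₁ * μ - ν₂) / (ν₁ + γ₁ * μ)) * ((ν₁ - γ₂ * μ) / (ν₂ + γ₂ * μ))) := by
    field_simp; ring
  have x0 : 0 ≤ (γ₁ * μ - ν₂) / (ν₁ + γ₁ * μ) := div_nonneg (by linarith) p₁.le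
  have x1 : (γ₁ * μ - ν₂) / (ν₁ + γ₁ * μ) ≤ 1 := by
    rw [div_le_one p₁]; linarith
  have y0 : 0 ≤ (ν₁ - γ₂ * μ) / (ν₂ + γ₂ * μ) := div_nonneg (by linarith) p₂.le
  have y1 : (ν₁ - γ₂ * μ) / (ν₂ + γ₂ * μ) ≤ ν₁ / ν₂ := by
    have : 0 ≤ γ₂ * μ := by positivity
    exact div_le_div₀ hν₁.le (by linarith) hν₂ (by linarith)
  rw [eX, eY, eXY]
  set κ := ν₁ / ν₂
  set X := (γ₁ * μ - ν₂) / (ν₁ + γ₁ * μ)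
  set Y := (ν₁ - γ₂ * μ) / (ν₂ + γ₂ * μ)
  have hXY0 : 0 ≤ X * Y := mul_nonneg x0 y0
  have hXY1 : X * Y ≤ κ := by nlinarith
  -- As `X * Y` runs through `[0, κ]`, the numerator runs through `[-κ, κ]`; this symmetry is what
  -- the choice of `θ` achieves.
  have e : θ * -(X * Y) + (1 - θ) = (κ - 2 * (X * Y)) / (2 + κ) := by
    rw [hθ]; field_simp; ring
  rw [e, abs_div, abs_of_pos (by positivity : 0 < 2 + κ)]
  gcongr
  rw [abs_le]
  constructor <;> linarith

/-- The constants `c` and `Λ` enclose the spectrum of the Dirichlet-to-Neumann operator, whose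
eigenvalues are `1 / μ`. The parameter conditions convert this enclosure into the two scalar
inequalities of `abs_eigenvalue_le`. -/
theorem convergenceRate_errorOperator_lt [FiniteDimensional ℝ X₁] [FiniteDimensional ℝ X₂] [FiniteDimensional ℝ V]
    {ν₁ ν₂ γ₁ γ₂ θ c Λ : ℝ} (hν₁ : 0 < ν₁) (hν₂ : 0 < ν₂)
    (hγ₁ : 0 ≤ γ₁) (hγ₂ : 0 ≤ γ₂)
    (hc : ∀ x, c * D.b (D.tr₁ x) (D.tr₁ x) ≤ D.a₁ x x)
    (hΛ : ∀ v, ∃ x, D.tr₁ x = v ∧ D.a₁ x x ≤ Λ * D.b v v)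
    (h₁ : Λ * ν₂ ≤ γ₁) (h₂ : γ₂ ≤ c * ν₁) (hθ : θ = 2 / (2 + ν₁ / ν₂)) :
    convergenceRate (D.errorOperator hν₁ hν₂ hγ₁ hγ₂ θ) < ENNReal.ofReal (ν₁ / (2 * ν₂)) := by
  obtain ⟨v, μ, hv⟩ := D.exists_basis hc hΛ
  have hκ : 0 < ν₁ / ν₂ := div_pos hν₁ hν₂
  refine (convergenceRate_le_of_eigenbasis v _
    (fun i => θ * (((γ₁ + γ₂) * (μ i / (ν₂ + γ₂ * μ i)) - 1) *
      ((γ₁ + γ₂) * (μ i / (ν₁ + γ₁ * μ i)) - 1)) + (1 - θ))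
    ((ν₁ / ν₂) / (2 + ν₁ / ν₂)) (fun i => ?_) (fun i => ?_)).trans_lt ?_
  · obtain ⟨-, -, -, h⟩ := hv i
    simp only [errorOperator, LinearMap.add_apply, LinearMap.smul_apply, LinearMap.comp_apply,
      LinearMap.sub_apply, LinearMap.id_apply, (h ν₁ γ₁ hν₁ hγ₁).1, map_sub, map_smul,
      (h ν₂ γ₂ hν₂ hγ₂).2]
    module
  · obtain ⟨hμ, hcμ, hΛμ, -⟩ := hv i
    refine abs_eigenvalue_le hν₁ hν₂ hγ₁ hγ₂ hμ ?_ ?_ hθ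
    · calc ν₂ ≤ (Λ * μ i) * ν₂ := le_mul_of_one_le_left hν₂.le hΛμ
        _ = (Λ * ν₂) * μ i := by ring
        _ ≤ _ := by gcongr
    · calc γ₂ * μ i ≤ c * ν₁ * μ i := by gcongr
        _ = (c * μ i) * ν₁ := by ring
        _ ≤ ν₁ := mul_le_of_le_one_left hν₁.le hcμ
  · have e : ν₁ / (2 * ν₂) = (ν₁ / ν₂) / 2 := by field_simp
    rw [e]
    refine (ENNReal.ofReal_lt_ofReal_iff (by positivity)).2 ?_
    -- Strictness comes from `2 < 2 + κ`, so it needs no strict inequality in the spectral bounds.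
    exact div_lt_div_of_pos_left hκ (by norm_num) (by linarith)

end MirrorSplitting

end LinearAlgebra

/-! ### Coordinates adapted to the mirror line -/

/-- The signed distance to the line through `p` with unit normal `n`. -/
def height (p n : Plane) : Plane →ᵃ[ℝ] ℝ :=
  (innerₛₗ ℝ n).toAffineMap - AffineMap.const ℝ Plane (inner ℝ n p)

theorem height_apply (p n x : Plane) : height p n x = inner ℝ n (x - p) := by
  simp [height, inner_sub_right]

theorem continuous_height (p n : Plane) : Continuous (height p n) := by
  simp only [funext (height_apply p n)]
  fun_prop

/-- The point with coordinates `s`, `t` in the frame `p`, `e`, `n`. -/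
def frameMap (p e n : Plane) (z : ℝ × ℝ) : Plane := p + z.1 • e + z.2 • n

/-- The frame `p`, `e`, `n` is orthonormal, its first axis is the mirror line, and the domain is
cut by this axis into its subdomains. -/
structure IsMirrorFrame (Ω Ω₁ Ω₂ : Set Plane) (L : AffineSubspace ℝ Plane) [Nonempty L]
    (p e n : Plane) : Prop where
  norm_e : ‖e‖ = 1
  norm_n : ‖n‖ = 1
  inner_eq : inner ℝ e n = 0
  isOpen : IsOpen Ω
  nonempty : Ω.Nonempty
  isBounded : Bornology.IsBounded Ω
  image_eq : EuclideanGeometry.reflection L '' Ω₁ = Ω₂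
  reflection_eq : ∀ x, EuclideanGeometry.reflection L x = x - (2 * height p n x) • n
  eq₁ : Ω₁ = {x ∈ Ω | 0 < height p n x}
  eq₂ : Ω₂ = {x ∈ Ω | height p n x < 0}
  mem_interface : ∀ x ∈ Ω, height p n x = 0 → x ∈ interface Ω₁ Ω₂
  height_interface : ∀ x ∈ interface Ω₁ Ω₂, height p n x = 0

/-- A point of `Ω₁` on the mirror line would be its own image and hence also lie in `Ω₂`. So the
signed distance has no zero on the connected set `Ω₁`, and orienting the normal makes it positive
there. -/
theorem exists_mirrorFrame {Ω Ω₁ Ω₂ : Set Plane} (hdec : IsDecomposition Ω Ω₁ Ω₂)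
    {L : AffineSubspace ℝ Plane} [Nonempty L] (hsymm : IsMirrorSymmetric Ω₁ Ω₂ L) :
    ∃ p e n, IsMirrorFrame Ω Ω₁ Ω₂ L p e n := by
  obtain ⟨⟨p, hp⟩⟩ := ‹Nonempty L›
  obtain ⟨v, hv0, hv⟩ := finrank_eq_one_iff'.1 hsymm.isLine
  set e : Plane := ‖(v : Plane)‖⁻¹ • (v : Plane) with he
  have hvn : ‖(v : Plane)‖ ≠ 0 := by simpa using hv0
  have hen : ‖e‖ = 1 := by rw [he, norm_smul, norm_inv, norm_norm, inv_mul_cancel₀ hvn]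
  have hee : e 0 ^ 2 + e 1 ^ 2 = 1 := by
    have := EuclideanSpace.real_norm_sq_eq e
    rw [hen, Fin.sum_univ_two] at this
    linarith
  have heL : e ∈ L.direction := L.direction.smul_mem _ v.2
  have hdir : ∀ w ∈ L.direction, ∃ c : ℝ, w = c • e := fun w hw => by
    obtain ⟨c, hc⟩ := hv ⟨w, hw⟩
    have hc' : c • (v : Plane) = w := congrArg Subtype.val hc
    exact ⟨c * ‖(v : Plane)‖, by rw [he, smul_smul, mul_assoc, mul_inv_cancel₀ hvn, mul_one, hc']⟩
  -- The normal is kept arbitrary because its sign is only decided at the end by the side on which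
  -- `Ω₁` lies.
  have key : ∀ n : Plane, ‖n‖ = 1 → inner ℝ e n = 0 →
      (∀ x : Plane, x = (inner ℝ e x : ℝ) • e + (inner ℝ n x : ℝ) • n) →
      (∀ x ∈ Ω₁, 0 < height p n x) → IsMirrorFrame Ω Ω₁ Ω₂ L p e n := by
    intro n hn hne hspan hpos
    have hL : ∀ x ∈ L, height p n x = 0 := fun x hx => by
      obtain ⟨c, hc⟩ := hdir _ (AffineSubspace.vsub_mem_direction hx hp)
      rw [height_apply]
      rw [vsub_eq_sub] at hc
      rw [hc, inner_smul_right, real_inner_comm, hne, mul_zero]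
    have hrefl : ∀ x, EuclideanGeometry.reflection L x = x - (2 * height p n x) • n := fun x => by
      have hq : (inner ℝ e (x - p) : ℝ) • e +ᵥ p ∈ L :=
        AffineSubspace.vadd_mem_of_mem_direction (L.direction.smul_mem _ heL) hp
      have hno : (height p n x) • n ∈ L.directionᗮ := by
        refine L.directionᗮ.smul_mem _ ?_
        rw [Submodule.mem_orthogonal]
        intro w hw
        obtain ⟨c, rfl⟩ := hdir w hw
        rw [inner_smul_left, hne, mul_zero]
      have hx : x = (height p n x) • n +ᵥ ((inner ℝ e (x - p) : ℝ) • e +ᵥ p) := by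
        have := hspan (x - p)
        rw [← height_apply p n] at this
        simp only [vadd_eq_add]
        rw [← add_assoc, add_comm (_ • n), ← this, sub_add_cancel]
      conv_lhs => rw [hx]
      rw [EuclideanGeometry.reflection_orthogonal_vadd hq hno]
      conv_rhs => rw [hx]
      have hh : height p n ((height p n x) • n +ᵥ ((inner ℝ e (x - p) : ℝ) • e +ᵥ p)) =
        height p n x := by rw [← hx]
      rw [hh]
      simp only [vadd_eq_add]
      module
    have hhr : ∀ x, height p n (EuclideanGeometry.reflection L x) = -height p n x := fun x => by
      rw [hrefl, height_apply, sub_right_comm, inner_sub_right, inner_smul_right,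
        real_inner_self_eq_norm_sq, hn, height_apply]
      ring
    have hneg : ∀ x ∈ Ω₂, height p n x < 0 := by
      rw [← hsymm.image_eq]
      rintro _ ⟨y, hy, rfl⟩
      rw [hhr]
      linarith [hpos y hy]
    have hu : ∀ x, x ∈ Ω₁ ∨ x ∈ Ω₂ ↔ x ∈ Ω ∧ x ∉ interface Ω₁ Ω₂ := fun x => by
      have := Set.ext_iff.1 hdec.union_eq x
      simpa using this
    have hI : ∀ x ∈ interface Ω₁ Ω₂, height p n x = 0 := fun x hx =>
      hL x (hsymm.interface_subset hx)
    refine ⟨hen, hn, hne, hdec.polygonal.isOpen, hdec.polygonal.isConnected.nonempty,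
      hdec.polygonal.isBounded, hsymm.image_eq, hrefl, ?_, ?_, ?_, hI⟩
    · ext x
      refine ⟨fun h => ⟨((hu x).1 (Or.inl h)).1, hpos x h⟩, fun h => ?_⟩
      rcases (hu x).2 ⟨h.1, fun hx => h.2.ne' (hI x hx)⟩ with h1 | h2
      · exact h1
      · exact absurd h.2 (not_lt.2 (hneg x h2).le)
    · ext x
      refine ⟨fun h => ⟨((hu x).1 (Or.inr h)).1, hneg x h⟩, fun h => ?_⟩
      rcases (hu x).2 ⟨h.1, fun hx => h.2.ne (hI x hx)⟩ with h1 | h2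
      · exact absurd h.2 (not_lt.2 (hpos x h1).le)
      · exact h2
    · intro x hx h0
      by_contra hn
      rcases (hu x).2 ⟨hx, hn⟩ with h1 | h2
      · exact (hpos x h1).ne' h0
      · exact (hneg x h2).ne h0
  -- The normal is the direction `e` turned by a right angle.
  set n : Plane := !₂[-e 1, e 0] with hn
  have hn1 : ‖n‖ = 1 := by
    have := EuclideanSpace.real_norm_sq_eq n
    rw [Fin.sum_univ_two] at this
    simp [hn] at this
    have h2 : ‖n‖ ^ 2 = 1 := by rw [hn]; linarith
    nlinarith [norm_nonneg n]
  have hne : inner ℝ e n = 0 := by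
    simp [hn, PiLp.inner_apply, Fin.sum_univ_two]; ring
  have hspan : ∀ x : Plane, x = (inner ℝ e x : ℝ) • e + (inner ℝ n x : ℝ) • n := fun x => by
    ext i
    fin_cases i
    · simp [hn, PiLp.inner_apply, Fin.sum_univ_two]
      linear_combination (-x 0) * hee
    · simp [hn, PiLp.inner_apply, Fin.sum_univ_two]
      linear_combination (-x 1) * hee
  have hne0 : ∀ x ∈ Ω₁, height p n x ≠ 0 := by
    intro x hx h0
    have hxL : x ∈ L := by
      have := hspan (x - p)
      rw [← height_apply p n, h0, zero_smul, add_zero, sub_eq_iff_eq_add] at this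
      rw [this]
      exact AffineSubspace.vadd_mem_of_mem_direction (L.direction.smul_mem _ heL) hp
    have h2 : x ∈ Ω₂ := by
      rw [← hsymm.image_eq]
      exact ⟨x, hx, (EuclideanGeometry.reflection_eq_self_iff x).2 hxL⟩
    exact Set.disjoint_left.1 hdec.disjoint hx h2
  obtain ⟨x₀, hx₀⟩ := hdec.isConnected₁.nonempty
  have hoc := (hdec.isConnected₁.isPreconnected.image _
    (continuous_height p n).continuousOn).ordConnected
  rcases lt_or_gt_of_ne (hne0 x₀ hx₀) with hlt | hgt
  · have hneg : ∀ x ∈ Ω₁, height p n x < 0 := fun x hx => by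
      by_contra h
      obtain ⟨y, hy, hy0⟩ := hoc.out ⟨x₀, hx₀, rfl⟩ ⟨x, hx, rfl⟩ ⟨hlt.le, not_lt.1 h⟩
      exact hne0 y hy hy0
    refine ⟨p, e, -n, key (-n) (by rw [norm_neg, hn1]) (by rw [inner_neg_right, hne, neg_zero])
      (fun x => ?_) (fun x hx => ?_)⟩
    · rw [inner_neg_left, neg_smul_neg]; exact hspan x
    · have := hneg x hx
      rw [height_apply] at this ⊢
      rw [inner_neg_left]; linarith
  · have hpos : ∀ x ∈ Ω₁, 0 < height p n x := fun x hx => by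
      by_contra h
      obtain ⟨y, hy, hy0⟩ := hoc.out ⟨x, hx, rfl⟩ ⟨x₀, hx₀, rfl⟩ ⟨not_lt.1 h, hgt.le⟩
      exact hne0 y hy hy0
    exact ⟨p, e, n, key n hn1 hne hspan hpos⟩

/-! ### Reflection, closures and measure in the mirror frame. -/

namespace IsMirrorFrame

variable {Ω Ω₁ Ω₂ : Set Plane} {L : AffineSubspace ℝ Plane} [Nonempty L] {p e n : Plane}

theorem reflection_eq_self (F : IsMirrorFrame Ω Ω₁ Ω₂ L p e n) {x : Plane}
    (hx : height p n x = 0) : EuclideanGeometry.reflection L x = x := by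
  rw [F.reflection_eq, hx, mul_zero, zero_smul, sub_zero]

theorem subset₁ (F : IsMirrorFrame Ω Ω₁ Ω₂ L p e n) : Ω₁ ⊆ Ω := by
  rw [F.eq₁]; exact Set.sep_subset _ _

theorem subset₂ (F : IsMirrorFrame Ω Ω₁ Ω₂ L p e n) : Ω₂ ⊆ Ω := by
  rw [F.eq₂]; exact Set.sep_subset _ _

theorem isOpen₁ (F : IsMirrorFrame Ω Ω₁ Ω₂ L p e n) : IsOpen Ω₁ := by
  rw [F.eq₁]
  exact F.isOpen.inter (isOpen_lt continuous_const (continuous_height p n))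

theorem isOpen₂ (F : IsMirrorFrame Ω Ω₁ Ω₂ L p e n) : IsOpen Ω₂ := by
  rw [F.eq₂]
  exact F.isOpen.inter (isOpen_lt (continuous_height p n) continuous_const)

theorem height_nonneg (F : IsMirrorFrame Ω Ω₁ Ω₂ L p e n) {x : Plane} (hx : x ∈ closure Ω₁) :
    0 ≤ height p n x := by
  have : closure Ω₁ ⊆ {x | 0 ≤ height p n x} :=
    closure_minimal (by rw [F.eq₁]; exact fun x hx => hx.2.le)
      (isClosed_le continuous_const (continuous_height p n))
  exact this hx

theorem height_nonpos (F : IsMirrorFrame Ω Ω₁ Ω₂ L p e n) {x : Plane} (hx : x ∈ closure Ω₂) :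
    height p n x ≤ 0 := by
  have : closure Ω₂ ⊆ {x | height p n x ≤ 0} :=
    closure_minimal (by rw [F.eq₂]; exact fun x hx => hx.2.le)
      (isClosed_le (continuous_height p n) continuous_const)
  exact this hx

theorem interface_subset₁ : interface Ω₁ Ω₂ ⊆ closure Ω₁ :=
  Set.inter_subset_left.trans frontier_subset_closure

theorem interface_subset₂ : interface Ω₁ Ω₂ ⊆ closure Ω₂ :=
  Set.inter_subset_right.trans frontier_subset_closure

theorem mem_closure_or (F : IsMirrorFrame Ω Ω₁ Ω₂ L p e n) {x : Plane} (hx : x ∈ Ω) :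
    x ∈ closure Ω₁ ∨ x ∈ closure Ω₂ := by
  rcases lt_trichotomy (height p n x) 0 with h | h | h
  · exact Or.inr (subset_closure (by rw [F.eq₂]; exact ⟨hx, h⟩))
  · exact Or.inl (interface_subset₁ (F.mem_interface x hx h))
  · exact Or.inl (subset_closure (by rw [F.eq₁]; exact ⟨hx, h⟩))

theorem reflection_mem₁ (F : IsMirrorFrame Ω Ω₁ Ω₂ L p e n) {x : Plane} (hx : x ∈ Ω₂) :
    EuclideanGeometry.reflection L x ∈ Ω₁ := by
  rw [← F.image_eq] at hx
  obtain ⟨y, hy, rfl⟩ := hx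
  rwa [EuclideanGeometry.reflection_reflection]

theorem reflection_mem₂ (F : IsMirrorFrame Ω Ω₁ Ω₂ L p e n) {x : Plane} (hx : x ∈ Ω₁) :
    EuclideanGeometry.reflection L x ∈ Ω₂ := by
  rw [← F.image_eq]
  exact ⟨x, hx, rfl⟩

theorem preimage_eq (F : IsMirrorFrame Ω Ω₁ Ω₂ L p e n) :
    EuclideanGeometry.reflection L ⁻¹' Ω₁ = Ω₂ := by
  ext x
  refine ⟨fun h => ?_, fun h => F.reflection_mem₁ h⟩
  rw [← EuclideanGeometry.reflection_reflection L x]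
  exact F.reflection_mem₂ h

theorem preimage_closure_eq (F : IsMirrorFrame Ω Ω₁ Ω₂ L p e n) :
    EuclideanGeometry.reflection L ⁻¹' closure Ω₁ = closure Ω₂ := by
  rw [← F.preimage_eq]
  exact (EuclideanGeometry.reflection L).toHomeomorph.preimage_closure Ω₁

theorem reflection_mem (F : IsMirrorFrame Ω Ω₁ Ω₂ L p e n) {x : Plane} (hx : x ∈ Ω) :
    EuclideanGeometry.reflection L x ∈ Ω := by
  rcases lt_trichotomy (height p n x) 0 with h | h | h
  · exact F.subset₁ (F.reflection_mem₁ (by rw [F.eq₂]; exact ⟨hx, h⟩))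
  · rwa [F.reflection_eq_self h]
  · exact F.subset₂ (F.reflection_mem₂ (by rw [F.eq₁]; exact ⟨hx, h⟩))

theorem height_frameMap (F : IsMirrorFrame Ω Ω₁ Ω₂ L p e n) (z : ℝ × ℝ) :
    height p n (frameMap p e n z) = z.2 := by
  rw [height_apply, frameMap, add_assoc, add_sub_cancel_left, inner_add_right, inner_smul_right,
    inner_smul_right, real_inner_comm, F.inner_eq, real_inner_self_eq_norm_sq, F.norm_n]
  ring

/-- The orthonormal basis of the frame. -/
theorem exists_orthonormalBasis (F : IsMirrorFrame Ω Ω₁ Ω₂ L p e n) :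
    ∃ b : OrthonormalBasis (Fin 2) ℝ Plane, b 0 = e ∧ b 1 = n := by
  have hon : Orthonormal ℝ ![e, n] := by
    rw [orthonormal_iff_ite]
    intro i j
    fin_cases i <;> fin_cases j <;>
      simp [F.inner_eq, real_inner_comm, F.norm_e, F.norm_n]
  have hc : Fintype.card (Fin 2) = Module.finrank ℝ Plane := by simp
  refine ⟨(basisOfOrthonormalOfCardEqFinrank hon hc).toOrthonormalBasis (by simpa using hon), ?_, ?_⟩
  <;> simp

theorem exists_eq_frameMap (F : IsMirrorFrame Ω Ω₁ Ω₂ L p e n) (x : Plane) :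
    ∃ s : ℝ, x = frameMap p e n (s, height p n x) := by
  obtain ⟨b, rfl, rfl⟩ := F.exists_orthonormalBasis
  refine ⟨inner ℝ (b 0) (x - p), ?_⟩
  have := b.sum_repr' (x - p)
  rw [Fin.sum_univ_two, ← height_apply p (b 1)] at this
  rw [frameMap, add_assoc, this]
  abel

/-- The frame coordinates are an orthonormal change of basis followed by a translation, after
identifying `ℝ × ℝ` with the Euclidean plane. -/
theorem measurePreserving_frameMap (F : IsMirrorFrame Ω Ω₁ Ω₂ L p e n) :
    MeasurePreserving (frameMap p e n) (volume : Measure (ℝ × ℝ)) (volume : Measure Plane) := by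
  obtain ⟨b, hb0, hb1⟩ := F.exists_orthonormalBasis
  have h1 := (volume_preserving_finTwoArrow ℝ).symm
  have h2 := (EuclideanSpace.volume_preserving_symm_measurableEquiv_toLp (Fin 2)).symm
  have h3 := b.measurePreserving_repr_symm
  have h4 := measurePreserving_add_left (volume : Measure Plane) p
  have := h4.comp (h3.comp (h2.comp h1))
  convert this using 1
  ext1 z
  have : ∀ y : EuclideanSpace ℝ (Fin 2), b.repr.symm y = y 0 • e + y 1 • n := fun y => by
    rw [← b.sum_repr_symm, Fin.sum_univ_two, hb0, hb1]
  simp only [Function.comp_apply]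
  rw [this, frameMap, add_assoc]
  rfl

/-- The arc length parametrization of the mirror line. -/
theorem isometry_axis (F : IsMirrorFrame Ω Ω₁ Ω₂ L p e n) :
    Isometry fun s : ℝ => frameMap p e n (s, 0) := by
  refine Isometry.of_dist_eq fun s t => ?_
  simp only [frameMap, zero_smul, add_zero, dist_add_left]
  rw [dist_eq_norm, ← sub_smul, norm_smul, F.norm_e, mul_one, Real.dist_eq, Real.norm_eq_abs]

end IsMirrorFrame

section

/-! ### Finite element functions -/

/-- A function that is Lipschitz on each set of a finite closed cover of an interval changes by at
most the constant times the length of the interval. -/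
theorem abs_sub_le_of_closed_cover {ι : Type*} (φ : ℝ → ℝ) (C : ℝ) (F : ι → Set ℝ)
    (hF : ∀ i, IsClosed (F i)) (hφ : ∀ i, ∀ x ∈ F i, ∀ y ∈ F i, |φ x - φ y| ≤ C * |x - y|)
    (s : Finset ι) :
    ∀ a b : ℝ, a ≤ b → Set.Icc a b ⊆ ⋃ i ∈ s, F i → |φ b - φ a| ≤ C * (b - a) := by
  classical
  induction s using Finset.strongInduction with
  | H s ih =>
    intro a b hab hcov
    obtain ⟨i, hi, hai⟩ := Set.mem_iUnion₂.1 (hcov (Set.left_mem_Icc.2 hab))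
    have hcomp : IsCompact (F i ∩ Set.Icc a b) := isCompact_Icc.inter_left (hF i)
    -- The last point `a'` of the interval in `F i` is used: beyond it `F i` is never met again, so
    -- the remaining interval is covered by one set fewer.
    have hmem : sSup (F i ∩ Set.Icc a b) ∈ F i ∩ Set.Icc a b :=
      hcomp.sSup_mem ⟨a, hai, Set.left_mem_Icc.2 hab⟩
    set a' := sSup (F i ∩ Set.Icc a b) with ha'
    have h1 : |φ a' - φ a| ≤ C * (a' - a) := by
      have := hφ i a' hmem.1 a hai
      rwa [abs_of_nonneg (sub_nonneg.2 hmem.2.1 : (0:ℝ) ≤ a' - a)] at this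
    rcases hmem.2.2.eq_or_lt with hb | hb
    · rwa [hb] at h1
    · have hsub : Set.Icc a' b ⊆ ⋃ j ∈ s.erase i, F j := by
        -- The point `a'` itself need not lie in another set a priori, but the union of the
        -- remaining sets is closed and contains every point just after it.
        rw [← closure_Ioc hb.ne]
        refine closure_minimal (fun x hx => ?_) (isClosed_biUnion_finset fun j _ => hF j)
        have hxab : x ∈ Set.Icc a b := ⟨hmem.2.1.trans hx.1.le, hx.2⟩
        obtain ⟨j, hj, hxj⟩ := Set.mem_iUnion₂.1 (hcov hxab)
        refine Set.mem_iUnion₂.2 ⟨j, Finset.mem_erase.2 ⟨?_, hj⟩, hxj⟩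
        rintro rfl
        exact absurd (le_csSup hcomp.bddAbove ⟨hxj, hxab⟩) (not_le.2 hx.1)
      have h2 := ih (s.erase i) (Finset.erase_ssubset hi) a' b hb.le hsub
      calc |φ b - φ a| ≤ |φ b - φ a'| + |φ a' - φ a| := abs_sub_le _ _ _
        _ ≤ C * (b - a') + C * (a' - a) := add_le_add h2 h1
        _ = C * (b - a) := by ring

/-- On the segment between two points, the closed cover pulls back to a closed cover of the unit
interval. No convexity of the pieces is needed. -/
theorem lipschitzWith_of_closed_cover {E ι : Type*} [NormedAddCommGroup E] [NormedSpace ℝ E]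
    (u : E → ℝ) (C : NNReal) (F : ι → Set E) (s : Finset ι) (hF : ∀ i, IsClosed (F i))
    (hu : ∀ i, LipschitzOnWith C u (F i)) (hcov : ∀ x, ∃ i ∈ s, x ∈ F i) : LipschitzWith C u := by
  refine LipschitzWith.of_dist_le_mul fun x y => ?_
  have hline : Continuous fun t : ℝ => y + t • (x - y) := by fun_prop
  have := abs_sub_le_of_closed_cover (fun t : ℝ => u (y + t • (x - y))) (C * dist x y)
    (fun i => (fun t : ℝ => y + t • (x - y)) ⁻¹' F i) (fun i => (hF i).preimage hline)
    (fun i a ha b hb => by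
      have := (hu i).dist_le_mul _ ha _ hb
      rw [dist_add_left, dist_eq_norm (a • _), ← sub_smul, norm_smul, Real.norm_eq_abs,
        ← dist_eq_norm x y, Real.dist_eq] at this
      linarith) s 0 1 zero_le_one (fun t _ => by
        obtain ⟨i, hi, h⟩ := hcov (y + t • (x - y))
        exact Set.mem_iUnion₂.2 ⟨i, hi, h⟩)
  simpa [Real.dist_eq] using this

theorem affineMap_eqOn_convexHull {A B : Plane →ᵃ[ℝ] ℝ} {s : Set Plane} (h : Set.EqOn A B s) :
    Set.EqOn A B (convexHull ℝ s) := by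
  have hc : Convex ℝ ((A - B) ⁻¹' {0}) := (convex_singleton (0 : ℝ)).affine_preimage (A - B)
  intro x hx
  have := convexHull_min (fun y hy => by simp [h hy]) hc hx
  simpa [sub_eq_zero] using this

theorem isClosed_element (K : Finset Plane) : IsClosed (convexHull ℝ (K : Set Plane)) :=
  K.finite_toSet.isClosed_convexHull ℝ

theorem lipschitzWith_affineMap (A : Plane →ᵃ[ℝ] ℝ) : ∃ C : NNReal, LipschitzWith C A := by
  refine ⟨‖A.linear.toContinuousLinearMap‖₊, LipschitzWith.of_dist_le_mul fun x y => ?_⟩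
  rw [dist_eq_norm, dist_eq_norm, ← vsub_eq_sub, ← A.linearMap_vsub, vsub_eq_sub]
  exact A.linear.toContinuousLinearMap.le_opNorm _

variable {T : Finset (Finset Plane)} {Ω Ω₁ Ω₂ : Set Plane}

/-- The elements and the complement of `Ω` form a finite closed cover of the plane, with the
function affine or zero on each piece. The sum of the local Lipschitz constants serves as a common
one. -/
theorem exists_lipschitzWith_of_piecewise (hT : IsTriangulation T Ω Ω₁ Ω₂) (hΩ : IsOpen Ω)
    {u : Plane → ℝ} (h0 : ∀ x, x ∉ Ω → u x = 0)
    (hA : ∀ K ∈ T, ∃ A : Plane →ᵃ[ℝ] ℝ, ∀ x ∈ convexHull ℝ (K : Set Plane), u x = A x) :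
    ∃ C : NNReal, LipschitzWith C u := by
  have hA' : ∀ K : T, ∃ C : NNReal, LipschitzOnWith C u (convexHull ℝ ((K : Finset Plane) : Set Plane)) := by
    rintro ⟨K, hK⟩
    obtain ⟨A, hAu⟩ := hA K hK
    obtain ⟨C, hC⟩ := lipschitzWith_affineMap A
    refine ⟨C, LipschitzOnWith.of_dist_le_mul fun x hx y hy => ?_⟩
    rw [hAu x hx, hAu y hy]
    exact hC.dist_le_mul x y
  choose C hC using hA'
  refine ⟨∑ K, C K, lipschitzWith_of_closed_cover u _
    (fun K : Option T => K.elim Ωᶜ fun K => convexHull ℝ ((K : Finset Plane) : Set Plane))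
    Finset.univ ?_ ?_ ?_⟩
  · rintro (_ | K)
    · exact hΩ.isClosed_compl
    · exact isClosed_element _
  · rintro (_ | K)
    · refine LipschitzOnWith.of_dist_le_mul fun x hx y hy => ?_
      rw [h0 x hx, h0 y hy, dist_self]
      positivity
    · exact (hC K).weaken (Finset.single_le_sum (fun _ _ => zero_le) (Finset.mem_univ K))
  · intro x
    by_cases hx : x ∈ Ω
    · have := subset_closure hx
      rw [← hT.cover] at this
      obtain ⟨K, hK, hxK⟩ := Set.mem_iUnion₂.1 this
      exact ⟨some ⟨K, hK⟩, Finset.mem_univ _, hxK⟩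
    · exact ⟨none, Finset.mem_univ _, hx⟩

/-- Continuity is automatic for a function that is affine on each closed element and zero off `Ω`,
so constructions never have to check it. -/
theorem mem_feSpace_of_piecewise (hT : IsTriangulation T Ω Ω₁ Ω₂) (hΩ : IsOpen Ω)
    {u : Plane → ℝ} (h0 : ∀ x, x ∉ Ω → u x = 0)
    (hA : ∀ K ∈ T, ∃ A : Plane →ᵃ[ℝ] ℝ, ∀ x ∈ convexHull ℝ (K : Set Plane), u x = A x) :
    u ∈ feSpace T Ω := by
  obtain ⟨C, hC⟩ := exists_lipschitzWith_of_piecewise hT hΩ h0 hA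
  exact ⟨hC.continuous, h0, hA⟩

theorem exists_lipschitzWith (hT : IsTriangulation T Ω Ω₁ Ω₂) (hΩ : IsOpen Ω)
    {u : Plane → ℝ} (hu : u ∈ feSpace T Ω) : ∃ C : NNReal, LipschitzWith C u :=
  exists_lipschitzWith_of_piecewise hT hΩ hu.2.1 hu.2.2

theorem exists_mem_element (hT : IsTriangulation T Ω Ω₁ Ω₂) {x : Plane} (hx : x ∈ Ω) :
    ∃ K ∈ T, x ∈ convexHull ℝ (K : Set Plane) := by
  have := subset_closure hx
  rw [← hT.cover] at this
  obtain ⟨K, hK, hxK⟩ := Set.mem_iUnion₂.1 this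
  exact ⟨K, hK, hxK⟩

/-- Three affinely independent points form an affine basis of the plane; the prescribed values are
combined with the barycentric coordinates. -/
theorem exists_affineMap_eq (hT : IsTriangulation T Ω Ω₁ Ω₂) {K : Finset Plane} (hK : K ∈ T)
    (c : Plane → ℝ) : ∃ A : Plane →ᵃ[ℝ] ℝ, ∀ q ∈ K, A q = c q := by
  have htot : affineSpan ℝ (Set.range fun q : K => (q : Plane)) = ⊤ :=
    (hT.indep K hK).affineSpan_eq_top_iff_card_eq_finrank_add_one.2 (by simp [hT.card_eq K hK])
  let b : AffineBasis K ℝ Plane := ⟨fun q => (q : Plane), hT.indep K hK, htot⟩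
  classical
  let A : Plane →ᵃ[ℝ] ℝ := ∑ q : K, c q • b.coord q
  refine ⟨A, fun q hq => ?_⟩
  have : ∀ x, A x = ∑ q : K, c q * b.coord q x := fun x => by
    have h := map_sum (⟨⟨fun A : Plane →ᵃ[ℝ] ℝ => A x, rfl⟩, fun _ _ => rfl⟩ :
      (Plane →ᵃ[ℝ] ℝ) →+ ℝ) (fun q : K => c q • b.coord q) Finset.univ
    exact h
  rw [this]
  have hb : ∀ r : K, b.coord r q = if r = ⟨q, hq⟩ then 1 else 0 := fun r =>
    b.coord_apply r ⟨q, hq⟩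
  simp [hb]

/-- Nodal interpolation in the P1 finite element space. -/
theorem exists_interpolant (hT : IsTriangulation T Ω Ω₁ Ω₂) (hΩ : IsOpen Ω) (c : Plane → ℝ)
    (hc : ∀ x, x ∉ Ω → c x = 0) : ∃ u ∈ feSpace T Ω, ∀ K ∈ T, ∀ q ∈ K, u q = c q := by
  classical
  have hex : ∀ K : Finset Plane, ∃ A : Plane →ᵃ[ℝ] ℝ, K ∈ T → ∀ q ∈ K, A q = c q := fun K => by
    by_cases hK : K ∈ T
    · obtain ⟨A, hA⟩ := exists_affineMap_eq hT hK c
      exact ⟨A, fun _ => hA⟩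
    · exact ⟨0, fun h => absurd h hK⟩
  choose A hA using hex
  -- An arbitrary element containing the point is chosen. Conformity makes the choice irrelevant:
  -- two elements meet inside the hull of their common vertices, where their affine interpolants
  -- agree.
  let u : Plane → ℝ := fun x =>
    if h : ∃ K ∈ T, x ∈ convexHull ℝ (K : Set Plane) then A h.choose x else 0
  have hu : ∀ K ∈ T, ∀ x ∈ convexHull ℝ (K : Set Plane), u x = A K x := by
    intro K hK x hx
    have h : ∃ K ∈ T, x ∈ convexHull ℝ (K : Set Plane) := ⟨K, hK, hx⟩
    have hux : u x = A h.choose x := dif_pos h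
    rw [hux]
    refine affineMap_eqOn_convexHull (fun q hq => ?_)
      (hT.inter_subset _ h.choose_spec.1 K hK ⟨h.choose_spec.2, hx⟩)
    rw [hA _ h.choose_spec.1 q hq.1, hA K hK q hq.2]
  have hu0 : ∀ x, x ∉ Ω → u x = 0 := by
    intro x hx
    by_cases h : ∃ K ∈ T, x ∈ convexHull ℝ (K : Set Plane)
    · obtain ⟨K, hK, hxK⟩ := h
      have hxc : x ∈ closure Ω := by rw [← hT.cover]; exact Set.mem_iUnion₂.2 ⟨K, hK, hxK⟩
      have hxf : x ∈ frontier Ω := by rw [hΩ.frontier_eq]; exact ⟨hxc, hx⟩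
      -- The boundary point may lie in several elements. One with an edge inside the boundary is
      -- selected: the interpolant is zero at both ends of that edge and hence along it.
      obtain ⟨K', hK', a, ha, b, hb, -, hxab, hab⟩ := hT.boundary x hxf
      have hsub : segment ℝ a b ⊆ convexHull ℝ (K' : Set Plane) :=
        (convex_convexHull ℝ _).segment_subset (subset_convexHull ℝ _ ha)
          (subset_convexHull ℝ _ hb)
      have hzero : ∀ y ∈ segment ℝ a b, y ∉ Ω := fun y hy => by
        have := hab hy
        rw [hΩ.frontier_eq] at this
        exact this.2
      rw [hu K' hK' x (hsub hxab)]
      rw [← convexHull_pair] at hxab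
      have := affineMap_eqOn_convexHull (A := A K') (B := AffineMap.const ℝ Plane 0)
        (s := {a, b}) (by
          rintro y (rfl | rfl)
          · rw [hA K' hK' _ ha, hc _ (hzero _ (left_mem_segment ℝ _ _))]; rfl
          · rw [hA K' hK' _ hb, hc _ (hzero _ (right_mem_segment ℝ _ _))]; rfl) hxab
      exact this
    · exact dif_neg h
  refine ⟨u, mem_feSpace_of_piecewise hT hΩ hu0 fun K hK => ⟨A K, hu K hK⟩, fun K hK q hq => ?_⟩
  rw [hu K hK q (subset_convexHull ℝ _ hq), hA K hK q hq]

/-- A finite element function is determined by its values at the finitely many vertices. -/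
theorem finiteDimensional_feSpace (hT : IsTriangulation T Ω Ω₁ Ω₂) :
    FiniteDimensional ℝ (feSpace T Ω) := by
  set S : Set Plane := ⋃ K ∈ T, (K : Set Plane) with hS
  have hfin : S.Finite := T.finite_toSet.biUnion fun K _ => K.finite_toSet
  have : Finite S := hfin
  let f : feSpace T Ω →ₗ[ℝ] (S → ℝ) :=
    LinearMap.funLeft ℝ ℝ (Subtype.val : S → Plane) ∘ₗ (feSpace T Ω).subtype
  refine FiniteDimensional.of_injective f ((injective_iff_map_eq_zero f).2 ?_)
  rintro ⟨u, hu⟩ h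
  have hv : ∀ K ∈ T, ∀ q ∈ K, u q = 0 := fun K hK q hq =>
    congrFun h ⟨q, Set.mem_iUnion₂.2 ⟨K, hK, hq⟩⟩
  ext x
  change u x = 0
  by_cases hx : x ∈ Ω
  · obtain ⟨K, hK, hxK⟩ := exists_mem_element hT hx
    obtain ⟨A, hA⟩ := hu.2.2 K hK
    rw [hA x hxK]
    exact affineMap_eqOn_convexHull (A := A) (B := AffineMap.const ℝ Plane 0)
      (fun q hq => by rw [← hA q (subset_convexHull ℝ _ hq), hv K hK q hq]; rfl) hxK
  · exact hu.2.1 x hx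

variable {L : AffineSubspace ℝ Plane} [Nonempty L] {p e n : Plane}

theorem comp_reflection_mem (F : IsMirrorFrame Ω Ω₁ Ω₂ L p e n) (hTL : IsMirrorSymmetricMesh T L)
    {u : Plane → ℝ} (hu : u ∈ feSpace T Ω) :
    u ∘ EuclideanGeometry.reflection L ∈ feSpace T Ω := by
  refine ⟨hu.1.comp (EuclideanGeometry.reflection L).continuous, fun x hx => hu.2.1 _ fun h => ?_,
    fun K hK => ?_⟩
  · have := F.reflection_mem h
    rw [EuclideanGeometry.reflection_reflection] at this
    exact hx this
  · obtain ⟨A, hA⟩ := hu.2.2 _ (hTL K hK)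
    refine ⟨A.comp ((EuclideanGeometry.reflection L).toAffineEquiv : Plane →ᵃ[ℝ] Plane),
      fun x hx => hA _ ?_⟩
    have h := AffineMap.image_convexHull
      ((EuclideanGeometry.reflection L).toAffineEquiv : Plane →ᵃ[ℝ] Plane) (K : Set Plane)
    have h2 : ((K.map (EuclideanGeometry.reflection L).toEquiv.toEmbedding : Finset Plane) :
        Set Plane) = ((EuclideanGeometry.reflection L).toAffineEquiv : Plane →ᵃ[ℝ] Plane) ''
          (K : Set Plane) := by
      rw [Finset.coe_map]; rfl
    rw [h2, ← h]
    exact ⟨x, hx, rfl⟩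

theorem eq_zero_of_height_eq_zero (F : IsMirrorFrame Ω Ω₁ Ω₂ L p e n) {u : Plane → ℝ}
    (hu : u ∈ feSpace T Ω) (hu0 : ∀ x ∈ interface Ω₁ Ω₂, u x = 0) {x : Plane}
    (hx : height p n x = 0) : u x = 0 := by
  by_cases h : x ∈ Ω
  · exact hu0 x (F.mem_interface x h hx)
  · exact hu.2.1 x h

/-- A finite element function with vanishing trace on the interface can be cut off. -/
theorem restrictTo_mem (hT : IsTriangulation T Ω Ω₁ Ω₂) (F : IsMirrorFrame Ω Ω₁ Ω₂ L p e n)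
    {u : Plane → ℝ} (hu : u ∈ feSpace T Ω) (hu0 : ∀ x ∈ interface Ω₁ Ω₂, u x = 0) :
    restrictTo (closure Ω₁) u ∈ feSpace T Ω := by
  refine mem_feSpace_of_piecewise hT F.isOpen (fun x hx => ?_) fun K hK => ?_
  · classical
    change Set.indicator _ _ _ = _
    rw [Set.indicator_apply, hu.2.1 x hx, ite_self]
  · rcases hT.uncut K hK with h | h
    · obtain ⟨A, hA⟩ := hu.2.2 K hK
      refine ⟨A, fun x hx => ?_⟩
      rw [← hA x hx]
      exact Set.indicator_of_mem (h hx) u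
    · refine ⟨0, fun x hx => ?_⟩
      change Set.indicator _ _ _ = _
      by_cases hx1 : x ∈ closure Ω₁
      · rw [Set.indicator_of_mem hx1]
        exact eq_zero_of_height_eq_zero F hu hu0
          (le_antisymm (F.height_nonpos (h hx)) (F.height_nonneg hx1))
      · rw [Set.indicator_of_notMem hx1]; rfl

end

section

/-! ### The forms on finite element functions -/

theorem measurable_gradient (u : Plane → ℝ) : Measurable (gradient u) :=
  (InnerProductSpace.toDual ℝ Plane).symm.continuous.measurable.comp (measurable_fderiv ℝ u)

theorem norm_gradient_eq (u : Plane → ℝ) (x : Plane) : ‖gradient u x‖ = ‖fderiv ℝ u x‖ :=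
  (InnerProductSpace.toDual ℝ Plane).symm.norm_map _

theorem norm_gradient_le {u : Plane → ℝ} {C : NNReal} (hu : LipschitzWith C u) (x : Plane) :
    ‖gradient u x‖ ≤ C := by
  rw [norm_gradient_eq]
  exact norm_fderiv_le_of_lipschitz ℝ hu

theorem integrableOn_inner_gradient {u v : Plane → ℝ} {C C' : NNReal} (hu : LipschitzWith C u)
    (hv : LipschitzWith C' v) {D : Set Plane} (hD : volume D < ⊤) :
    IntegrableOn (fun x => inner ℝ (gradient u x) (gradient v x)) D := by
  refine Measure.integrableOn_of_bounded (M := C * C') hD.ne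
    ((measurable_gradient u).inner (measurable_gradient v)).aestronglyMeasurable
    (Filter.Eventually.of_forall fun x => ?_)
  refine (norm_inner_le_norm _ _).trans ?_
  exact mul_le_mul (norm_gradient_le hu x) (norm_gradient_le hv x) (norm_nonneg _) C.2

theorem energy_eq_mul (D : Set Plane) (ν : ℝ) (u v : Plane → ℝ) :
    energy D ν u v = ν * energy D 1 u v := by
  simp only [energy, one_mul]
  exact integral_const_mul _ _

theorem energy_comm (D : Set Plane) (ν : ℝ) (u v : Plane → ℝ) :
    energy D ν u v = energy D ν v u := by
  simp only [energy, real_inner_comm]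

theorem energy_nonneg (D : Set Plane) (u : Plane → ℝ) : 0 ≤ energy D 1 u u :=
  integral_nonneg fun x => by
    rw [one_mul]; exact real_inner_self_nonneg

/-- Additivity of the gradient holds wherever both functions are differentiable, which is almost
everywhere by Rademacher's theorem; Lipschitz bounds make the integrands integrable on sets of
finite measure. -/
theorem energy_add_left {D : Set Plane} (hD : volume D < ⊤) {u u' v : Plane → ℝ}
    {C C' C'' : NNReal} (hu : LipschitzWith C u) (hu' : LipschitzWith C' u')
    (hv : LipschitzWith C'' v) :
    energy D 1 (u + u') v = energy D 1 u v + energy D 1 u' v := by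
  simp only [energy, one_mul]
  rw [← integral_add (integrableOn_inner_gradient hu hv hD) (integrableOn_inner_gradient hu' hv hD)]
  refine integral_congr_ae (ae_restrict_of_ae ?_)
  filter_upwards [hu.ae_differentiableAt, hu'.ae_differentiableAt] with x h h'
  simp only [gradient]
  rw [fderiv_add h h', map_add, inner_add_left]

theorem energy_smul_left {D : Set Plane} (c : ℝ) {u v : Plane → ℝ} {C : NNReal}
    (hu : LipschitzWith C u) : energy D 1 (c • u) v = c * energy D 1 u v := by
  simp only [energy, one_mul]
  rw [← integral_const_mul]
  refine integral_congr_ae (ae_restrict_of_ae ?_)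
  filter_upwards [hu.ae_differentiableAt] with x h
  simp only [gradient]
  rw [fderiv_const_smul h, map_smul, inner_smul_left]
  rfl

theorem gradient_restrictTo {D : Set Plane} (hD : IsOpen D) (u : Plane → ℝ) {x : Plane}
    (hx : x ∈ D) : gradient (restrictTo (closure D) u) x = gradient u x := by
  unfold gradient
  congr 1
  refine Filter.EventuallyEq.fderiv_eq ?_
  filter_upwards [hD.mem_nhds hx] with y hy
  exact Set.indicator_of_mem (subset_closure hy) u

theorem energy_restrictTo_left {D : Set Plane} (hD : IsOpen D) (ν : ℝ) (u v : Plane → ℝ) :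
    energy D ν (restrictTo (closure D) u) v = energy D ν u v := by
  refine setIntegral_congr_fun hD.measurableSet fun x hx => ?_
  simp only [gradient_restrictTo hD u hx]

theorem energy_restrictTo {D : Set Plane} (hD : IsOpen D) (ν : ℝ) (u v : Plane → ℝ) :
    energy D ν (restrictTo (closure D) u) (restrictTo (closure D) v) = energy D ν u v := by
  rw [energy_restrictTo_left hD, energy_comm, energy_restrictTo_left hD, energy_comm]

theorem isClosed_interface (Ω₁ Ω₂ : Set Plane) : IsClosed (interface Ω₁ Ω₂) :=
  isClosed_frontier.inter isClosed_frontier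

theorem pairing_congr {Γ : Set Plane} (hΓ : IsClosed Γ) {u u' v v' : Plane → ℝ}
    (hu : Set.EqOn u u' Γ) (hv : Set.EqOn v v' Γ) : pairing Γ u v = pairing Γ u' v' :=
  setIntegral_congr_fun hΓ.measurableSet fun x hx => by simp only [hu hx, hv hx]

theorem pairing_comm (Γ : Set Plane) (u v : Plane → ℝ) : pairing Γ u v = pairing Γ v u := by
  simp only [pairing, mul_comm]

theorem restrictTo_eqOn (s : Set Plane) (u : Plane → ℝ) : Set.EqOn (restrictTo s u) u s :=
  fun _ hx => Set.indicator_of_mem hx u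

theorem load_congr {D : Set Plane} (hD : IsOpen D) (f : Plane → ℝ) {v v' : Plane → ℝ}
    (hv : Set.EqOn v v' D) : load D f v = load D f v' :=
  setIntegral_congr_fun hD.measurableSet fun x hx => by simp only [hv hx]

theorem load_restrictTo {D : Set Plane} (hD : IsOpen D) (f v : Plane → ℝ) :
    load D f (restrictTo (closure D) v) = load D f v :=
  load_congr hD f ((restrictTo_eqOn _ v).mono subset_closure)

variable {T : Finset (Finset Plane)} {Ω Ω₁ Ω₂ : Set Plane} {L : AffineSubspace ℝ Plane} [Nonempty L]
  {p e n : Plane}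

theorem exists_bound (F : IsMirrorFrame Ω Ω₁ Ω₂ L p e n) {u : Plane → ℝ} (hu : u ∈ feSpace T Ω) :
    ∃ C, ∀ x, ‖u x‖ ≤ C :=
  (HasCompactSupport.intro (F.isBounded.isCompact_closure)
    fun x hx => hu.2.1 x fun h => hx (subset_closure h)).exists_bound_of_continuous hu.1

theorem integrableOn_load (F : IsMirrorFrame Ω Ω₁ Ω₂ L p e n) {f : Plane → ℝ}
    (hf : MemLp f 2 (volume.restrict Ω)) {D : Set Plane} (hD : D ⊆ Ω) {v : Plane → ℝ}
    (hv : v ∈ feSpace T Ω) : IntegrableOn (fun x => f x * v x) D := by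
  have : IsFiniteMeasure (volume.restrict Ω) :=
    ⟨by rw [Measure.restrict_apply_univ]; exact F.isBounded.measure_lt_top⟩
  obtain ⟨C, hC⟩ := exists_bound F hv
  have h1 : Integrable f (volume.restrict Ω) := hf.integrable (by norm_num)
  have h2 : IntegrableOn f D := IntegrableOn.mono_set h1 hD
  exact h2.mul_bdd (c := C) hv.1.aestronglyMeasurable (Filter.Eventually.of_forall hC)

theorem load_add (F : IsMirrorFrame Ω Ω₁ Ω₂ L p e n) {f : Plane → ℝ}
    (hf : MemLp f 2 (volume.restrict Ω)) {D : Set Plane} (hD : D ⊆ Ω) {v v' : Plane → ℝ}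
    (hv : v ∈ feSpace T Ω) (hv' : v' ∈ feSpace T Ω) :
    load D f (v + v') = load D f v + load D f v' := by
  unfold load
  rw [← integral_add (integrableOn_load F hf hD hv) (integrableOn_load F hf hD hv')]
  simp only [Pi.add_apply, mul_add]

theorem load_smul (D : Set Plane) (f : Plane → ℝ) (c : ℝ) (v : Plane → ℝ) :
    load D f (c • v) = c * load D f v := by
  unfold load
  rw [← integral_const_mul]
  congr 1
  ext x
  simp only [Pi.smul_apply, smul_eq_mul]
  ring

/-- The interface pairing of finite element functions in terms of the arc length parameter. -/
theorem pairing_eq (F : IsMirrorFrame Ω Ω₁ Ω₂ L p e n) {u : Plane → ℝ} (hu : u ∈ feSpace T Ω)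
    (v : Plane → ℝ) :
    pairing (interface Ω₁ Ω₂) u v =
      ∫ s : ℝ, u (frameMap p e n (s, 0)) * v (frameMap p e n (s, 0)) := by
  set ι : ℝ → Plane := fun s => frameMap p e n (s, 0) with hι
  have hiso : Isometry ι := F.isometry_axis
  have hemb : MeasurableEmbedding ι := hiso.isClosedEmbedding.measurableEmbedding
  have hmap := hiso.map_hausdorffMeasure (d := 1) (Or.inl zero_le_one)
  rw [hausdorffMeasure_real] at hmap
  have hsub : interface Ω₁ Ω₂ ⊆ Set.range ι := fun x hx => by
    obtain ⟨s, hs⟩ := F.exists_eq_frameMap x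
    rw [F.height_interface x hx] at hs
    exact ⟨s, hs.symm⟩
  -- The mirror line is an isometric copy of `ℝ`, so the one-dimensional Hausdorff measure on it is
  -- transported Lebesgue measure. Extending the integral to all of `ℝ` costs nothing since `u`
  -- vanishes off `Ω`.
  have h1 : (Measure.hausdorffMeasure (1 : ℝ) : Measure Plane).restrict (interface Ω₁ Ω₂) =
      (Measure.map ι volume).restrict (interface Ω₁ Ω₂) := by
    rw [hmap, Measure.restrict_restrict (isClosed_interface Ω₁ Ω₂).measurableSet,
      Set.inter_eq_left.2 hsub]
  unfold pairing
  rw [h1, hemb.setIntegral_map]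
  refine setIntegral_eq_integral_of_forall_compl_eq_zero fun s hs => ?_
  rw [hu.2.1 _ fun h => hs (F.mem_interface _ h (F.height_frameMap _)), zero_mul]

theorem hasCompactSupport_axis (F : IsMirrorFrame Ω Ω₁ Ω₂ L p e n) {u : Plane → ℝ}
    (hu : u ∈ feSpace T Ω) (t : ℝ) : HasCompactSupport fun s : ℝ => u (frameMap p e n (s, t)) := by
  have hiso : Isometry fun s : ℝ => frameMap p e n (s, t) := by
    refine Isometry.of_dist_eq fun s s' => ?_
    rw [← F.isometry_axis.dist_eq]
    simp [frameMap]
  exact HasCompactSupport.intro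
    (hiso.isClosedEmbedding.isCompact_preimage F.isBounded.isCompact_closure)
    fun s hs => hu.2.1 _ fun h => hs (subset_closure h)

theorem continuous_frameMap (p e n : Plane) : Continuous (frameMap p e n) := by
  unfold frameMap; fun_prop

theorem continuous_axis {u : Plane → ℝ} (hu : Continuous u) (p e n : Plane) (t : ℝ) :
    Continuous fun s : ℝ => u (frameMap p e n (s, t)) :=
  hu.comp ((continuous_frameMap p e n).comp (by fun_prop))

theorem integrable_axis (F : IsMirrorFrame Ω Ω₁ Ω₂ L p e n) {u v : Plane → ℝ}
    (hu : u ∈ feSpace T Ω) (hv : Continuous v) (t : ℝ) :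
    Integrable fun s : ℝ => u (frameMap p e n (s, t)) * v (frameMap p e n (s, t)) :=
  ((continuous_axis hu.1 p e n t).mul (continuous_axis hv p e n t)).integrable_of_hasCompactSupport
    (hasCompactSupport_axis F hu t).mul_right

theorem pairing_add_left (F : IsMirrorFrame Ω Ω₁ Ω₂ L p e n) {u u' v : Plane → ℝ}
    (hu : u ∈ feSpace T Ω) (hu' : u' ∈ feSpace T Ω) (hv : Continuous v) :
    pairing (interface Ω₁ Ω₂) (u + u') v =
      pairing (interface Ω₁ Ω₂) u v + pairing (interface Ω₁ Ω₂) u' v := by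
  rw [pairing_eq F ((feSpace T Ω).add_mem hu hu'), pairing_eq F hu, pairing_eq F hu',
    ← integral_add (integrable_axis F hu hv 0) (integrable_axis F hu' hv 0)]
  simp only [Pi.add_apply, add_mul]

theorem pairing_smul_left (Γ : Set Plane) (c : ℝ) (u v : Plane → ℝ) :
    pairing Γ (c • u) v = c * pairing Γ u v := by
  unfold pairing
  rw [← integral_const_mul]
  simp only [Pi.smul_apply, smul_eq_mul, mul_assoc]

/-! ### Reflection -/

theorem measurePreserving_reflection (L : AffineSubspace ℝ Plane) [Nonempty L] :
    MeasurePreserving (EuclideanGeometry.reflection L) (volume : Measure Plane) volume := by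
  have h1 := (EuclideanGeometry.reflection L).linearIsometryEquiv.measurePreserving
  have h2 := measurePreserving_add_right (volume : Measure Plane) (EuclideanGeometry.reflection L 0)
  have h3 : (EuclideanGeometry.reflection L : Plane → Plane) =
      (fun x => x + EuclideanGeometry.reflection L 0) ∘
        (EuclideanGeometry.reflection L).linearIsometryEquiv := by
    ext1 x
    have := (EuclideanGeometry.reflection L).map_vsub x 0
    simp only [vsub_eq_sub, sub_zero] at this
    rw [Function.comp_apply, this, sub_add_cancel]
  rw [h3]
  exact h2.comp h1

/-- The chain rule for an isometry. It holds without any differentiability assumption: the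
reflection is an involution, so both sides fail to be differentiable together, and both gradients
then have the default value zero. -/
theorem gradient_comp_reflection (L : AffineSubspace ℝ Plane) [Nonempty L] (u : Plane → ℝ)
    (x : Plane) :
    gradient (u ∘ EuclideanGeometry.reflection L) x =
      (EuclideanGeometry.reflection L).linearIsometryEquiv.symm
        (gradient u (EuclideanGeometry.reflection L x)) := by
  set r := EuclideanGeometry.reflection L with hr
  set R := r.linearIsometryEquiv with hR
  have hrd : ∀ x, HasFDerivAt r (R.toContinuousLinearEquiv : Plane →L[ℝ] Plane) x := fun x => by
    have h : (r : Plane → Plane) = fun x => R x + r 0 := by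
      ext1 x
      have := r.map_vsub x 0
      simp only [vsub_eq_sub, sub_zero] at this
      rw [hR, this, sub_add_cancel]
    rw [h]
    exact (R.toContinuousLinearEquiv : Plane →L[ℝ] Plane).hasFDerivAt.add_const _
  by_cases hd : DifferentiableAt ℝ u (r x)
  · have hc : HasFDerivAt (u ∘ r) ((fderiv ℝ u (r x)).comp
        (R.toContinuousLinearEquiv : Plane →L[ℝ] Plane)) x :=
      hd.hasFDerivAt.comp x (hrd x)
    refine ext_inner_right ℝ fun y => ?_
    have h1 : inner ℝ (R.symm (gradient u (r x))) y = inner ℝ (gradient u (r x)) (R y) := by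
      rw [← R.inner_map_map, R.apply_symm_apply]
    rw [h1]
    unfold gradient
    rw [InnerProductSpace.toDual_symm_apply, InnerProductSpace.toDual_symm_apply, hc.fderiv]
    rfl
  · have hd' : ¬ DifferentiableAt ℝ (u ∘ r) x := fun h => hd <| by
      have hx : r (r x) = x := EuclideanGeometry.reflection_reflection L x
      have h2 : DifferentiableAt ℝ ((u ∘ r) ∘ r) (r x) :=
        DifferentiableAt.comp (r x) (by rwa [hx]) (hrd (r x)).differentiableAt
      have h3 : (u ∘ r) ∘ r = u := by
        ext1 y
        simp only [Function.comp_apply]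
        rw [hr, EuclideanGeometry.reflection_reflection]
      rwa [h3] at h2
    unfold gradient
    rw [fderiv_zero_of_not_differentiableAt hd, fderiv_zero_of_not_differentiableAt hd']
    simp

theorem energy_comp_reflection (F : IsMirrorFrame Ω Ω₁ Ω₂ L p e n) (ν : ℝ) (u v : Plane → ℝ) :
    energy Ω₂ ν (u ∘ EuclideanGeometry.reflection L) (v ∘ EuclideanGeometry.reflection L) =
      energy Ω₁ ν u v := by
  unfold energy
  rw [← F.preimage_eq]
  simp only [gradient_comp_reflection, LinearIsometryEquiv.inner_map_map]
  exact (measurePreserving_reflection L).setIntegral_preimage_emb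
    (EuclideanGeometry.reflection L).toHomeomorph.measurableEmbedding
    (fun y => ν * inner ℝ (gradient u y) (gradient v y)) Ω₁

end

section

/-! ### The trace inequality -/

/-- Cauchy–Schwarz against the constant one, obtained from nonnegativity of the variance about the
mean `m`. -/
theorem sq_intervalIntegral_le {f : ℝ → ℝ} {a b : ℝ} (hab : a < b)
    (hf : IntervalIntegrable f volume a b)
    (hf2 : IntervalIntegrable (fun t => f t ^ 2) volume a b) :
    (∫ t in a..b, f t) ^ 2 ≤ (b - a) * ∫ t in a..b, f t ^ 2 := by
  set I := ∫ t in a..b, f t with hI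
  have hba : 0 < b - a := sub_pos.2 hab
  set m := I / (b - a) with hm
  have h0 : 0 ≤ ∫ t in a..b, (f t - m) ^ 2 :=
    intervalIntegral.integral_nonneg hab.le fun _ _ => sq_nonneg _
  have h1 : ∫ t in a..b, (f t - m) ^ 2 = (∫ t in a..b, f t ^ 2) - 2 * m * I + m ^ 2 * (b - a) := by
    have : ∀ t, (f t - m) ^ 2 = f t ^ 2 - 2 * m * f t + m ^ 2 := fun t => by ring
    simp only [this]
    rw [intervalIntegral.integral_add (hf2.sub (hf.const_mul _)) (by simp),
      intervalIntegral.integral_sub hf2 (hf.const_mul _), intervalIntegral.integral_const_mul,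
      intervalIntegral.integral_const, smul_eq_mul, ← hI]
    ring
  have h2 : m * (b - a) = I := div_mul_cancel₀ _ hba.ne'
  rw [h1] at h0
  have h3 : 0 ≤ ((∫ t in a..b, f t ^ 2) - 2 * m * I + m ^ 2 * (b - a)) * (b - a) :=
    mul_nonneg h0 hba.le
  have h4 : ((∫ t in a..b, f t ^ 2) - 2 * m * I + m ^ 2 * (b - a)) * (b - a) =
      (b - a) * (∫ t in a..b, f t ^ 2) - 2 * (m * (b - a)) * I + (m * (b - a)) ^ 2 := by ring
  rw [h4, h2] at h3
  linarith

/-- A Lipschitz function on the line that vanishes off an open set bounded by `M` is controlled by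
its derivative on the positive part of the set. -/
theorem sq_le_mul_setIntegral_deriv {φ : ℝ → ℝ} {C : NNReal} (hφ : LipschitzWith C φ) {U : Set ℝ}
    (hU : IsOpen U) (h0 : ∀ t, t ∉ U → φ t = 0) {M : ℝ} (hM0 : 0 ≤ M) (hM : ∀ t ∈ U, t ≤ M)
    {t₀ : ℝ} (ht₀ : 0 ≤ t₀) :
    φ t₀ ^ 2 ≤ M * ∫ t in U ∩ Set.Ioi 0, deriv φ t ^ 2 := by
  by_cases ht : t₀ ∈ U
  swap
  · rw [h0 t₀ ht]
    have : 0 ≤ ∫ t in U ∩ Set.Ioi 0, deriv φ t ^ 2 := integral_nonneg fun _ => sq_nonneg _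
    simpa using mul_nonneg hM0 this
  have hbd : ∀ t, ‖deriv φ t‖ ≤ C := fun t => norm_deriv_le_of_lipschitz hφ
  have hbd2 : ∀ t, ‖deriv φ t ^ 2‖ ≤ C ^ 2 := fun t => by
    rw [norm_pow]; exact pow_le_pow_left₀ (norm_nonneg _) (hbd t) 2
  have hmeas : Measurable (deriv φ) := measurable_deriv φ
  have hint : ∀ s : Set ℝ, volume s < ⊤ → IntegrableOn (deriv φ) s := fun s hs =>
    Measure.integrableOn_of_bounded (M := C) hs.ne hmeas.aestronglyMeasurable
      (Filter.Eventually.of_forall hbd)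
  have hint2 : ∀ s : Set ℝ, volume s < ⊤ → IntegrableOn (fun t => deriv φ t ^ 2) s := fun s hs =>
    Measure.integrableOn_of_bounded (M := C ^ 2) hs.ne (hmeas.pow_const 2).aestronglyMeasurable
      (Filter.Eventually.of_forall hbd2)
  -- `t₁ = sInf S` is the first exit from `U` after `t₀`. The function vanishes there, and the whole
  -- interval between lies in `U`, so no convexity of the domain along normals is used.
  set S := Uᶜ ∩ Set.Ici t₀ with hS
  have hSc : IsClosed S := hU.isClosed_compl.inter isClosed_Ici
  have hSne : S.Nonempty := ⟨M + 1, fun h => by linarith [hM _ h], by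
    have := hM _ ht; simp only [Set.mem_Ici]; linarith⟩
  have hSb : BddBelow S := ⟨t₀, fun t h => h.2⟩
  have hmem := hSc.csInf_mem hSne hSb
  set t₁ := sInf S with ht₁
  have hlt : t₀ < t₁ := lt_of_le_of_ne hmem.2 fun h => hmem.1 (h ▸ ht)
  have hsub : ∀ t, t₀ ≤ t → t < t₁ → t ∈ U := fun t h1 h2 => by
    by_contra h
    exact absurd (csInf_le hSb ⟨h, h1⟩) (not_le.2 h2)
  have ht₁M : t₁ ≤ M := by
    by_contra h
    push Not at h
    have h1 := hM t₀ ht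
    -- If `t₁` exceeded `M`, this midpoint would be a point of `U` above `M`.
    have := hM ((M + t₁) / 2) (hsub _ (by linarith) (by linarith))
    linarith
  have hFTC : ∫ t in t₀..t₁, deriv φ t = φ t₁ - φ t₀ :=
    (hφ.lipschitzOnWith.absolutelyContinuousOnInterval).integral_deriv_eq_sub
  rw [h0 t₁ hmem.1] at hFTC
  have hI : IntervalIntegrable (deriv φ) volume t₀ t₁ :=
    (intervalIntegrable_iff_integrableOn_Ioc_of_le hlt.le).2 (hint _ measure_Ioc_lt_top)
  have hI2 : IntervalIntegrable (fun t => deriv φ t ^ 2) volume t₀ t₁ :=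
    (intervalIntegrable_iff_integrableOn_Ioc_of_le hlt.le).2 (hint2 _ measure_Ioc_lt_top)
  have hCS := sq_intervalIntegral_le hlt hI hI2
  have hle : ∫ t in t₀..t₁, deriv φ t ^ 2 ≤ ∫ t in U ∩ Set.Ioi 0, deriv φ t ^ 2 := by
    rw [intervalIntegral.integral_of_le hlt.le, integral_Ioc_eq_integral_Ioo]
    refine setIntegral_mono_set (hint2 _ ?_) (ae_of_all _ fun _ => sq_nonneg _)
      (Filter.Eventually.of_forall ?_)
    · exact (measure_mono (fun t h => ⟨h.2, hM t h.1⟩ : U ∩ Set.Ioi 0 ⊆ Set.Ioc 0 M)).trans_lt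
        measure_Ioc_lt_top
    · exact fun t h => ⟨hsub t h.1.le h.2, ht₀.trans_lt h.1⟩
  have hnn : 0 ≤ ∫ t in t₀..t₁, deriv φ t ^ 2 :=
    intervalIntegral.integral_nonneg hlt.le fun _ _ => sq_nonneg _
  calc φ t₀ ^ 2 = (∫ t in t₀..t₁, deriv φ t) ^ 2 := by rw [hFTC]; ring
    _ ≤ (t₁ - t₀) * ∫ t in t₀..t₁, deriv φ t ^ 2 := hCS
    _ ≤ M * ∫ t in U ∩ Set.Ioi 0, deriv φ t ^ 2 :=
      mul_le_mul (by linarith) hle hnn hM0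

variable {T : Finset (Finset Plane)} {Ω Ω₁ Ω₂ : Set Plane} {L : AffineSubspace ℝ Plane} [Nonempty L]
  {p e n : Plane}

/-- The trace inequality on the lines parallel to the mirror line. -/
theorem integral_sq_le_energy (F : IsMirrorFrame Ω Ω₁ Ω₂ L p e n) {u : Plane → ℝ}
    (hu : u ∈ feSpace T Ω) {C : NNReal} (hC : LipschitzWith C u) {M : ℝ} (hM0 : 0 ≤ M)
    (hM : ∀ x ∈ Ω, height p n x ≤ M) {t₀ : ℝ} (ht₀ : 0 ≤ t₀) :
    ∫ s : ℝ, u (frameMap p e n (s, t₀)) * u (frameMap p e n (s, t₀)) ≤ M * energy Ω₁ 1 u u := by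
  set h : Plane → ℝ := Ω₁.indicator fun x => inner ℝ (gradient u x) (gradient u x) with hh
  have hfin : volume Ω₁ < ⊤ :=
    (measure_mono F.subset₁).trans_lt F.isBounded.measure_lt_top
  have hint : Integrable h :=
    (integrable_indicator_iff F.isOpen₁.measurableSet).2 (integrableOn_inner_gradient hC hC hfin)
  have hmp := F.measurePreserving_frameMap
  have hintc : Integrable (fun z : ℝ × ℝ => h (frameMap p e n z)) :=
    (hmp.integrable_comp hint.aestronglyMeasurable).2 hint
  have hE : energy Ω₁ 1 u u = ∫ s : ℝ, ∫ t : ℝ, h (frameMap p e n (s, t)) := by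
    have h1 : ∫ z : ℝ × ℝ, h (frameMap p e n z) = ∫ x, h x := by
      rw [← hmp.map_eq]
      exact (integral_map hmp.measurable.aemeasurable
        (by rw [hmp.map_eq]; exact hint.aestronglyMeasurable)).symm
    have h2 : ∫ x, h x = energy Ω₁ 1 u u := by
      rw [hh, integral_indicator F.isOpen₁.measurableSet]
      simp only [energy, one_mul]
    rw [← h2, ← h1]
    exact integral_prod _ hintc
  rw [hE, ← integral_const_mul]
  -- Rademacher's theorem in the plane, combined with Fubini, gives differentiability at almost
  -- every point of almost every normal line, which suffices to compare the derivative along the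
  -- line with the full gradient.
  have hd : ∀ᵐ z : ℝ × ℝ, DifferentiableAt ℝ u (frameMap p e n z) :=
    hmp.quasiMeasurePreserving.ae hC.ae_differentiableAt
  have hd' : ∀ᵐ s : ℝ, ∀ᵐ t : ℝ, DifferentiableAt ℝ u (frameMap p e n (s, t)) :=
    Measure.ae_ae_of_ae_prod hd
  have hint1 : ∀ᵐ s : ℝ, Integrable fun t : ℝ => h (frameMap p e n (s, t)) :=
    Integrable.prod_right_ae hintc
  refine integral_mono_ae (integrable_axis F hu hu.1 t₀)
    ((Integrable.integral_prod_left hintc).const_mul M) ?_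
  filter_upwards [hd', hint1] with s hs hs1
  have hline : ∀ t, HasDerivAt (fun t : ℝ => frameMap p e n (s, t)) n t := fun t => by
    have := ((hasDerivAt_id t).smul_const n).const_add (p + s • e)
    simpa [frameMap] using this
  have hlip : LipschitzWith C fun t : ℝ => u (frameMap p e n (s, t)) := by
    refine LipschitzWith.of_dist_le_mul fun t t' => (hC.dist_le_mul _ _).trans_eq ?_
    congr 1
    simp only [frameMap, dist_add_left]
    rw [dist_eq_norm, ← sub_smul, norm_smul, F.norm_n, mul_one, Real.dist_eq, Real.norm_eq_abs]
  set U : Set ℝ := {t | frameMap p e n (s, t) ∈ Ω} with hU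
  have hUo : IsOpen U := F.isOpen.preimage ((continuous_frameMap p e n).comp (by fun_prop))
  have h1 := sq_le_mul_setIntegral_deriv hlip hUo (fun t ht => hu.2.1 _ ht) hM0
    (fun t ht => by have := hM _ ht; rwa [F.height_frameMap] at this) ht₀
  rw [← pow_two]
  refine h1.trans (mul_le_mul_of_nonneg_left ?_ hM0)
  have hind : ∀ t, h (frameMap p e n (s, t)) = (U ∩ Set.Ioi 0).indicator
      (fun t => ‖gradient u (frameMap p e n (s, t))‖ ^ 2) t := fun t => by
    classical
    have : frameMap p e n (s, t) ∈ Ω₁ ↔ t ∈ U ∩ Set.Ioi 0 := by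
      rw [F.eq₁]
      change _ ∧ 0 < height p n _ ↔ _
      rw [F.height_frameMap]; rfl
    simp only [hh, Set.indicator_apply, this, real_inner_self_eq_norm_sq]
  have hmeas : MeasurableSet (U ∩ Set.Ioi 0) := hUo.measurableSet.inter measurableSet_Ioi
  simp only [hind] at hs1 ⊢
  rw [integral_indicator hmeas]
  refine integral_mono_of_nonneg (ae_of_all _ fun _ => sq_nonneg _)
    ((integrable_indicator_iff hmeas).1 hs1) (ae_restrict_of_ae ?_)
  filter_upwards [hs] with t ht
  have hder := (ht.hasFDerivAt.comp_hasDerivAt t (hline t)).deriv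
  have hder' : deriv (fun t : ℝ => u (frameMap p e n (s, t))) t =
      fderiv ℝ u (frameMap p e n (s, t)) n := hder
  rw [hder', norm_gradient_eq, ← sq_abs (fderiv ℝ u _ n)]
  refine pow_le_pow_left₀ (abs_nonneg _) ?_ 2
  have := (fderiv ℝ u (frameMap p e n (s, t))).le_opNorm n
  rwa [F.norm_n, mul_one, Real.norm_eq_abs] at this

theorem eq_zero_of_integral_axis (F : IsMirrorFrame Ω Ω₁ Ω₂ L p e n) {u : Plane → ℝ}
    (hu : u ∈ feSpace T Ω) {t : ℝ}
    (h : ∫ s : ℝ, u (frameMap p e n (s, t)) * u (frameMap p e n (s, t)) ≤ 0) (s : ℝ) :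
    u (frameMap p e n (s, t)) = 0 := by
  have h0 : ∫ s : ℝ, u (frameMap p e n (s, t)) * u (frameMap p e n (s, t)) = 0 :=
    le_antisymm h (integral_nonneg fun _ => mul_self_nonneg _)
  rw [integral_eq_zero_iff_of_nonneg (fun _ => mul_self_nonneg _) (integrable_axis F hu hu.1 t)] at h0
  have hc := continuous_axis hu.1 p e n t
  have := (hc.mul hc).ae_eq_iff_eq volume continuous_zero |>.1 h0
  exact mul_self_eq_zero.1 (congrFun this s)

/-- A finite element function without energy vanishes in the subdomain. -/
theorem eq_zero_of_energy_eq_zero (hT : IsTriangulation T Ω Ω₁ Ω₂)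
    (F : IsMirrorFrame Ω Ω₁ Ω₂ L p e n) {u : Plane → ℝ} (hu : u ∈ feSpace T Ω)
    (h : energy Ω₁ 1 u u = 0) {x : Plane} (hx : x ∈ closure Ω₁) : u x = 0 := by
  obtain ⟨C, hC⟩ := exists_lipschitzWith hT F.isOpen hu
  obtain ⟨M, hM⟩ := (F.isBounded.isCompact_closure.image (continuous_height p n)).bddAbove
  obtain ⟨s, hs⟩ := F.exists_eq_frameMap x
  -- Every point of the closed subdomain lies on a parallel at nonnegative height. The trace
  -- inequality is available on each such parallel, and with zero energy it forces the function to
  -- vanish there.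
  have := integral_sq_le_energy F hu hC (le_max_right M 0)
    (fun y hy => (hM ⟨y, subset_closure hy, rfl⟩).trans (le_max_left M 0)) (F.height_nonneg hx)
  rw [h, mul_zero] at this
  rw [hs]
  exact eq_zero_of_integral_axis F hu this s

end

section

/-! ### Geometry of the elements -/

/-- Moving from the centre of the inscribed disc by `ρ` along and against the gradient changes the
affine function by `2 * ρ * ‖g‖` in total, while its values stay between `-m` and `m` on the
element. -/
theorem gradient_le_of_abs_le {u : Plane → ℝ} {K : Finset Plane} {x : Plane} {ρ m : ℝ}
    (hρ : 0 < ρ) (hball : Metric.closedBall x ρ ⊆ convexHull ℝ (K : Set Plane))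
    {A : Plane →ᵃ[ℝ] ℝ} (hA : ∀ y ∈ convexHull ℝ (K : Set Plane), u y = A y)
    (hm : ∀ q ∈ K, |u q| ≤ m) {y : Plane} (hy : y ∈ convexHull ℝ (K : Set Plane)) :
    ‖gradient u y‖ ≤ m / ρ := by
  have hAm : ∀ z ∈ convexHull ℝ (K : Set Plane), A z ∈ Set.Icc (-m) m := fun z hz =>
    convexHull_min (t := A ⁻¹' Set.Icc (-m) m) (fun q hq => by
      rw [Set.mem_preimage, ← hA q (subset_convexHull ℝ _ hq)]
      exact abs_le.1 (hm q hq)) ((convex_Icc _ _).affine_preimage A) hz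
  have hx := hAm x (hball (Metric.mem_closedBall_self hρ.le))
  have hm0 : 0 ≤ m := by linarith [hx.1, hx.2]
  by_cases hd : DifferentiableAt ℝ u y
  swap
  · unfold gradient
    rw [fderiv_zero_of_not_differentiableAt hd, map_zero, norm_zero]
    positivity
  have hAd : HasFDerivAt A A.linear.toContinuousLinearMap y := by
    rw [A.decomp]
    exact A.linear.toContinuousLinearMap.hasFDerivAt.add_const _
  -- This covers points on the element boundary: a convex set with interior determines derivatives
  -- at all its points, so differentiability of `u` there forces its derivative to be that of `A`.
  have huniq : UniqueDiffWithinAt ℝ (convexHull ℝ (K : Set Plane)) y :=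
    uniqueDiffOn_convex (convex_convexHull ℝ _)
      ⟨x, interior_mono hball (by
        rw [interior_closedBall _ hρ.ne']; exact Metric.mem_ball_self hρ)⟩ y hy
  have hder : fderiv ℝ u y = A.linear.toContinuousLinearMap :=
    huniq.eq hd.hasFDerivAt.hasFDerivWithinAt
      (hAd.hasFDerivWithinAt.congr hA (hA y hy))
  set g := gradient u y with hg
  by_cases hg0 : g = 0
  · rw [hg0, norm_zero]; positivity
  have hgn : ‖g‖ ≠ 0 := norm_ne_zero_iff.2 hg0
  set v := ‖g‖⁻¹ • g with hv
  have hvn : ‖v‖ = 1 := by rw [hv, norm_smul, norm_inv, norm_norm, inv_mul_cancel₀ hgn]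
  have hAv : A.linear v = ‖g‖ := by
    have h1 : inner ℝ g v = fderiv ℝ u y v := InnerProductSpace.toDual_symm_apply
    rw [hder] at h1
    rw [← LinearMap.coe_toContinuousLinearMap' A.linear, ← h1, hv, inner_smul_right,
      real_inner_self_eq_norm_sq]
    field_simp
  have hmem : ∀ c : ℝ, |c| = ρ → A (c • v +ᵥ x) ∈ Set.Icc (-m) m := fun c hc =>
    hAm _ (hball (by
      rw [Metric.mem_closedBall, vadd_eq_add, dist_eq_norm, add_sub_cancel_right, norm_smul, hvn,
        Real.norm_eq_abs, hc, mul_one]))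
  have h1 := hmem ρ (abs_of_pos hρ)
  have h2 := hmem (-ρ) (by rw [abs_neg, abs_of_pos hρ])
  rw [A.map_vadd, map_smul, hAv, smul_eq_mul, vadd_eq_add] at h1 h2
  rw [le_div_iff₀ hρ]
  linarith [h1.2, h2.1]

theorem affineMap_sum_smul (B : Plane →ᵃ[ℝ] ℝ) (K : Finset Plane) (w : Plane → ℝ)
    (hw : ∑ q ∈ K, w q = 1) : B (∑ q ∈ K, w q • q) = ∑ q ∈ K, w q * B q := by
  have h : ∀ x, B x = B.linear x + B 0 := fun x => congrFun B.decomp x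
  have h2 : ∑ q ∈ K, w q * B q = ∑ q ∈ K, (w q * B.linear q + w q * B 0) :=
    Finset.sum_congr rfl fun q _ => by rw [h q, mul_add]
  rw [h, h2, Finset.sum_add_distrib, ← Finset.sum_mul, hw, one_mul, map_sum]
  simp only [map_smul, smul_eq_mul]

/-- A point of a polytope at which a nonnegative affine function vanishes lies in the face where
it vanishes. -/
theorem mem_convexHull_face {B : Plane →ᵃ[ℝ] ℝ} {K : Finset Plane} (hB : ∀ q ∈ K, 0 ≤ B q)
    {x : Plane} (hx : x ∈ convexHull ℝ (K : Set Plane)) (hBx : B x = 0) :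
    x ∈ convexHull ℝ ((K.filter fun q => B q = 0 : Finset Plane) : Set Plane) := by
  rw [Finset.mem_convexHull'] at hx ⊢
  obtain ⟨w, hw0, hw1, rfl⟩ := hx
  rw [affineMap_sum_smul B K w hw1] at hBx
  have hz := (Finset.sum_eq_zero_iff_of_nonneg
    fun q hq => mul_nonneg (hw0 q hq) (hB q hq)).1 hBx
  have hne : ∀ q ∈ K, w q ≠ 0 → B q = 0 := fun q hq h =>
    (mul_eq_zero.1 (hz q hq)).resolve_left h
  refine ⟨w, fun q hq => hw0 q (Finset.mem_filter.1 hq).1, ?_, ?_⟩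
  · rw [Finset.sum_filter_of_ne hne, hw1]
  · exact Finset.sum_filter_of_ne fun q hq h => hne q hq fun h0 => h (by rw [h0, zero_smul])

variable {T : Finset (Finset Plane)} {Ω Ω₁ Ω₂ : Set Plane} {L : AffineSubspace ℝ Plane} [Nonempty L]
  {p e n : Plane}

/-- Since the interface does not cut the element, the height has one sign on its vertices, and its
zero set within the element is a face. -/
theorem mem_convexHull_axis (hT : IsTriangulation T Ω Ω₁ Ω₂) (F : IsMirrorFrame Ω Ω₁ Ω₂ L p e n)
    {K : Finset Plane} (hK : K ∈ T) {x : Plane} (hx : x ∈ convexHull ℝ (K : Set Plane))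
    (hx0 : height p n x = 0) :
    x ∈ convexHull ℝ ((K.filter fun q => height p n q = 0 : Finset Plane) : Set Plane) := by
  rcases hT.uncut K hK with h | h
  · exact mem_convexHull_face (fun q hq => F.height_nonneg (h (subset_convexHull ℝ _ hq))) hx hx0
  · have := mem_convexHull_face (B := -height p n) (K := K) (fun q hq => by
      have := F.height_nonpos (h (subset_convexHull ℝ _ hq))
      simpa using this) hx (by simp [hx0])
    simpa using this

theorem diam_le_meshSize {K : Finset Plane} (hK : K ∈ T) :
    Metric.diam (convexHull ℝ (K : Set Plane)) ≤ meshSize T :=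
  le_ciSup (f := fun K : T => Metric.diam (convexHull ℝ ((K : Finset Plane) : Set Plane)))
    (Set.finite_range _).bddAbove ⟨K, hK⟩

theorem isBounded_element (K : Finset Plane) :
    Bornology.IsBounded (convexHull ℝ (K : Set Plane)) :=
  (K.finite_toSet.isCompact_convexHull ℝ).isBounded

theorem dist_le_meshSize {K : Finset Plane} (hK : K ∈ T) {x y : Plane}
    (hx : x ∈ convexHull ℝ (K : Set Plane)) (hy : y ∈ convexHull ℝ (K : Set Plane)) :
    dist x y ≤ meshSize T :=
  (Metric.dist_le_diam_of_mem (isBounded_element K) hx hy).trans (diam_le_meshSize hK)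

theorem diam_pos (hT : IsTriangulation T Ω Ω₁ Ω₂) {K : Finset Plane} (hK : K ∈ T) :
    0 < Metric.diam (convexHull ℝ (K : Set Plane)) := by
  obtain ⟨a, ha, b, hb, hab⟩ := Finset.one_lt_card.1 (by rw [hT.card_eq K hK]; norm_num : 1 < K.card)
  exact (dist_pos.2 hab).trans_le (Metric.dist_le_diam_of_mem (isBounded_element K)
    (subset_convexHull ℝ _ ha) (subset_convexHull ℝ _ hb))

theorem meshSize_pos (hT : IsTriangulation T Ω Ω₁ Ω₂) (hΩ : Ω.Nonempty) : 0 < meshSize T := by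
  obtain ⟨x, hx⟩ := hΩ
  obtain ⟨K, hK, -⟩ := exists_mem_element hT hx
  exact (diam_pos hT hK).trans_le (diam_le_meshSize hK)

/-- Open sets contained in different elements are disjoint. -/
theorem disjoint_of_subset_element (hT : IsTriangulation T Ω Ω₁ Ω₂) {K K' : Finset Plane}
    (hK : K ∈ T) (hK' : K' ∈ T) (hne : K ≠ K') {U U' : Set Plane} (hU : IsOpen U)
    (hU' : IsOpen U') (hUK : U ⊆ convexHull ℝ (K : Set Plane))
    (hUK' : U' ⊆ convexHull ℝ (K' : Set Plane)) : Disjoint U U' := by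
  rw [Set.disjoint_iff_inter_eq_empty]
  by_contra h
  obtain ⟨x, hx⟩ := Set.nonempty_iff_ne_empty.2 h
  have hsub : U ∩ U' ⊆ convexHull ℝ ((K : Set Plane) ∩ (K' : Set Plane)) :=
    (Set.inter_subset_inter hUK hUK').trans (hT.inter_subset K hK K' hK')
  -- If the open sets met, the common vertices would affinely span the plane. A vertex of `K`
  -- missing from `K'` would then depend affinely on the other vertices of `K`.
  have htop := interior_convexHull_nonempty_iff_affineSpan_eq_top.1
    ⟨x, interior_maximal hsub (hU.inter hU') hx⟩
  obtain ⟨q, hq, hq'⟩ : ∃ q ∈ K, q ∉ K' := by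
    by_contra hc
    push Not at hc
    exact hne (Finset.eq_of_subset_of_card_le hc (by rw [hT.card_eq K hK, hT.card_eq K' hK']))
  have := (hT.indep K hK).notMem_affineSpan_sdiff ⟨q, hq⟩ Set.univ
  refine this (affineSpan_mono ℝ ?_ (htop ▸ AffineSubspace.mem_top ℝ Plane q))
  rintro y ⟨hy, hy'⟩
  refine ⟨⟨y, hy⟩, ⟨Set.mem_univ _, ?_⟩, rfl⟩
  rintro h
  have : y = q := congrArg Subtype.val h
  exact hq' (this ▸ hy')

theorem volume_real_ball (x : Plane) {r : ℝ} (hr : 0 ≤ r) :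
    volume.real (Metric.ball x r) = Real.pi * r ^ 2 := by
  rw [measureReal_def, EuclideanSpace.volume_ball_fin_two]
  simp [ENNReal.toReal_ofReal hr, Real.pi_pos.le, mul_comm]

theorem volume_real_closedBall (x : Plane) {r : ℝ} (hr : 0 ≤ r) :
    volume.real (Metric.closedBall x r) = Real.pi * r ^ 2 := by
  rw [measureReal_def, EuclideanSpace.volume_closedBall_fin_two]
  simp [ENNReal.toReal_ofReal hr, Real.pi_pos.le, mul_comm]

/-- The number of elements near a point is bounded. -/
theorem card_near_le (hT : IsTriangulation T Ω Ω₁ Ω₂) {h r : ℝ} (hr : 0 < r) (hh : 0 ≤ h)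
    (hmesh : meshSize T ≤ h) {c : Finset Plane → Plane}
    (hc : ∀ K ∈ T, Metric.ball (c K) r ⊆ convexHull ℝ (K : Set Plane)) (y : Plane)
    (S : Finset (Finset Plane)) (hS : S ⊆ T) (hy : ∀ K ∈ S, dist y (c K) ≤ 2 * h) :
    (S.card : ℝ) ≤ 9 * h ^ 2 / r ^ 2 := by
  -- A packing argument: the inscribed discs are disjoint and all fit into a disc of radius `3 * h`,
  -- made of `2 * h` to reach a centre and `h` to cross an element.
  have hsub : (⋃ K ∈ S, Metric.ball (c K) r) ⊆ Metric.closedBall y (3 * h) := by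
    refine Set.iUnion₂_subset fun K hK z hz => ?_
    have h1 := dist_le_meshSize (hS hK) (hc K (hS hK) hz)
      (hc K (hS hK) (Metric.mem_ball_self hr))
    have h2 := hy K hK
    rw [Metric.mem_closedBall]
    have h3 := dist_triangle z (c K) y
    rw [dist_comm (c K) y] at h3
    linarith
  have hvol : volume.real (⋃ K ∈ S, Metric.ball (c K) r) = S.card * (Real.pi * r ^ 2) := by
    rw [measureReal_biUnion_finset]
    · simp only [volume_real_ball _ hr.le, Finset.sum_const, nsmul_eq_mul]
    · intro K hK K' hK' hne
      exact disjoint_of_subset_element hT (hS hK) (hS hK') hne Metric.isOpen_ball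
        Metric.isOpen_ball (hc K (hS hK)) (hc K' (hS hK'))
    · exact fun _ _ => measurableSet_ball
  have := measureReal_mono hsub (μ := volume) measure_closedBall_lt_top.ne
  rw [hvol, volume_real_closedBall _ (by positivity)] at this
  rw [le_div_iff₀ (by positivity)]
  have h2 : Real.pi * (S.card * r ^ 2) ≤ Real.pi * (9 * h ^ 2) := by linarith
  exact le_of_mul_le_mul_left h2 Real.pi_pos

/-- An element containing a disc cannot lie in the mirror line: moving from the centre by `ρ` along
the normal changes the height. -/
theorem filter_height_ne (F : IsMirrorFrame Ω Ω₁ Ω₂ L p e n) {K : Finset Plane} {x : Plane} {ρ : ℝ}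
    (hρ : 0 < ρ) (hball : Metric.closedBall x ρ ⊆ convexHull ℝ (K : Set Plane)) :
    ∃ q ∈ K, height p n q ≠ 0 := by
  by_contra h
  push Not at h
  have h0 : Set.EqOn (height p n) (AffineMap.const ℝ Plane 0) (convexHull ℝ (K : Set Plane)) :=
    affineMap_eqOn_convexHull fun q hq => h q hq
  have h1 := h0 (hball (Metric.mem_closedBall_self hρ.le))
  have h2 := h0 (hball (show x + ρ • n ∈ Metric.closedBall x ρ by
    rw [Metric.mem_closedBall, dist_eq_norm, add_sub_cancel_left, norm_smul, F.norm_n, mul_one,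
      Real.norm_eq_abs, abs_of_pos hρ]))
  rw [height_apply] at h1 h2
  rw [add_sub_right_comm, inner_add_right, h1, inner_smul_right, real_inner_self_eq_norm_sq,
    F.norm_n] at h2
  simp at h2
  exact hρ.ne' h2

/-- An element edge on the mirror line is at least as long as the diameter of an inscribed disc. -/
theorem two_mul_le_dist_of_edge (hT : IsTriangulation T Ω Ω₁ Ω₂) (F : IsMirrorFrame Ω Ω₁ Ω₂ L p e n)
    {K : Finset Plane} (hK : K ∈ T) {x : Plane} {ρ : ℝ} (hρ : 0 < ρ)
    (hball : Metric.closedBall x ρ ⊆ convexHull ℝ (K : Set Plane)) {q₁ q₂ : Plane} (hq₁ : q₁ ∈ K)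
    (hq₂ : q₂ ∈ K) (hne : q₁ ≠ q₂) (h₁ : height p n q₁ = 0) (h₂ : height p n q₂ = 0) :
    2 * ρ ≤ dist q₁ q₂ := by
  classical
  obtain ⟨q₃, hq₃, h₃⟩ := filter_height_ne F hρ hball
  have h13 : q₁ ≠ q₃ := fun h => h₃ (h ▸ h₁)
  have h23 : q₂ ≠ q₃ := fun h => h₃ (h ▸ h₂)
  have hKeq : {q₁, q₂, q₃} = K := by
    refine Finset.eq_of_subset_of_card_le ?_ ?_
    · intro q hq
      simp only [Finset.mem_insert, Finset.mem_singleton] at hq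
      rcases hq with rfl | rfl | rfl <;> assumption
    · rw [hT.card_eq K hK, Finset.card_eq_three.2 ⟨q₁, q₂, q₃, hne, h13, h23, rfl⟩]
  -- The diameter of the disc parallel to the mirror line is written in barycentric coordinates. Its
  -- ends have the same height, hence the same weight `d` at `q₃`, so it is a multiple of the edge
  -- by a factor of modulus at most one.
  have hmem : ∀ c : ℝ, |c| = ρ → ∃ a b d : ℝ, 0 ≤ a ∧ 0 ≤ b ∧ 0 ≤ d ∧ a + b + d = 1 ∧
      a • q₁ + b • q₂ + d • q₃ = x + c • e ∧ height p n (x + c • e) = d * height p n q₃ := by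
    intro c hc
    have : x + c • e ∈ convexHull ℝ (K : Set Plane) := hball (by
      rw [Metric.mem_closedBall, dist_eq_norm, add_sub_cancel_left, norm_smul, F.norm_e, mul_one,
        Real.norm_eq_abs, hc])
    rw [Finset.mem_convexHull'] at this
    obtain ⟨w, hw0, hw1, hwx⟩ := this
    have hwh := affineMap_sum_smul (height p n) K w hw1
    rw [hwx] at hwh
    rw [← hKeq] at hw1 hwx hwh
    rw [Finset.sum_insert (by simp [hne, h13]), Finset.sum_insert (by simp [h23]),
      Finset.sum_singleton, ← add_assoc] at hw1 hwx hwh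
    refine ⟨w q₁, w q₂, w q₃, hw0 _ hq₁, hw0 _ hq₂, hw0 _ hq₃, hw1, hwx, ?_⟩
    rw [hwh, h₁, h₂]
    ring
  obtain ⟨a, b, d, ha, hb, hd, hs, hx, hh⟩ := hmem ρ (abs_of_pos hρ)
  obtain ⟨a', b', d', ha', hb', hd', hs', hx', hh'⟩ := hmem (-ρ) (by rw [abs_neg, abs_of_pos hρ])
  have hce : ∀ c : ℝ, height p n (x + c • e) = height p n x := fun c => by
    rw [height_apply, add_sub_right_comm, inner_add_right, inner_smul_right, real_inner_comm e n,
      F.inner_eq, mul_zero, add_zero, height_apply]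
  have hdd : d = d' := by
    rw [hce] at hh hh'
    exact mul_right_cancel₀ h₃ (hh.symm.trans hh')
  have hdiff : (2 * ρ) • e = (a - a') • (q₁ - q₂) := by
    have h1 : (2 * ρ) • e = (x + ρ • e) - (x + (-ρ) • e) := by module
    have h2 : b - b' = -(a - a') := by linarith
    rw [h1, ← hx, ← hx', hdd]
    have h3 : a • q₁ + b • q₂ + d' • q₃ - (a' • q₁ + b' • q₂ + d' • q₃) =
      (a - a') • q₁ + (b - b') • q₂ := by module
    rw [h3, h2]
    module
  have hn := congrArg norm hdiff
  rw [norm_smul, norm_smul, F.norm_e, Real.norm_eq_abs, Real.norm_eq_abs, mul_one,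
    abs_of_pos (by positivity), ← dist_eq_norm] at hn
  rw [hn]
  refine mul_le_of_le_one_left dist_nonneg (abs_le.2 ⟨?_, ?_⟩) <;> linarith

/-- Every point of the mirror line in the domain lies on an element edge in the mirror line. -/
theorem exists_edge (hT : IsTriangulation T Ω Ω₁ Ω₂) (F : IsMirrorFrame Ω Ω₁ Ω₂ L p e n)
    {σ : ℝ} (hσ : 0 < σ) (hreg : IsShapeRegular σ T) {x : Plane} (hx : x ∈ Ω)
    (hx0 : height p n x = 0) :
    ∃ K ∈ T, ∃ q₁ ∈ K, ∃ q₂ ∈ K, q₁ ≠ q₂ ∧ height p n q₁ = 0 ∧ height p n q₂ = 0 ∧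
      x ∈ segment ℝ q₁ q₂ := by
  classical
  have hcont : Continuous fun t : ℝ => x + t • e := by fun_prop
  have hev : ∀ᶠ t in nhdsWithin (0 : ℝ) (Set.Ioi 0), x + t • e ∈ Ω :=
    (hcont.tendsto' 0 x (by simp)).mono_left nhdsWithin_le_nhds (F.isOpen.mem_nhds hx)
  -- Finitely many elements cover the points of the line just after `x`, so one of them contains
  -- points arbitrarily close to `x`, and `x` itself because it is closed. A face containing two
  -- points of the line cannot be a single vertex.
  have hfr : ∃ K ∈ T, ∃ᶠ t in nhdsWithin (0 : ℝ) (Set.Ioi 0),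
      x + t • e ∈ convexHull ℝ (K : Set Plane) := by
    by_contra h
    push Not at h
    have h2 : ∀ᶠ t in nhdsWithin (0 : ℝ) (Set.Ioi 0), ∀ K ∈ T,
        x + t • e ∉ convexHull ℝ (K : Set Plane) :=
      (Filter.eventually_all_finset T).2 fun K hK => Filter.not_frequently.1 (by simpa using h K hK)
    obtain ⟨t, ht, ht'⟩ := (hev.and h2).exists
    obtain ⟨K, hK, hxK⟩ := exists_mem_element hT ht
    exact ht' K hK hxK
  obtain ⟨K, hK, hfr⟩ := hfr
  have hxK : x ∈ convexHull ℝ (K : Set Plane) :=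
    (isClosed_element K).mem_of_frequently_of_tendsto hfr
      ((hcont.tendsto' 0 x (by simp)).mono_left nhdsWithin_le_nhds)
  obtain ⟨t, hty, ht⟩ := (hfr.and_eventually self_mem_nhdsWithin).exists
  have hte : height p n (x + t • e) = 0 := by
    rw [height_apply, add_sub_right_comm, inner_add_right, inner_smul_right,
      real_inner_comm e n, F.inner_eq, mul_zero, add_zero, ← height_apply, hx0]
  have hZx := mem_convexHull_axis hT F hK hxK hx0
  have hZy := mem_convexHull_axis hT F hK hty hte
  set Z := K.filter fun q => height p n q = 0 with hZ
  have hxy : x ≠ x + t • e := fun h => by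
    have h1 : t • e = 0 := by simpa using h.symm
    have h2 := congrArg norm h1
    rw [norm_smul, F.norm_e, norm_zero, mul_one, norm_eq_zero] at h2
    exact (ne_of_gt ht) h2
  obtain ⟨c, hc⟩ := hreg K hK
  obtain ⟨q₃, hq₃, h₃⟩ := filter_height_ne F (mul_pos hσ (diam_pos hT hK)) hc
  have hlt : Z.card < 3 := by
    rw [← hT.card_eq K hK]
    refine Finset.card_lt_card (Finset.filter_ssubset.2 ⟨q₃, hq₃, h₃⟩)
  have hcard : Z.card = 2 := by
    have h1 : Z.card ≠ 0 := fun h => by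
      rw [Finset.card_eq_zero.1 h] at hZx
      simp at hZx
    have h2 : Z.card ≠ 1 := fun h => by
      obtain ⟨q, hq⟩ := Finset.card_eq_one.1 h
      rw [hq] at hZx hZy
      simp only [Finset.coe_singleton, convexHull_singleton, Set.mem_singleton_iff] at hZx hZy
      exact hxy (hZx.trans hZy.symm)
    omega
  obtain ⟨q₁, q₂, hne, hq⟩ := Finset.card_eq_two.1 hcard
  have hm₁ : q₁ ∈ Z := by rw [hq]; simp
  have hm₂ : q₂ ∈ Z := by rw [hq]; simp
  rw [hq, Finset.coe_pair, convexHull_pair] at hZx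
  exact ⟨K, hK, q₁, (Finset.mem_filter.1 hm₁).1, q₂, (Finset.mem_filter.1 hm₂).1, hne,
    (Finset.mem_filter.1 hm₁).2, (Finset.mem_filter.1 hm₂).2, hZx⟩

end

section

/-! ### The inverse estimate -/

/-- With end values `A` and `B`, the integral is `(b - a) * (A ^ 2 + A * B + B ^ 2) / 3`. By
convexity the square is largest at an end, and completing squares gives the factor four. -/
theorem sq_affine_le {α β a b s : ℝ} (hab : a < b) (hs : s ∈ Set.Icc a b) :
    (b - a) * (α + β * s) ^ 2 ≤ 4 * ∫ t in a..b, (α + β * t) ^ 2 := by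
  have hI : ∫ t in a..b, (α + β * t) ^ 2 =
      (α ^ 2 * b + α * β * b ^ 2 + β ^ 2 * b ^ 3 / 3) -
        (α ^ 2 * a + α * β * a ^ 2 + β ^ 2 * a ^ 3 / 3) := by
    refine intervalIntegral.integral_eq_sub_of_hasDerivAt
      (f := fun t => α ^ 2 * t + α * β * t ^ 2 + β ^ 2 * t ^ 3 / 3) (fun t _ => ?_)
      (Continuous.intervalIntegrable (by fun_prop) _ _)
    have h1 := (hasDerivAt_id t).const_mul (α ^ 2)
    have h2 := (hasDerivAt_pow 2 t).const_mul (α * β)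
    have h3 := ((hasDerivAt_pow 3 t).const_mul (β ^ 2)).div_const 3
    refine ((h1.add h2).add h3).congr_deriv ?_
    push_cast
    ring
  have hba : 0 < b - a := sub_pos.2 hab
  have hI' : ∫ t in a..b, (α + β * t) ^ 2 = (b - a) *
      (((α + β * a) ^ 2 + (α + β * a) * (α + β * b) + (α + β * b) ^ 2) / 3) := by
    rw [hI]; ring
  rw [hI', ← mul_assoc, mul_comm 4, mul_assoc]
  refine mul_le_mul_of_nonneg_left ?_ hba.le
  set A := α + β * a with hA
  set B := α + β * b with hB
  set l := (s - a) / (b - a) with hl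
  have hl0 : 0 ≤ l := div_nonneg (by linarith [hs.1]) hba.le
  have hl1 : l ≤ 1 := (div_le_one hba).2 (by linarith [hs.2])
  have hsl : α + β * s = (1 - l) * A + l * B := by
    have : l * (b - a) = s - a := div_mul_cancel₀ _ hba.ne'
    rw [hA, hB]
    linear_combination (-β) * this
  have h1 : (α + β * s) ^ 2 ≤ (1 - l) * A ^ 2 + l * B ^ 2 := by
    have h2 : (1 - l) * A ^ 2 + l * B ^ 2 - (α + β * s) ^ 2 = l * (1 - l) * (A - B) ^ 2 := by
      rw [hsl]; ring
    have h3 : 0 ≤ l * (1 - l) * (A - B) ^ 2 :=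
      mul_nonneg (mul_nonneg hl0 (by linarith)) (sq_nonneg _)
    linarith
  have hA2 : A ^ 2 ≤ 4 * ((A ^ 2 + A * B + B ^ 2) / 3) := by
    linarith [sq_nonneg (A + 2 * B), (by ring : (A + 2 * B) ^ 2 = A ^ 2 + 4 * (A * B) + 4 * B ^ 2)]
  have hB2 : B ^ 2 ≤ 4 * ((A ^ 2 + A * B + B ^ 2) / 3) := by
    linarith [sq_nonneg (2 * A + B), (by ring : (2 * A + B) ^ 2 = 4 * A ^ 2 + 4 * (A * B) + B ^ 2)]
  have h4 := mul_le_mul_of_nonneg_left hA2 (by linarith : 0 ≤ 1 - l)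
  have h5 := mul_le_mul_of_nonneg_left hB2 hl0
  linarith

variable {T : Finset (Finset Plane)} {Ω Ω₁ Ω₂ : Set Plane} {L : AffineSubspace ℝ Plane} [Nonempty L]
  {p e n : Plane}

theorem frameMap_axis (p e n : Plane) (s : ℝ) : frameMap p e n (s, 0) = p + s • e := by
  simp [frameMap]

/-- Values of a finite element function on the mirror line are controlled by its local mean
square. -/
theorem sq_le_integral_near (hT : IsTriangulation T Ω Ω₁ Ω₂) (F : IsMirrorFrame Ω Ω₁ Ω₂ L p e n)
    {σ : ℝ} (hσ : 0 < σ) (hreg : IsShapeRegular σ T) {r : ℝ}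
    (hr : ∀ K ∈ T, r ≤ σ * Metric.diam (convexHull ℝ (K : Set Plane))) {w : Plane → ℝ}
    (hw : w ∈ feSpace T Ω) {x : Plane} (hx : x ∈ Ω) (hx0 : height p n x = 0) :
    r * w x ^ 2 ≤ 2 * ∫ s in {s : ℝ | dist (frameMap p e n (s, 0)) x ≤ meshSize T},
      w (frameMap p e n (s, 0)) * w (frameMap p e n (s, 0)) := by
  obtain ⟨K, hK, q₁, hq₁, q₂, hq₂, hne, h₁, h₂, hseg⟩ := exists_edge hT F hσ hreg hx hx0
  obtain ⟨c, hc⟩ := hreg K hK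
  have hlen := two_mul_le_dist_of_edge hT F hK (mul_pos hσ (diam_pos hT hK)) hc hq₁ hq₂ hne h₁ h₂
  obtain ⟨s₁, hs₁⟩ := F.exists_eq_frameMap q₁
  obtain ⟨s₂, hs₂⟩ := F.exists_eq_frameMap q₂
  rw [h₁] at hs₁
  rw [h₂] at hs₂
  have hsub : segment ℝ q₁ q₂ ⊆ convexHull ℝ (K : Set Plane) :=
    (convex_convexHull ℝ _).segment_subset (subset_convexHull ℝ _ hq₁)
      (subset_convexHull ℝ _ hq₂)
  have himage : (fun s : ℝ => p + s • e) '' Set.uIcc s₁ s₂ = segment ℝ q₁ q₂ := by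
    have : (fun s : ℝ => p + s • e) = AffineMap.lineMap (k := ℝ) p (p + e) := by
      ext1 s
      simp [AffineMap.lineMap_apply, add_comm]
    rw [this, ← segment_eq_uIcc, image_segment, ← this, hs₁, hs₂, frameMap_axis, frameMap_axis]
  rw [← himage] at hsub hseg
  obtain ⟨s, hs, hsx⟩ := hseg
  obtain ⟨A, hA⟩ := hw.2.2 K hK
  have hwA : ∀ t ∈ Set.uIcc s₁ s₂, w (p + t • e) = A p + A.linear e * t := fun t ht => by
    rw [hA (p + t • e) (hsub ⟨t, ht, rfl⟩), add_comm p, ← vadd_eq_add, A.map_vadd, map_smul, smul_eq_mul,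
      vadd_eq_add]
    ring
  have hdist : dist q₁ q₂ = |s₁ - s₂| := by
    rw [hs₁, hs₂, F.isometry_axis.dist_eq, Real.dist_eq]
  set a := min s₁ s₂ with ha
  set b := max s₁ s₂ with hb
  have hba : b - a = dist q₁ q₂ := by rw [hdist, ha, hb, max_sub_min_eq_abs']
  have hab : a < b := by
    have := dist_pos.2 hne
    linarith
  have hIcc : Set.uIcc s₁ s₂ = Set.Icc a b := rfl
  rw [hIcc] at hs hwA hsub
  have hmain := sq_affine_le (α := A p) (β := A.linear e) hab hs
  rw [← hwA s hs] at hmain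
  have hxs : p + s • e = x := hsx
  rw [hxs] at hmain
  have hle : ∫ t in a..b, (A p + A.linear e * t) ^ 2 ≤
      ∫ s in {s : ℝ | dist (frameMap p e n (s, 0)) x ≤ meshSize T},
        w (frameMap p e n (s, 0)) * w (frameMap p e n (s, 0)) := by
    rw [intervalIntegral.integral_of_le hab.le]
    have h1 : ∫ t in Set.Ioc a b, (A p + A.linear e * t) ^ 2 =
        ∫ s in Set.Ioc a b, w (frameMap p e n (s, 0)) * w (frameMap p e n (s, 0)) :=
      setIntegral_congr_fun measurableSet_Ioc fun t ht => by
        simp only [frameMap_axis]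
        rw [hwA t (Set.Ioc_subset_Icc_self ht), pow_two]
    rw [h1]
    refine setIntegral_mono_set (integrable_axis F hw hw.1 0).integrableOn
      (ae_of_all _ fun _ => mul_self_nonneg _) (Filter.Eventually.of_forall fun t ht => ?_)
    change dist _ _ ≤ _
    rw [frameMap_axis, ← hxs]
    exact dist_le_meshSize hK (hsub ⟨t, Set.Ioc_subset_Icc_self ht, rfl⟩) (hsub ⟨s, hs, rfl⟩)
  -- The edge is at least as long as the diameter of the inscribed disc; this turns the factor four
  -- of `sq_affine_le` into two.
  have hr2 : 2 * r ≤ b - a := by rw [hba]; linarith [hr K hK]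
  have := mul_le_mul_of_nonneg_right hr2 (sq_nonneg (w x))
  linarith

/-- Overlaps of elements are counted repeatedly, which is harmless for a nonnegative integrand and
avoids showing that edges are null sets. -/
theorem setIntegral_le_sum_element (hT : IsTriangulation T Ω Ω₁ Ω₂) {D : Set Plane}
    (hD : IsOpen D) (hDΩ : D ⊆ Ω) {f : Plane → ℝ} (hf : ∀ x, 0 ≤ f x)
    (hfi : ∀ K ∈ T, IntegrableOn f (convexHull ℝ (K : Set Plane))) :
    ∫ x in D, f x ≤ ∑ K ∈ T, ∫ x in convexHull ℝ (K : Set Plane), f x := by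
  classical
  have hm : ∀ K : Finset Plane, MeasurableSet (convexHull ℝ (K : Set Plane)) := fun K =>
    (isClosed_element K).measurableSet
  have hi : ∀ K ∈ T, Integrable ((convexHull ℝ (K : Set Plane)).indicator f) := fun K hK =>
    (integrable_indicator_iff (hm K)).2 (hfi K hK)
  rw [← integral_indicator hD.measurableSet]
  simp only [← integral_indicator (hm _)]
  rw [← integral_finsetSum _ hi]
  refine integral_mono_of_nonneg (ae_of_all _ fun x => Set.indicator_nonneg (fun x _ => hf x) x)
    (integrable_finsetSum _ hi) (ae_of_all _ fun x => ?_)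
  have hnn : ∀ K ∈ T, 0 ≤ (convexHull ℝ (K : Set Plane)).indicator f x := fun K _ =>
    Set.indicator_nonneg (fun x _ => hf x) x
  by_cases hx : x ∈ D
  · obtain ⟨K, hK, hxK⟩ := exists_mem_element hT (hDΩ hx)
    simp only
    rw [Set.indicator_of_mem hx]
    calc f x = (convexHull ℝ (K : Set Plane)).indicator f x := (Set.indicator_of_mem hxK f).symm
      _ ≤ _ := Finset.single_le_sum hnn hK
  · simp only
    rw [Set.indicator_of_notMem hx]
    exact Finset.sum_nonneg hnn

/-- Every trace is the trace of a finite element function with energy bounded by the inverse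
estimate. -/
theorem exists_lift (hT : IsTriangulation T Ω Ω₁ Ω₂) (F : IsMirrorFrame Ω Ω₁ Ω₂ L p e n)
    {σ τ : ℝ} (hσ : 0 < σ) (hτ : 0 < τ) (hreg : IsShapeRegular σ T) (hqu : IsQuasiUniform τ T)
    {w : Plane → ℝ} (hw : w ∈ feSpace T Ω) :
    ∃ w' ∈ feSpace T Ω, (∀ x, height p n x = 0 → w' x = w x) ∧
      energy Ω₁ 1 w' w' ≤ 18 * Real.pi / (σ ^ 5 * τ ^ 3) * (meshSize T)⁻¹ *
        ∫ s : ℝ, w (frameMap p e n (s, 0)) * w (frameMap p e n (s, 0)) := by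
  classical
  -- The lift keeps the nodal values on the mirror line and is zero at all other vertices.
  obtain ⟨w', hw', hwc⟩ := exists_interpolant hT F.isOpen
    (fun x => if height p n x = 0 then w x else 0)
    (fun x hx => by simp only [hw.2.1 x hx, ite_self])
  refine ⟨w', hw', fun x hx0 => ?_, ?_⟩
  · by_cases hx : x ∈ Ω
    swap
    · rw [hw.2.1 x hx, hw'.2.1 x hx]
    obtain ⟨K, hK, hxK⟩ := exists_mem_element hT hx
    obtain ⟨A, hA⟩ := hw.2.2 K hK
    obtain ⟨A', hA'⟩ := hw'.2.2 K hK
    rw [hA x hxK, hA' x hxK]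
    refine affineMap_eqOn_convexHull (fun q hq => ?_) (mem_convexHull_axis hT F hK hxK hx0)
    obtain ⟨hqK, hq0⟩ := Finset.mem_filter.1 hq
    rw [← hA q (subset_convexHull ℝ _ hqK), ← hA' q (subset_convexHull ℝ _ hqK), hwc K hK q hqK,
      if_pos hq0]
  set h := meshSize T with hh
  have hpos : 0 < h := meshSize_pos hT F.nonempty
  choose! c hc using hreg
  set d : Finset Plane → ℝ := fun K => Metric.diam (convexHull ℝ (K : Set Plane)) with hd
  set r := σ * (τ * h) with hr
  have hr0 : 0 < r := by positivity
  have hrK : ∀ K ∈ T, r ≤ σ * d K := fun K hK => mul_le_mul_of_nonneg_left (hqu K hK) hσ.le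
  set g : ℝ → ℝ := fun s => w (frameMap p e n (s, 0)) * w (frameMap p e n (s, 0)) with hg
  have hg0 : ∀ s, 0 ≤ g s := fun s => mul_self_nonneg _
  have hgi : Integrable g := integrable_axis F hw hw.1 0
  -- The window radius `2 * h` allows `h` from the centre of the element to a vertex and `h` along
  -- an edge that may belong to a neighbouring element.
  set I : Finset Plane → Set ℝ := fun K => {s : ℝ | dist (frameMap p e n (s, 0)) (c K) ≤ 2 * h}
    with hI
  have hIc : ∀ K, IsClosed (I K) := fun K =>
    isClosed_le (((continuous_frameMap p e n).comp (by fun_prop : Continuous fun s : ℝ => (s, (0 : ℝ)))).dist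
      continuous_const) continuous_const
  set J : Finset Plane → ℝ := fun K => ∫ s in I K, g s with hJ
  have hJ0 : ∀ K, 0 ≤ J K := fun K => integral_nonneg hg0
  have hcK : ∀ K ∈ T, c K ∈ convexHull ℝ (K : Set Plane) := fun K hK =>
    hc K hK (Metric.mem_closedBall_self (mul_pos hσ (diam_pos hT hK)).le)
  have hnode : ∀ K ∈ T, ∀ q ∈ K, |w' q| ≤ Real.sqrt (2 / r * J K) := by
    intro K hK q hq
    rw [hwc K hK q hq]
    split_ifs with hq0
    · by_cases hqΩ : q ∈ Ω
      · refine Real.abs_le_sqrt ?_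
        have h1 := sq_le_integral_near hT F hσ (fun K hK => ⟨c K, hc K hK⟩) hrK hw hqΩ hq0
        have h2 : ∫ s in {s : ℝ | dist (frameMap p e n (s, 0)) q ≤ h}, g s ≤ J K := by
          refine setIntegral_mono_set hgi.integrableOn (ae_of_all _ hg0)
            (Filter.Eventually.of_forall fun s hs => ?_)
          have h3 := dist_le_meshSize hK (subset_convexHull ℝ _ hq) (hcK K hK)
          have h4 : dist (frameMap p e n (s, 0)) q ≤ h := hs
          change dist _ _ ≤ 2 * h
          linarith [dist_triangle (frameMap p e n (s, 0)) q (c K)]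
        rw [div_mul_eq_mul_div, le_div_iff₀ hr0]
        linarith
      · rw [hw.2.1 q hqΩ, abs_zero]; exact Real.sqrt_nonneg _
    · rw [abs_zero]; exact Real.sqrt_nonneg _
  have hgrad : ∀ K ∈ T, ∀ y ∈ convexHull ℝ (K : Set Plane),
      ‖gradient w' y‖ ≤ Real.sqrt (2 / r * J K) / (σ * d K) := fun K hK y hy => by
    obtain ⟨A, hA⟩ := hw'.2.2 K hK
    exact gradient_le_of_abs_le (mul_pos hσ (diam_pos hT hK)) (hc K hK) hA (hnode K hK) hy
  obtain ⟨C, hC⟩ := exists_lipschitzWith hT F.isOpen hw'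
  have helem : ∀ K ∈ T, ∫ x in convexHull ℝ (K : Set Plane),
      inner ℝ (gradient w' x) (gradient w' x) ≤ Real.pi / σ ^ 2 * (2 / r * J K) := by
    intro K hK
    have hdK : 0 < d K := diam_pos hT hK
    have h1 := norm_setIntegral_le_of_norm_le_const (μ := volume) (s := convexHull ℝ (K : Set Plane))
      (f := fun x => inner ℝ (gradient w' x) (gradient w' x))
      (C := (Real.sqrt (2 / r * J K) / (σ * d K)) ^ 2)
      (isBounded_element K).measure_lt_top (fun x hx => by
        rw [real_inner_self_eq_norm_sq, norm_pow, norm_norm]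
        exact pow_le_pow_left₀ (norm_nonneg _) (hgrad K hK x hx) 2)
    have h2 : volume.real (convexHull ℝ (K : Set Plane)) ≤ Real.pi * d K ^ 2 := by
      rw [← volume_real_closedBall (c K) hdK.le]
      refine measureReal_mono (fun y hy => ?_) measure_closedBall_lt_top.ne
      exact Metric.dist_le_diam_of_mem (isBounded_element K) hy (hcK K hK)
    rw [div_pow, Real.sq_sqrt (mul_nonneg (by positivity) (hJ0 K))] at h1
    calc _ ≤ _ := le_trans (le_abs_self _) h1
      _ ≤ 2 / r * J K / (σ * d K) ^ 2 * (Real.pi * d K ^ 2) :=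
        mul_le_mul_of_nonneg_left h2
          (div_nonneg (mul_nonneg (by positivity) (hJ0 K)) (by positivity))
      _ = _ := by field_simp
  -- The windows overlap boundedly often: a point of the line lies in the window of at most `9 * h ^
  -- 2 / r ^ 2` elements.
  have hsum : ∑ K ∈ T, J K ≤ 9 * h ^ 2 / r ^ 2 * ∫ s, g s := by
    have h1 : ∀ K ∈ T, Integrable ((I K).indicator g) := fun K _ =>
      hgi.indicator (hIc K).measurableSet
    simp only [hJ, ← integral_indicator (hIc _).measurableSet]
    rw [← integral_finsetSum _ h1, ← integral_const_mul]
    refine integral_mono (integrable_finsetSum _ h1) (hgi.const_mul _) fun s => ?_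
    have h2 : ∑ K ∈ T, (I K).indicator g s = ((T.filter fun K => s ∈ I K).card : ℝ) * g s := by
      simp only [Set.indicator_apply]
      rw [← Finset.sum_filter, Finset.sum_const, nsmul_eq_mul]
    simp only
    rw [h2]
    refine mul_le_mul_of_nonneg_right ?_ (hg0 s)
    exact card_near_le hT hr0 hpos.le le_rfl
      (fun K hK => Metric.ball_subset_closedBall.trans
        ((Metric.closedBall_subset_closedBall (hrK K hK)).trans (hc K hK)))
      (frameMap p e n (s, 0)) _ (Finset.filter_subset _ _)
      fun K hK => (Finset.mem_filter.1 hK).2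
  have hfin : ∀ K : Finset Plane, volume (convexHull ℝ (K : Set Plane)) < ⊤ := fun K =>
    (isBounded_element K).measure_lt_top
  simp only [energy, one_mul]
  calc _ ≤ ∑ K ∈ T, ∫ x in convexHull ℝ (K : Set Plane),
        inner ℝ (gradient w' x) (gradient w' x) :=
        setIntegral_le_sum_element hT F.isOpen₁ F.subset₁ (fun x => real_inner_self_nonneg)
          fun K _ => integrableOn_inner_gradient hC hC (hfin K)
    _ ≤ ∑ K ∈ T, Real.pi / σ ^ 2 * (2 / r * J K) := Finset.sum_le_sum helem
    _ = Real.pi / σ ^ 2 * (2 / r) * ∑ K ∈ T, J K := by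
        rw [Finset.mul_sum]; exact Finset.sum_congr rfl fun _ _ => by ring
    _ ≤ Real.pi / σ ^ 2 * (2 / r) * (9 * h ^ 2 / r ^ 2 * ∫ s, g s) :=
        mul_le_mul_of_nonneg_left hsum (by positivity)
    _ = _ := by
        -- With `r = σ * τ * h`, the factors `π / σ ^ 2`, `2 / r` and `9 * h ^ 2 / r ^ 2` multiply
        -- to the stated constant times `1 / h`.
        rw [hr]
        field_simp
        ring

end

/-! ### The splitting of the finite element problem -/

theorem restrictTo_restrictTo {s t : Set Plane} (h : t ⊆ s) (u : Plane → ℝ) :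
    restrictTo t (restrictTo s u) = restrictTo t u := by
  change t.indicator (s.indicator u) = t.indicator u
  rw [Set.indicator_indicator, Set.inter_eq_left.2 h]

theorem restrictTo_congr {s : Set Plane} {u v : Plane → ℝ} (h : Set.EqOn u v s) :
    restrictTo s u = restrictTo s v := by
  ext x
  change s.indicator u x = s.indicator v x
  by_cases hx : x ∈ s
  · rw [Set.indicator_of_mem hx, Set.indicator_of_mem hx, h hx]
  · rw [Set.indicator_of_notMem hx, Set.indicator_of_notMem hx]

theorem eqOn_of_restrictTo_eq {s : Set Plane} {u v : Plane → ℝ}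
    (h : restrictTo s u = restrictTo s v) : Set.EqOn u v s := fun x hx => by
  rw [← restrictTo_eqOn s u hx, h, restrictTo_eqOn s v hx]

theorem pairing_nonneg (Γ : Set Plane) (u : Plane → ℝ) : 0 ≤ pairing Γ u u :=
  integral_nonneg fun _ => mul_self_nonneg _

section Forms

variable {T : Finset (Finset Plane)} {Ω Ω₁ Ω₂ : Set Plane} {L : AffineSubspace ℝ Plane} [Nonempty L]
  {p e n : Plane}

theorem energy_add_local (hT : IsTriangulation T Ω Ω₁ Ω₂) (F : IsMirrorFrame Ω Ω₁ Ω₂ L p e n)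
    {D : Set Plane} (hD : IsOpen D) (hDΩ : D ⊆ Ω) {x y z : Plane → ℝ}
    (hx : x ∈ localSpace T Ω D) (hy : y ∈ localSpace T Ω D) (hz : z ∈ localSpace T Ω D) :
    energy D 1 (x + y) z = energy D 1 x z + energy D 1 y z := by
  obtain ⟨u, hu, rfl⟩ := hx
  obtain ⟨v, hv, rfl⟩ := hy
  obtain ⟨w, hw, rfl⟩ := hz
  obtain ⟨_, h1⟩ := exists_lipschitzWith hT F.isOpen hu
  obtain ⟨_, h2⟩ := exists_lipschitzWith hT F.isOpen hv
  obtain ⟨_, h3⟩ := exists_lipschitzWith hT F.isOpen hw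
  rw [← map_add, energy_restrictTo hD, energy_restrictTo hD, energy_restrictTo hD]
  exact energy_add_left ((measure_mono hDΩ).trans_lt F.isBounded.measure_lt_top) h1 h2 h3

theorem energy_smul_local (hT : IsTriangulation T Ω Ω₁ Ω₂) (F : IsMirrorFrame Ω Ω₁ Ω₂ L p e n)
    {D : Set Plane} (hD : IsOpen D) (c : ℝ) {x z : Plane → ℝ} (hx : x ∈ localSpace T Ω D) :
    energy D 1 (c • x) z = c * energy D 1 x z := by
  obtain ⟨u, hu, rfl⟩ := hx
  obtain ⟨_, h1⟩ := exists_lipschitzWith hT F.isOpen hu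
  rw [← map_smul, energy_restrictTo_left hD, energy_restrictTo_left hD]
  exact energy_smul_left c h1

/-- The energy form on a local space. -/
def energyForm (hT : IsTriangulation T Ω Ω₁ Ω₂) (F : IsMirrorFrame Ω Ω₁ Ω₂ L p e n)
    {D : Set Plane} (hD : IsOpen D) (hDΩ : D ⊆ Ω) :
    localSpace T Ω D →ₗ[ℝ] localSpace T Ω D →ₗ[ℝ] ℝ :=
  LinearMap.mk₂ ℝ (fun x y => energy D 1 x y)
    (fun x y z => energy_add_local hT F hD hDΩ x.2 y.2 z.2)
    (fun c x _ => energy_smul_local hT F hD c x.2)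
    (fun x y z => by
      rw [energy_comm, energy_comm _ _ (x : Plane → ℝ) y, energy_comm _ _ (x : Plane → ℝ) z]
      exact energy_add_local hT F hD hDΩ y.2 z.2 x.2)
    (fun c x y => by
      rw [energy_comm, energy_comm _ _ (x : Plane → ℝ) y]
      exact energy_smul_local hT F hD c y.2)

theorem pairing_add_interface (F : IsMirrorFrame Ω Ω₁ Ω₂ L p e n) {x y z : Plane → ℝ}
    (hx : x ∈ interfaceSpace T Ω (interface Ω₁ Ω₂)) (hy : y ∈ interfaceSpace T Ω (interface Ω₁ Ω₂))
    (hz : z ∈ interfaceSpace T Ω (interface Ω₁ Ω₂)) :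
    pairing (interface Ω₁ Ω₂) (x + y) z =
      pairing (interface Ω₁ Ω₂) x z + pairing (interface Ω₁ Ω₂) y z := by
  obtain ⟨u, hu, rfl⟩ := hx
  obtain ⟨v, hv, rfl⟩ := hy
  obtain ⟨w, hw, rfl⟩ := hz
  have hΓ := isClosed_interface Ω₁ Ω₂
  rw [← map_add, pairing_congr hΓ (restrictTo_eqOn _ (u + v)) (restrictTo_eqOn _ w),
    pairing_congr hΓ (restrictTo_eqOn _ u) (restrictTo_eqOn _ w),
    pairing_congr hΓ (restrictTo_eqOn _ v) (restrictTo_eqOn _ w)]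
  exact pairing_add_left F hu hv hw.1

/-- The pairing on the interface space. -/
def pairingForm (F : IsMirrorFrame Ω Ω₁ Ω₂ L p e n) :
    interfaceSpace T Ω (interface Ω₁ Ω₂) →ₗ[ℝ] interfaceSpace T Ω (interface Ω₁ Ω₂) →ₗ[ℝ] ℝ :=
  LinearMap.mk₂ ℝ (fun x y => pairing (interface Ω₁ Ω₂) x y)
    (fun x y z => pairing_add_interface F x.2 y.2 z.2)
    (fun c x y => pairing_smul_left _ c x y)
    (fun x y z => by
      rw [pairing_comm, pairing_comm _ (x : Plane → ℝ) y, pairing_comm _ (x : Plane → ℝ) z]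
      exact pairing_add_interface F y.2 z.2 x.2)
    (fun c x y => by
      rw [pairing_comm, pairing_comm _ (x : Plane → ℝ) y]
      exact pairing_smul_left _ c y x)

/-- The load functional on a local space. -/
def loadForm (F : IsMirrorFrame Ω Ω₁ Ω₂ L p e n) {f : Plane → ℝ}
    (hf : MemLp f 2 (volume.restrict Ω)) {D : Set Plane} (hD : IsOpen D) (hDΩ : D ⊆ Ω) :
    localSpace T Ω D →ₗ[ℝ] ℝ where
  toFun x := load D f x
  map_add' := by
    rintro ⟨_, u, hu, rfl⟩ ⟨_, v, hv, rfl⟩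
    change load D f (restrictTo _ u + restrictTo _ v) = _
    rw [← map_add, load_restrictTo hD, load_restrictTo hD, load_restrictTo hD]
    exact load_add F hf hDΩ hu hv
  map_smul' c x := load_smul D f c x

/-- The trace on the interface. -/
def trace (T : Finset (Finset Plane)) (Ω : Set Plane) {D Γ : Set Plane} (h : Γ ⊆ closure D) :
    localSpace T Ω D →ₗ[ℝ] interfaceSpace T Ω Γ :=
  (restrictTo Γ).restrict (by
    rintro _ ⟨u, hu, rfl⟩
    rw [restrictTo_restrictTo h]
    exact ⟨u, hu, rfl⟩)

theorem comp_reflection_mem_localSpace (F : IsMirrorFrame Ω Ω₁ Ω₂ L p e n)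
    (hTL : IsMirrorSymmetricMesh T L) {x : Plane → ℝ} (hx : x ∈ localSpace T Ω Ω₁) :
    x ∘ EuclideanGeometry.reflection L ∈ localSpace T Ω Ω₂ := by
  obtain ⟨u, hu, rfl⟩ := hx
  refine ⟨u ∘ EuclideanGeometry.reflection L, comp_reflection_mem F hTL hu, ?_⟩
  change Set.indicator _ _ = Set.indicator _ _ ∘ _
  rw [← F.preimage_closure_eq]
  rfl

/-- The restriction of the finite element space to a local space. -/
def localMap (T : Finset (Finset Plane)) (Ω D : Set Plane) : feSpace T Ω →ₗ[ℝ] localSpace T Ω D :=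
  (restrictTo (closure D)).submoduleMap (feSpace T Ω)

theorem coe_localMap (D : Set Plane) (w : feSpace T Ω) :
    (localMap T Ω D w : Plane → ℝ) = restrictTo (closure D) w := rfl

theorem localMap_surjective (D : Set Plane) : Function.Surjective (localMap T Ω D) := by
  rintro ⟨_, u, hu, rfl⟩
  exact ⟨⟨u, hu⟩, rfl⟩

theorem coe_trace {D Γ : Set Plane} (h : Γ ⊆ closure D) (x : localSpace T Ω D) :
    (trace T Ω h x : Plane → ℝ) = restrictTo Γ x := rfl

theorem trace_localMap {D Γ : Set Plane} (h : Γ ⊆ closure D) (w : feSpace T Ω) :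
    (trace T Ω h (localMap T Ω D w) : Plane → ℝ) = restrictTo Γ w := by
  rw [coe_trace, coe_localMap, restrictTo_restrictTo h]

theorem trace_surjective {D Γ : Set Plane} (h : Γ ⊆ closure D) :
    Function.Surjective (trace T Ω h) := by
  rintro ⟨_, u, hu, rfl⟩
  exact ⟨localMap T Ω D ⟨u, hu⟩, Subtype.ext (trace_localMap h _)⟩

/-- Reflection as a map between the local spaces. -/
def reflectLocal (F : IsMirrorFrame Ω Ω₁ Ω₂ L p e n) (hTL : IsMirrorSymmetricMesh T L)
    (x : localSpace T Ω Ω₁) : localSpace T Ω Ω₂ :=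
  ⟨x ∘ EuclideanGeometry.reflection L, comp_reflection_mem_localSpace F hTL x.2⟩

theorem reflectLocal_surjective (F : IsMirrorFrame Ω Ω₁ Ω₂ L p e n)
    (hTL : IsMirrorSymmetricMesh T L) : Function.Surjective (reflectLocal (T := T) F hTL) := by
  rintro ⟨_, v, hv, rfl⟩
  refine ⟨⟨restrictTo (closure Ω₁) (v ∘ EuclideanGeometry.reflection L), _,
    comp_reflection_mem F hTL hv, rfl⟩, Subtype.ext ?_⟩
  change Set.indicator _ _ ∘ _ = Set.indicator _ _
  rw [← F.preimage_closure_eq]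
  ext y
  classical
  simp only [Function.comp_apply, Set.indicator_apply, Set.mem_preimage,
    EuclideanGeometry.reflection_reflection]

theorem trace_reflectLocal (F : IsMirrorFrame Ω Ω₁ Ω₂ L p e n) (hTL : IsMirrorSymmetricMesh T L)
    (x : localSpace T Ω Ω₁) :
    trace T Ω IsMirrorFrame.interface_subset₂ (reflectLocal F hTL x) =
      trace T Ω IsMirrorFrame.interface_subset₁ x :=
  Subtype.ext <| restrictTo_congr fun y hy => by
    change (x : Plane → ℝ) (EuclideanGeometry.reflection L y) = (x : Plane → ℝ) y
    rw [F.reflection_eq_self (F.height_interface y hy)]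

/-- A local function with zero trace extends by zero across the interface and stays in the finite
element space because no element is cut. -/
theorem exists_glue (hT : IsTriangulation T Ω Ω₁ Ω₂) (F : IsMirrorFrame Ω Ω₁ Ω₂ L p e n)
    (x : localSpace T Ω Ω₁)
    (h : trace T Ω (IsMirrorFrame.interface_subset₁ (Ω₁ := Ω₁) (Ω₂ := Ω₂)) x = 0) :
    ∃ w, localMap T Ω Ω₁ w = x ∧ localMap T Ω Ω₂ w = 0 := by
  obtain ⟨⟨u, hu⟩, rfl⟩ := localMap_surjective Ω₁ x
  have h1 : restrictTo (interface Ω₁ Ω₂) u = restrictTo (interface Ω₁ Ω₂) 0 := by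
    rw [map_zero]
    exact (trace_localMap IsMirrorFrame.interface_subset₁ ⟨u, hu⟩).symm.trans
      (congrArg Subtype.val h)
  have hu0 : ∀ x ∈ interface Ω₁ Ω₂, u x = 0 := fun x hx => eqOn_of_restrictTo_eq h1 hx
  refine ⟨⟨_, restrictTo_mem hT F hu hu0⟩, Subtype.ext (restrictTo_restrictTo subset_rfl u),
    Subtype.ext ?_⟩
  change restrictTo (closure Ω₂) (restrictTo (closure Ω₁) u) = 0
  rw [← map_zero (restrictTo (closure Ω₂))]
  refine restrictTo_congr fun y hy => ?_
  change Set.indicator _ _ _ = _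
  by_cases hy1 : y ∈ closure Ω₁
  · rw [Set.indicator_of_mem hy1]
    exact eq_zero_of_height_eq_zero F hu hu0
      (le_antisymm (F.height_nonpos hy) (F.height_nonneg hy1))
  · rw [Set.indicator_of_notMem hy1]; rfl

theorem eq_zero_of_localMap_eq_zero (F : IsMirrorFrame Ω Ω₁ Ω₂ L p e n) (w : feSpace T Ω)
    (h1 : localMap T Ω Ω₁ w = 0) (h2 : localMap T Ω Ω₂ w = 0) : w = 0 := by
  have h1' : restrictTo (closure Ω₁) (w : Plane → ℝ) = restrictTo (closure Ω₁) 0 := by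
    rw [map_zero]; exact congrArg Subtype.val h1
  have h2' : restrictTo (closure Ω₂) (w : Plane → ℝ) = restrictTo (closure Ω₂) 0 := by
    rw [map_zero]; exact congrArg Subtype.val h2
  refine Subtype.ext (funext fun x => ?_)
  change (w : Plane → ℝ) x = 0
  by_cases hx : x ∈ Ω
  · rcases F.mem_closure_or hx with h | h
    · exact eqOn_of_restrictTo_eq h1' h
    · exact eqOn_of_restrictTo_eq h2' h
  · exact w.2.2.1 x hx

theorem eq_zero_of_energyForm_eq_zero (hT : IsTriangulation T Ω Ω₁ Ω₂)
    (F : IsMirrorFrame Ω Ω₁ Ω₂ L p e n) (x : localSpace T Ω Ω₁)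
    (h : energy Ω₁ 1 x x = 0) : x = 0 := by
  obtain ⟨⟨u, hu⟩, rfl⟩ := localMap_surjective Ω₁ x
  rw [coe_localMap, energy_restrictTo F.isOpen₁] at h
  refine Subtype.ext ?_
  rw [coe_localMap]
  change restrictTo (closure Ω₁) u = 0
  rw [← map_zero (restrictTo (closure Ω₁))]
  exact restrictTo_congr fun x hx => eq_zero_of_energy_eq_zero hT F hu h hx

theorem eq_zero_of_pairing_eq_zero (F : IsMirrorFrame Ω Ω₁ Ω₂ L p e n)
    (x : interfaceSpace T Ω (interface Ω₁ Ω₂)) (h : pairing (interface Ω₁ Ω₂) x x = 0) :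
    x = 0 := by
  obtain ⟨_, u, hu, rfl⟩ := x
  simp only at h
  rw [pairing_congr (isClosed_interface Ω₁ Ω₂) (restrictTo_eqOn _ u) (restrictTo_eqOn _ u),
    pairing_eq F hu] at h
  refine Subtype.ext ?_
  change restrictTo (interface Ω₁ Ω₂) u = 0
  rw [← map_zero (restrictTo (interface Ω₁ Ω₂))]
  refine restrictTo_congr fun x hx => ?_
  obtain ⟨s, hs⟩ := F.exists_eq_frameMap x
  rw [hs, F.height_interface x hx]
  exact eq_zero_of_integral_axis F hu h.le s

/-- The splitting of the finite element problem into the problems in the subdomains. -/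
def mirrorSplitting (hT : IsTriangulation T Ω Ω₁ Ω₂) (F : IsMirrorFrame Ω Ω₁ Ω₂ L p e n)
    (hTL : IsMirrorSymmetricMesh T L) :
    MirrorSplitting (feSpace T Ω) (localSpace T Ω Ω₁) (localSpace T Ω Ω₂)
      (interfaceSpace T Ω (interface Ω₁ Ω₂)) where
  r₁ := localMap T Ω Ω₁
  r₂ := localMap T Ω Ω₂
  tr₁ := trace T Ω IsMirrorFrame.interface_subset₁
  tr₂ := trace T Ω IsMirrorFrame.interface_subset₂
  a₁ := energyForm hT F F.isOpen₁ F.subset₁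
  a₂ := energyForm hT F F.isOpen₂ F.subset₂
  b := pairingForm F
  J := reflectLocal F hTL
  tr_J := trace_reflectLocal F hTL
  a_J x y := energy_comp_reflection F 1 (x : Plane → ℝ) (y : Plane → ℝ)
  J_surj := reflectLocal_surjective F hTL
  r₂_surj := localMap_surjective Ω₂
  tr₁_surj := trace_surjective IsMirrorFrame.interface_subset₁
  tr_r w := Subtype.ext <| (trace_localMap IsMirrorFrame.interface_subset₁ w).trans
    (trace_localMap IsMirrorFrame.interface_subset₂ w).symm
  glue := exists_glue hT F
  r_inj := eq_zero_of_localMap_eq_zero F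
  a_symm x y := energy_comm Ω₁ 1 (x : Plane → ℝ) (y : Plane → ℝ)
  a_nonneg x := energy_nonneg Ω₁ (x : Plane → ℝ)
  a_def := eq_zero_of_energyForm_eq_zero hT F
  b_symm x y := pairing_comm (interface Ω₁ Ω₂) (x : Plane → ℝ) (y : Plane → ℝ)
  b_nonneg x := pairing_nonneg (interface Ω₁ Ω₂) (x : Plane → ℝ)
  b_def := eq_zero_of_pairing_eq_zero F

/-- The pairings see only traces, and the coefficient factors out of the energy. This brings the
concrete problem to the form solved by `MirrorSplitting.robin₁` and `MirrorSplitting.robin₂`. -/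
theorem isRobinSolution_iff {D Γ : Set Plane} (hΓ : IsClosed Γ) (hΓD : Γ ⊆ closure D) (ν γ : ℝ)
    (f : Plane → ℝ) (g : interfaceSpace T Ω Γ) (u : localSpace T Ω D) :
    IsRobinSolution T Ω D Γ ν γ f g u ↔
      ∀ x : localSpace T Ω D, ν * energy D 1 u x +
        γ * pairing Γ (trace T Ω hΓD u : Plane → ℝ) (trace T Ω hΓD x : Plane → ℝ) =
          load D f x + pairing Γ g (trace T Ω hΓD x : Plane → ℝ) := by
  have htr : ∀ x : localSpace T Ω D, Set.EqOn (trace T Ω hΓD x : Plane → ℝ) x Γ := fun x =>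
    restrictTo_eqOn Γ (x : Plane → ℝ)
  have key : ∀ x : localSpace T Ω D, (ν * energy D 1 u x +
        γ * pairing Γ (trace T Ω hΓD u : Plane → ℝ) (trace T Ω hΓD x : Plane → ℝ) =
          load D f x + pairing Γ g (trace T Ω hΓD x : Plane → ℝ)) ↔
      energy D ν u x + γ * pairing Γ u x = load D f x + pairing Γ g x := fun x => by
    rw [pairing_congr hΓ (htr u) (htr x), pairing_congr hΓ (Set.eqOn_refl (g : Plane → ℝ) Γ) (htr x),
      energy_eq_mul D ν]
  constructor
  · intro h x
    exact (key x).2 (h.2 x x.2)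
  · intro h
    exact ⟨u.2, fun v hv => (key ⟨v, hv⟩).1 (h ⟨v, hv⟩)⟩

theorem isRRErrorOperator (hT : IsTriangulation T Ω Ω₁ Ω₂) (F : IsMirrorFrame Ω Ω₁ Ω₂ L p e n)
    (hTL : IsMirrorSymmetricMesh T L) [FiniteDimensional ℝ (feSpace T Ω)]
    [FiniteDimensional ℝ (localSpace T Ω Ω₁)] [FiniteDimensional ℝ (localSpace T Ω Ω₂)]
    [FiniteDimensional ℝ (interfaceSpace T Ω (interface Ω₁ Ω₂))]
    {ν₁ ν₂ γ₁ γ₂ : ℝ} (hν₁ : 0 < ν₁) (hν₂ : 0 < ν₂) (hγ₁ : 0 ≤ γ₁) (hγ₂ : 0 ≤ γ₂) (θ : ℝ) :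
    IsRRErrorOperator T Ω Ω₁ Ω₂ ν₁ ν₂ γ₁ γ₂ θ
      ((mirrorSplitting hT F hTL).errorOperator hν₁ hν₂ hγ₁ hγ₂ θ) := by
  intro f hf
  have hΓ := isClosed_interface Ω₁ Ω₂
  set S := mirrorSplitting hT F hTL with hS
  obtain ⟨gs, w, hw, h₁, h₂⟩ := S.exists_exactDatum hν₁ hν₂ γ₁ γ₂
    (loadForm F hf F.isOpen₁ F.subset₁) (loadForm F hf F.isOpen₂ F.subset₂)
  refine ⟨gs, ⟨w, ⟨w.2, fun v hv => ?_⟩, ?_⟩, fun g g' => ?_⟩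
  · have h : ν₁ * energy Ω₁ 1 (restrictTo (closure Ω₁) w) (restrictTo (closure Ω₁) v) +
        ν₂ * energy Ω₂ 1 (restrictTo (closure Ω₂) w) (restrictTo (closure Ω₂) v) =
        load Ω₁ f (restrictTo (closure Ω₁) v) + load Ω₂ f (restrictTo (closure Ω₂) v) := hw ⟨v, hv⟩
    rwa [energy_restrictTo F.isOpen₁, energy_restrictTo F.isOpen₂, load_restrictTo F.isOpen₁,
      load_restrictTo F.isOpen₂, ← energy_eq_mul, ← energy_eq_mul] at h
  · exact (isRobinSolution_iff hΓ IsMirrorFrame.interface_subset₁ ν₁ γ₁ f gs (S.r₁ w)).2 h₁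
  · rw [← S.step_iff hν₁ hν₂ hγ₁ hγ₂ θ _ _ gs w h₁ h₂]
    constructor
    · rintro ⟨u₁, g₂, u₂, gt, k₁, rfl, k₂, rfl, hg'⟩
      refine ⟨⟨u₁, k₁.1⟩, ⟨u₂, k₂.1⟩, ?_, ?_, Subtype.ext hg'⟩
      · exact (isRobinSolution_iff hΓ IsMirrorFrame.interface_subset₁ ν₁ γ₁ f g ⟨u₁, k₁.1⟩).1 k₁
      · exact (isRobinSolution_iff hΓ IsMirrorFrame.interface_subset₂ ν₂ γ₂ f
          ((γ₁ + γ₂) • S.tr₁ ⟨u₁, k₁.1⟩ - g) ⟨u₂, k₂.1⟩).1 k₂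
    · rintro ⟨u₁, u₂, k₁, k₂, hg'⟩
      refine ⟨u₁, _, u₂, _, ?_, rfl, ?_, rfl, congrArg Subtype.val hg'⟩
      · exact (isRobinSolution_iff hΓ IsMirrorFrame.interface_subset₁ ν₁ γ₁ f g u₁).2 k₁
      · exact (isRobinSolution_iff hΓ IsMirrorFrame.interface_subset₂ ν₂ γ₂ f
          ((γ₁ + γ₂) • S.tr₁ u₁ - g) u₂).2 k₂

end Forms

end RobinRobin
end

/-! ### The theorem: the constants and the two spectral bounds. -/

theorem mainTheorem7 (Ω Ω₁ Ω₂ : Set RobinRobin.Plane)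
    (hdec : RobinRobin.IsDecomposition Ω Ω₁ Ω₂)
    (L : AffineSubspace ℝ RobinRobin.Plane) [Nonempty L]
    (hsymm : RobinRobin.IsMirrorSymmetric Ω₁ Ω₂ L)
    (σ τ : ℝ) (hσ : 0 < σ) (hτ : 0 < τ) :
    ∃ c₀ C₁ : ℝ, 0 < c₀ ∧ 0 < C₁ ∧
      ∀ T : Finset (Finset RobinRobin.Plane),
        RobinRobin.IsTriangulation T Ω Ω₁ Ω₂ →
        RobinRobin.IsMirrorSymmetricMesh T L →
        RobinRobin.IsShapeRegular σ T →
        RobinRobin.IsQuasiUniform τ T →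
        ∀ ν₁ ν₂ γ₁ γ₂ θ : ℝ, 0 < ν₁ → 0 < ν₂ →
          C₁ * ν₂ * (RobinRobin.meshSize T)⁻¹ ≤ γ₁ →
          0 < γ₂ → γ₂ ≤ c₀ * ν₁ →
          θ = 2 / (2 + ν₁ / ν₂) →
          ∃ R : Module.End ℝ (RobinRobin.interfaceSpace T Ω (RobinRobin.interface Ω₁ Ω₂)),
            RobinRobin.IsRRErrorOperator T Ω Ω₁ Ω₂ ν₁ ν₂ γ₁ γ₂ θ R ∧
            RobinRobin.convergenceRate R < ENNReal.ofReal (ν₁ / (2 * ν₂)) := by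
  open RobinRobin in
  obtain ⟨p, e, n, F⟩ := exists_mirrorFrame hdec hsymm
  obtain ⟨M', hM'⟩ := (F.isBounded.isCompact_closure.image (continuous_height p n)).bddAbove
  -- `M` bounds the height over `Ω`; the maximum with one makes its positivity immediate.
  set M := max M' 1 with hMdef
  have hM0 : 0 < M := lt_max_of_lt_right one_pos
  have hM : ∀ x ∈ Ω, height p n x ≤ M := fun x hx =>
    (hM' ⟨x, subset_closure hx, rfl⟩).trans (le_max_left _ _)
  have hC₁ : 0 < 18 * Real.pi / (σ ^ 5 * τ ^ 3) := by have := Real.pi_pos; positivity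
  -- The first constant comes from the trace inequality and the second from the inverse estimate;
  -- neither involves the mesh.
  refine ⟨M⁻¹, 18 * Real.pi / (σ ^ 5 * τ ^ 3), inv_pos.2 hM0, hC₁, ?_⟩
  intro T hT hTL hreg hqu ν₁ ν₂ γ₁ γ₂ θ hν₁ hν₂ hγ₁ hγ₂ hγ₂c hθ
  have hh : 0 < meshSize T := meshSize_pos hT F.nonempty
  have hγ₁0 : 0 ≤ γ₁ := le_trans (by positivity) hγ₁
  have := finiteDimensional_feSpace hT
  have : FiniteDimensional ℝ (localSpace T Ω Ω₁) := by unfold localSpace; infer_instance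
  have : FiniteDimensional ℝ (localSpace T Ω Ω₂) := by unfold localSpace; infer_instance
  have : FiniteDimensional ℝ (interfaceSpace T Ω (interface Ω₁ Ω₂)) := by
    unfold interfaceSpace; infer_instance
  have hΓ := isClosed_interface Ω₁ Ω₂
  have hpair : ∀ u ∈ feSpace T Ω, pairing (interface Ω₁ Ω₂) (restrictTo (interface Ω₁ Ω₂) u)
      (restrictTo (interface Ω₁ Ω₂) u) =
        ∫ s : ℝ, u (frameMap p e n (s, 0)) * u (frameMap p e n (s, 0)) := fun u hu => by
    rw [pairing_congr hΓ (restrictTo_eqOn _ u) (restrictTo_eqOn _ u), pairing_eq F hu]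
  refine ⟨_, isRRErrorOperator hT F hTL hν₁ hν₂ hγ₁0 hγ₂.le θ,
    MirrorSplitting.convergenceRate_errorOperator_lt _ (c := M⁻¹)
      (Λ := 18 * Real.pi / (σ ^ 5 * τ ^ 3) * (meshSize T)⁻¹) hν₁ hν₂ hγ₁0 hγ₂.le ?_ ?_ ?_ hγ₂c hθ⟩
  · rintro ⟨_, u, hu, rfl⟩
    change M⁻¹ * pairing (interface Ω₁ Ω₂)
      (restrictTo (interface Ω₁ Ω₂) (restrictTo (closure Ω₁) u))
      (restrictTo (interface Ω₁ Ω₂) (restrictTo (closure Ω₁) u)) ≤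
      energy Ω₁ 1 (restrictTo (closure Ω₁) u) (restrictTo (closure Ω₁) u)
    obtain ⟨C, hC⟩ := exists_lipschitzWith hT F.isOpen hu
    rw [restrictTo_restrictTo IsMirrorFrame.interface_subset₁, hpair u hu,
      energy_restrictTo F.isOpen₁, inv_mul_le_iff₀ hM0]
    exact integral_sq_le_energy F hu hC hM0.le hM le_rfl
  · rintro ⟨_, w, hw, rfl⟩
    obtain ⟨w', hw', htr, hE⟩ := exists_lift hT F hσ hτ hreg hqu hw
    refine ⟨⟨restrictTo (closure Ω₁) w', w', hw', rfl⟩, Subtype.ext ?_, ?_⟩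
    · change restrictTo (interface Ω₁ Ω₂) (restrictTo (closure Ω₁) w') =
        restrictTo (interface Ω₁ Ω₂) w
      rw [restrictTo_restrictTo IsMirrorFrame.interface_subset₁]
      exact restrictTo_congr fun x hx => htr x (F.height_interface x hx)
    · change energy Ω₁ 1 (restrictTo (closure Ω₁) w') (restrictTo (closure Ω₁) w') ≤
        _ * pairing (interface Ω₁ Ω₂) (restrictTo (interface Ω₁ Ω₂) w)
          (restrictTo (interface Ω₁ Ω₂) w)
      rw [energy_restrictTo F.isOpen₁, hpair w hw]
      exact hE
  · calc _ = 18 * Real.pi / (σ ^ 5 * τ ^ 3) * ν₂ * (meshSize T)⁻¹ := by ring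
      _ ≤ γ₁ := hγ₁
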